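/- Let $\Delta$ be a finite (geometric) simplicial complex. It is a normal $3$-pseudomanifold if all its maximal faces (facets) are $3$-simplices, every triangle lies in exactly two facets, and the link of every face of dimension at most $1$, including the empty face (whose link is $\Delta$ itself), is connected; it is balanced if its vertices can be coloured by $\kappa:V(\Delta)\to\{0,1,2,3\}$ so that no simplex has two vertices of the same colour. For a balanced normal $3$-pseudomanifold, the dual graph $\Lambda(\Delta)$ has the facets as vertices, two of them being joined by an edge when they share a triangle; this edge gets the colour $c$ that is missing from the triangle. For each cyclic ordering $\varepsilon=(\varepsilon_0,\varepsilon_1,\varepsilon_2,\varepsilon_3)$ of the four colours, $\Lambda(\Delta)$ embeds in a closed surface $F_\varepsilon$ whose cell structure has the vertices and edges of $\Lambda(\Delta)$, with the $2$-cells bounded exactly by the bi-coloured cycles of colours $\varepsilon_i,\varepsilon_{i+1}$, $i\in\mathbb Z_4$. Put $\rho_\varepsilon(\Delta)=1-\tfrac12\chi(F_\varepsilon)$ (the genus of $F_\varepsilon$ if it is orientable, half its genus otherwise), and $\mathcal G(\Delta)=\min_\varepsilon\rho_\varepsilon(\Delta)$. The balanced genus of a closed $3$-manifold $M$ is $$\mathcal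 G_M=\min\{\mathcal G(\Delta)\;:\;\Delta\text{ a balanced triangulation of }M\},$$ where a balanced triangulation of $M$ is a balanced normal $3$-pseudomanifold whose geometric carrier is homeomorphic to $M$. **Theorem.** Let $M$ be a closed (compact, without boundary) connected $3$-manifold that is not homeomorphic to the $3$-sphere. Then $$\mathcal G_M\;\ge\; m(M)+3,$$ where $m(M)$ is the rank of the fundamental group $\pi_1(M)$, i.e. its minimal number of generators. -/

import Mathlib

open Geometry

/-- The minimal number of generators of a group, with value `⊤` if the group is not finitely
generated. -/
noncomputable def groupRank (G : Type*) [Group G] : ℕ∞ :=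
  ⨅ S : {S : Set G // Subgroup.closure S = ⊤}, (S : Set G).encard

section Complexes

variable {E : Type*} [AddCommGroup E] [Module ℝ E]

open Classical in
/-- The nonempty faces of the link of `σ` in `K`. For `σ = ∅` (the face of dimension `-1` of
every complex, which `K.faces` does not list) these are all the faces of `K`. -/
def linkFaces (K : SimplicialComplex ℝ E) (σ : Finset E) : Set (Finset E) :=
  {τ | τ ∈ K.faces ∧ Disjoint τ σ ∧ τ ∪ σ ∈ K.faces}

open Classical in
/-- The graph (1-skeleton) of the link of `σ` in `K`. -/
def linkGraph (K : SimplicialComplex ℝ E) (σ : Finset E) :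
    SimpleGraph {v : E // {v} ∈ linkFaces K σ} where
  Adj u v := u ≠ v ∧ ({(u : E), (v : E)} : Finset E) ∈ linkFaces K σ
  symm := ⟨fun u v h => ⟨h.1.symm, by rw [Finset.pair_comm]; exact h.2⟩⟩
  loopless := ⟨fun _ h => h.1 rfl⟩

/-- A (closed, connected) normal `d`-pseudomanifold: a finite complex, pure of dimension `d`, in
which every `(d-1)`-face lies in exactly two facets and in which the link of every face of
codimension at least two, the empty face included, is connected. A face with `k` vertices has
dimension `k - 1`. A complex is connected when it has a vertex and its graph is connected. -/
structure IsNormalPseudomanifold (d : ℕ) (K : SimplicialComplex ℝ E) : Prop where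
  finite : K.faces.Finite
  pure : ∀ σ ∈ K.facets, σ.card = d + 1
  two_facets : ∀ σ ∈ K.faces, σ.card = d → {τ | τ ∈ K.facets ∧ σ ⊆ τ}.ncard = 2
  connected_link : ∀ σ : Finset E, σ = ∅ ∨ σ ∈ K.faces → σ.card + 1 ≤ d →
    (linkGraph K σ).Connected

/-- `κ` is a balanced colouring of `K` with the colours `0, …, d`: every face has at most one
vertex of each colour. Only the values of `κ` on the vertices of `K` matter. -/
def IsBalancedColoring (d : ℕ) (K : SimplicialComplex ℝ E) (κ : E → Fin (d + 1)) : Prop :=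
  ∀ σ ∈ K.faces, Set.InjOn κ (σ : Set E)

open Classical in
/-- The dual graph: its vertices are the facets, two of them adjacent when they share a
`(d-1)`-simplex. -/
def dualGraph (d : ℕ) (K : SimplicialComplex ℝ E) : SimpleGraph {σ : Finset E // σ ∈ K.facets} where
  Adj σ τ := σ ≠ τ ∧ ((σ : Finset E) ∩ (τ : Finset E)).card = d
  symm := ⟨fun σ τ h => ⟨h.1.symm, by rw [Finset.inter_comm]; exact h.2⟩⟩
  loopless := ⟨fun _ h => h.1 rfl⟩

open Classical in
/-- The edge `{σ, τ}` of the dual graph has colour `c` when the colours of the vertices of `σ ∩ τ`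
are exactly the colours other than `c`. This is the spanning subgraph of the dual graph that
consists of the edges whose colour is `a` or `b`. -/
def bicoloredGraph (d : ℕ) (K : SimplicialComplex ℝ E) (κ : E → Fin (d + 1)) (a b : Fin (d + 1)) :
    SimpleGraph {σ : Finset E // σ ∈ K.facets} where
  Adj σ τ := (dualGraph d K).Adj σ τ ∧ ∃ c : Fin (d + 1), (c = a ∨ c = b) ∧
    ((σ : Finset E) ∩ (τ : Finset E)).image κ = {c}ᶜ
  symm := ⟨fun σ τ h => ⟨h.1.symm, by rw [Finset.inter_comm]; exact h.2⟩⟩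
  loopless := ⟨fun _ h => h.1.1 rfl⟩

/-- The number of bi-coloured cycles with colours `a` and `b` in the dual graph. For a balanced
normal pseudomanifold the graph of these two colours is 2-regular, so these cycles are its
connected components. -/
noncomputable def bicoloredCycleCount (d : ℕ) (K : SimplicialComplex ℝ E) (κ : E → Fin (d + 1))
    (a b : Fin (d + 1)) : ℕ :=
  Nat.card (bicoloredGraph d K κ a b).ConnectedComponent

/-- The Euler characteristic `V - E + F` of the closed surface `F_ε` into which the dual graph
embeds regularly with respect to the cyclic order `(ε 0, ε 1, …, ε d)` of the colours. The vertices
and edges of its cell structure are those of the dual graph, and its 2-cells are discs glued in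
along the bi-coloured cycles with colours `ε i`, `ε (i + 1)`, where `i` runs over `ℤ/(d+1)`. -/
noncomputable def surfaceEulerChar (d : ℕ) (K : SimplicialComplex ℝ E) (κ : E → Fin (d + 1))
    (ε : Equiv.Perm (Fin (d + 1))) : ℤ :=
  (Nat.card {σ : Finset E // σ ∈ K.facets} : ℤ) - (dualGraph d K).edgeSet.ncard
    + ∑ i : Fin (d + 1), (bicoloredCycleCount d K κ (ε i) (ε (i + 1)) : ℤ)

/-- The balanced `ε`-genus `1 - χ(F_ε) / 2`: the genus of `F_ε` if this surface is orientable, and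
half of its (non-orientable) genus otherwise. -/
noncomputable def balancedGenusAt (d : ℕ) (K : SimplicialComplex ℝ E) (κ : E → Fin (d + 1))
    (ε : Equiv.Perm (Fin (d + 1))) : ℝ :=
  1 - (surfaceEulerChar d K κ ε : ℝ) / 2

/-- The balanced genus of a balanced complex: the smallest balanced `ε`-genus over the finitely
many cyclic orders `ε` of the colours. -/
noncomputable def complexBalancedGenus (d : ℕ) (K : SimplicialComplex ℝ E) (κ : E → Fin (d + 1)) :
    ℝ :=
  Finset.univ.inf' Finset.univ_nonempty (balancedGenusAt d K κ)

end Complexes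

/-- A balanced triangulation of a space `M` of dimension `d`: a balanced normal `d`-pseudomanifold
in some `ℝⁿ` whose geometric carrier is homeomorphic to `M`. -/
structure BalancedTriangulation (d : ℕ) (M : Type*) [TopologicalSpace M] where
  n : ℕ
  complex : SimplicialComplex ℝ (EuclideanSpace ℝ (Fin n))
  normal : IsNormalPseudomanifold d complex
  color : EuclideanSpace ℝ (Fin n) → Fin (d + 1)
  balanced : IsBalancedColoring d complex color
  homeo : complex.space ≃ₜ M

/-- The balanced genus of a `d`-dimensional space: the least balanced genus of its balanced
triangulations (`⊤` if it had none). -/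
noncomputable def balancedGenus (d : ℕ) (M : Type*) [TopologicalSpace M] : EReal :=
  ⨅ T : BalancedTriangulation d M, (complexBalancedGenus d T.complex T.color : EReal)

/-!
Given a cyclic order `ε` of the colours, split them into the pairs `{ε 0, ε 2}` and `{ε 1, ε 3}`.
Every facet is the join of an edge of the graph `G` spanned by the first two colours and an edge of
the graph `G'` spanned by the last two. The fundamental group is generated by the edges of `G`
outside a spanning tree. An edge of `G` lying in the link of a vertex `y` of `G'` may be traded for
a path in the rest of that link, so some edges of `G` may be dropped as generators. The surface
`F_ε` separates `G` from `G'`, and since the links of the vertices of `G'` are connected surfaces,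
with Euler characteristic at most two, `ρ_ε ≥ E(G) - V(G) + 1`. Hence three edges that can be
dropped at the same time, in `G` or in `G'`, give the bound. If neither graph has three such edges,
each of them is a circle or a theta graph, and the complex is a sphere.
-/

/-! ### Graphs on the vertices of a complex -/

section Graphs

variable {V : Type*}

/-- The vertices of `G` that are not isolated lie in one component. -/
def SupportConnected (G : SimpleGraph V) : Prop :=
  ∀ ⦃u⦄, u ∈ G.support → ∀ ⦃v⦄, v ∈ G.support → G.Reachable u v

lemma SupportConnected.supp_connectedComponentMk {G : SimpleGraph V} (hG : SupportConnected G)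
    {r : V} (hr : r ∈ G.support) : (G.connectedComponentMk r).supp = G.support := by
  ext v
  rw [SimpleGraph.ConnectedComponent.mem_supp_iff, SimpleGraph.ConnectedComponent.eq]
  refine ⟨fun ⟨w⟩ => ?_, fun h => hG h hr⟩
  cases w with
  | nil => exact hr
  | cons hadj _ => exact (SimpleGraph.mem_support _).2 ⟨_, hadj⟩

/-- The graph that joins any two distinct vertices of the same component of `G`. -/
def reachGraph (G : SimpleGraph V) : SimpleGraph V where
  Adj x y := x ≠ y ∧ G.Reachable x y
  symm := ⟨fun _ _ h => ⟨h.1.symm, h.2.symm⟩⟩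
  loopless := ⟨fun _ h => h.1 rfl⟩

lemma le_reachGraph (G : SimpleGraph V) : G ≤ reachGraph G :=
  fun _ _ h => ⟨h.ne, h.reachable⟩

lemma reachable_of_le_reachGraph {G H : SimpleGraph V} (h : H ≤ reachGraph G) {x y : V}
    (hxy : H.Reachable x y) : G.Reachable x y := by
  obtain ⟨w⟩ := hxy
  induction w with
  | nil => rfl
  | cons hadj _ ih => exact (h hadj).2.trans ih

lemma ncard_supp_le_ncard_edgeSet_add_one [Finite V] {G : SimpleGraph V}
    (c : G.ConnectedComponent) : c.supp.ncard ≤ G.edgeSet.ncard + 1 := by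
  have hcard : Nat.card c.toSimpleGraph.edgeSet ≤ Nat.card G.edgeSet :=
    Nat.card_le_card_of_injective _
      (SimpleGraph.Hom.mapEdgeSet.injective c.toSimpleGraph_hom Subtype.val_injective)
  exact c.connected_toSimpleGraph.card_vert_le_card_edgeSet_add_one.trans
    (Nat.add_le_add_right hcard 1)

lemma ncard_edgeSet_add_one_of_isAcyclic [Finite V] {G : SimpleGraph V} (hG : G.IsAcyclic)
    {c : G.ConnectedComponent} (hc : G.support ⊆ c.supp) :
    G.edgeSet.ncard + 1 = c.supp.ncard := by
  classical
  have := Fintype.ofFinite V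
  have htree : (G.induce c.supp).IsTree := hG.isTree_connectedComponent c
  rw [← Nat.card_coe_set_eq c.supp, Nat.card_eq_fintype_card, ← SimpleGraph.coe_edgeFinset,
    Set.ncard_coe_finset, ← G.card_edgeFinset_induce_of_support_subset hc, htree.card_edgeFinset]

lemma sum_ncard_neighborSet [Fintype V] (G : SimpleGraph V) :
    ∑ v, (G.neighborSet v).ncard = 2 * G.edgeSet.ncard := by
  classical
  rw [← SimpleGraph.coe_edgeFinset, Set.ncard_coe_finset, ← G.sum_degrees_eq_twice_card_edges]
  refine Finset.sum_congr rfl fun v _ => ?_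
  rw [← SimpleGraph.card_neighborSet_eq_degree, Set.ncard_eq_toFinset_card', Set.toFinset_card]

end Graphs

/-! ### Removable edges -/

/-- The combinatorial data of a balanced `3`-complex whose four colours are split into two pairs:
`Fac x x' y y'` says that `x, x', y, y'` span a facet, where `x, x'` have the two colours of the
first pair, in any order, and `y, y'` those of the second pair. -/
structure FacetSystem (A B : Type*) where
  Fac : A → A → B → B → Prop
  symm_left : ∀ {x x' y y'}, Fac x x' y y' → Fac x' x y y'
  symm_right : ∀ {x x' y y'}, Fac x x' y y' → Fac x x' y' y
  ne_left : ∀ {x x' y y'}, Fac x x' y y' → x ≠ x'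
  ne_right : ∀ {x x' y y'}, Fac x x' y y' → y ≠ y'

namespace FacetSystem

variable {A B : Type*}

/-- The same facets with the roles of the two colour pairs exchanged. -/
def swap (C : FacetSystem A B) : FacetSystem B A where
  Fac y y' x x' := C.Fac x x' y y'
  symm_left h := C.symm_right h
  symm_right h := C.symm_left h
  ne_left h := C.ne_right h
  ne_right h := C.ne_left h

/-- The subgraph of the 1-skeleton that is induced on the vertices of the first colour pair. -/
def graph (C : FacetSystem A B) : SimpleGraph A where
  Adj x x' := ∃ y y', C.Fac x x' y y'
  symm := ⟨fun _ _ ⟨y, y', h⟩ => ⟨y, y', C.symm_left h⟩⟩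
  loopless := ⟨fun _ ⟨_, _, h⟩ => C.ne_left h rfl⟩

/-- The part of `C.graph` that lies in the link of the vertex `y`. -/
def link (C : FacetSystem A B) (y : B) : SimpleGraph A where
  Adj x x' := ∃ y', C.Fac x x' y y'
  symm := ⟨fun _ _ ⟨y', h⟩ => ⟨y', C.symm_left h⟩⟩
  loopless := ⟨fun _ ⟨_, h⟩ => C.ne_left h rfl⟩

/-- The link of the edge `{y, y'}`, which has no further vertices of the second colour pair. -/
def edgeLink (C : FacetSystem A B) (y y' : B) : SimpleGraph A where
  Adj x x' := C.Fac x x' y y'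
  symm := ⟨fun _ _ h => C.symm_left h⟩
  loopless := ⟨fun _ h => C.ne_left h rfl⟩

/-- Every facet occurs four times, once for each order of the two vertices on either side. -/
def orderedFacets (C : FacetSystem A B) : Set (A × A × B × B) :=
  {t | C.Fac t.1 t.2.1 t.2.2.1 t.2.2.2}

/-- The edges of the complex that join the two colour pairs. -/
def crossEdges (C : FacetSystem A B) : Set (A × B) :=
  {t | ∃ x' y', C.Fac t.1 x' t.2 y'}

lemma ncard_crossEdges_swap (C : FacetSystem A B) :
    C.swap.crossEdges.ncard = C.crossEdges.ncard := by
  rw [← Set.ncard_image_of_injective _ Prod.swap_injective, Set.image_swap_eq_preimage_swap]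
  congr 1
  ext ⟨x, y⟩
  exact exists_comm

lemma edgeLink_le_link (C : FacetSystem A B) (y y' : B) : C.edgeLink y y' ≤ C.link y :=
  fun _ _ h => ⟨y', h⟩

lemma link_le_graph (C : FacetSystem A B) (y : B) : C.link y ≤ C.graph :=
  fun _ _ ⟨y', h⟩ => ⟨y, y', h⟩

/-- The part of normality that concerns the subgraphs of `C.graph`. By `neighbor_chain`, the discs
that the vertices `w` cut out of the link of `y` are joined up by sharing edges. -/
structure HalfNormal (C : FacetSystem A B) : Prop where
  edgeLink_isCycles : ∀ y y', (C.edgeLink y y').IsCycles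
  exists_adj : ∀ x, ∃ x', C.graph.Adj x x'
  connected : C.graph.Connected
  link_connected : ∀ y, SupportConnected (C.link y)
  edgeLink_connected : ∀ y y', SupportConnected (C.edgeLink y y')
  neighbor_chain : ∀ y w w', C.swap.graph.Adj y w → C.swap.graph.Adj y w' →
    Relation.ReflTransGen (fun u v => ∃ x x', C.Fac x x' y u ∧ C.Fac x x' y v) w w'

/-- `C` has the properties of the facets of a normal `3`-pseudomanifold that are used here. -/
structure Normal (C : FacetSystem A B) : Prop where
  left : C.HalfNormal
  right : C.swap.HalfNormal

lemma Normal.swap {C : FacetSystem A B} (h : C.Normal) : C.swap.Normal := ⟨h.right, h.left⟩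

/-- A set of edges, given as a graph, that contains each edge of a vertex link whose endpoints it
joins within that link. If all edges of a link but one carry trivial elements of the fundamental
group and join the endpoints of the last one, then so does the last one. -/
def LinkClosed (C : FacetSystem A B) (S : SimpleGraph A) : Prop :=
  ∀ y x x', (C.link y).Adj x x' → (C.link y ⊓ S).Reachable x x' → S.Adj x x'

/-- The edges in `R` are recovered from the remaining edges of `G` by closing up in vertex links. -/
def RemovableFrom (C : FacetSystem A B) (G : SimpleGraph A) (R : Set (Sym2 A)) : Prop :=
  ∀ S, C.LinkClosed S → G.deleteEdges R ≤ S → G ≤ S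

variable {C : FacetSystem A B}

lemma linkClosed_reachGraph (G : SimpleGraph A) : C.LinkClosed (reachGraph G) :=
  fun _ _ _ h h' => ⟨h.ne, reachable_of_le_reachGraph inf_le_right h'⟩

section Removable

variable {G H : SimpleGraph A} {R R' : Set (Sym2 A)}

lemma removableFrom_empty : C.RemovableFrom G ∅ :=
  fun _ _ h => by rwa [SimpleGraph.deleteEdges_empty] at h

lemma RemovableFrom.union (hR : C.RemovableFrom G R) (hR' : C.RemovableFrom H R') (hH : H ≤ G)
    (hR'H : R' ⊆ H.edgeSet) (hdisj : Disjoint R H.edgeSet) : C.RemovableFrom G (R' ∪ R) := by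
  intro S hS hle
  have hHS : H ≤ S := hR' S hS fun u v huv => by
    rw [SimpleGraph.deleteEdges_adj] at huv
    exact hle (SimpleGraph.deleteEdges_adj.2
      ⟨hH huv.1, not_or.2 ⟨huv.2, Set.disjoint_right.1 hdisj huv.1⟩⟩)
  refine hR S hS fun u v huv => ?_
  rw [SimpleGraph.deleteEdges_adj] at huv
  by_cases h : s(u, v) ∈ R'
  · exact hHS (hR'H h)
  · exact hle (SimpleGraph.deleteEdges_adj.2 ⟨huv.1, not_or.2 ⟨h, huv.2⟩⟩)

lemma RemovableFrom.reachable_deleteEdges (hR : C.RemovableFrom G R) {u v : A}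
    (h : G.Reachable u v) : (G.deleteEdges R).Reachable u v :=
  reachable_of_le_reachGraph (hR _ (linkClosed_reachGraph _) (le_reachGraph _)) h

lemma HalfNormal.removableFrom_edgeLink [Finite A] (hC : C.HalfNormal) {y y' : B} {e : Sym2 A}
    (he : e ∈ (C.edgeLink y y').edgeSet) : C.RemovableFrom (C.edgeLink y y') {e} := by
  intro S hS hle
  obtain ⟨x, x'⟩ := e
  have hxx : S.Adj x x' := hS y x x' ⟨y', he⟩
    (((hC.edgeLink_isCycles y y').reachable_deleteEdges he).mono
      (le_inf ((SimpleGraph.deleteEdges_le _).trans (C.edgeLink_le_link y y')) hle))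
  intro u v huv
  by_cases h : s(u, v) = s(x, x')
  · exact (SimpleGraph.mem_edgeSet S).1 (h ▸ hxx)
  · exact hle (SimpleGraph.deleteEdges_adj.2 ⟨huv, h⟩)

lemma RemovableFrom.insert [Finite A] (hC : C.HalfNormal) (hR : C.RemovableFrom G R) {y y' : B}
    {e : Sym2 A} (he : e ∈ (C.edgeLink y y').edgeSet) (hG : C.edgeLink y y' ≤ G)
    (hdisj : Disjoint R (C.edgeLink y y').edgeSet) : C.RemovableFrom G (insert e R) :=
  hR.union (hC.removableFrom_edgeLink he) hG (Set.singleton_subset_iff.2 he) hdisj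

lemma HalfNormal.exists_removable_of_triangular [Finite A] (hC : C.HalfNormal)
    {x₁ x₁' x₂ x₂' x₃ x₃' : A} {y₁ y₁' y₂ y₂' y₃ y₃' : B} (h₁ : C.Fac x₁ x₁' y₁ y₁')
    (h₂ : C.Fac x₂ x₂' y₂ y₂') (h₃ : C.Fac x₃ x₃' y₃ y₃') (h₁₂ : ¬ C.Fac x₁ x₁' y₂ y₂')
    (h₁₃ : ¬ C.Fac x₁ x₁' y₃ y₃') (h₂₃ : ¬ C.Fac x₂ x₂' y₃ y₃') :
    ∃ R ⊆ C.graph.edgeSet, R.ncard = 3 ∧ C.RemovableFrom C.graph R := by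
  have hgraph : ∀ y y', C.edgeLink y y' ≤ C.graph := fun y y' =>
    (C.edgeLink_le_link y y').trans (C.link_le_graph y)
  have hne : ∀ {e e' : Sym2 A} {y y' : B}, e ∈ (C.edgeLink y y').edgeSet →
      e' ∉ (C.edgeLink y y').edgeSet → e ≠ e' := fun h h' he => h' (he ▸ h)
  refine ⟨{s(x₃, x₃'), s(x₂, x₂'), s(x₁, x₁')}, ?_, ?_, ?_⟩
  · rintro _ (rfl | rfl | rfl)
    exacts [⟨_, _, h₃⟩, ⟨_, _, h₂⟩, ⟨_, _, h₁⟩]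
  · exact Set.ncard_eq_three.2 ⟨_, _, _, hne h₃ h₂₃, hne h₃ h₁₃, hne h₂ h₁₂, rfl⟩
  · have hR₁ : C.RemovableFrom C.graph {s(x₁, x₁')} := by
      simpa using removableFrom_empty.insert hC h₁ (hgraph _ _) (Set.empty_disjoint _)
    refine (hR₁.insert hC h₂ (hgraph _ _) ?_).insert hC h₃ (hgraph _ _) ?_
    · exact Set.disjoint_singleton_left.2 h₁₂
    · exact Set.disjoint_insert_left.2 ⟨h₂₃, Set.disjoint_singleton_left.2 h₁₃⟩

end Removable

section Links

lemma link_support_nonempty (hC : C.Normal) (y : B) : (C.link y).support.Nonempty := by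
  obtain ⟨w, x, x', h⟩ := hC.right.exists_adj y
  exact ⟨x, (SimpleGraph.mem_support _).2 ⟨x', w, h⟩⟩

lemma Normal.ncard_setOf_fac (hC : C.Normal) {x x' : A} {y y' : B} (h : C.Fac x x' y y') :
    {z | C.Fac x x' y z}.ncard = 2 :=
  hC.right.edgeLink_isCycles x x' (v := y) ⟨y', h⟩

lemma Normal.eq_or_eq_of_fac [Finite B] (hC : C.Normal) {x x' : A} {y w w' z : B}
    (h : C.Fac x x' y w) (h' : C.Fac x x' y w') (hne : w ≠ w') (hz : C.Fac x x' y z) :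
    z = w ∨ z = w' := by
  have hpair : {w, w'} ⊆ {z | C.Fac x x' y z} := by
    rintro _ (rfl | rfl)
    exacts [h, h']
  have heq := Set.eq_of_subset_of_ncard_le hpair
    (by rw [hC.ncard_setOf_fac h, Set.ncard_pair hne]) (Set.toFinite _)
  exact heq.symm.subset hz

lemma HalfNormal.exists_fac_of_not_subset (hC : C.HalfNormal) {y : B} {W : Set B}
    (hW : W.Nonempty) (hWy : W ⊆ C.swap.graph.neighborSet y)
    (hyW : ¬ C.swap.graph.neighborSet y ⊆ W) :
    ∃ w ∈ W, ∃ w' ∉ W, ∃ x x', C.Fac x x' y w ∧ C.Fac x x' y w' := by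
  by_contra! hcon
  obtain ⟨w₀, hw₀⟩ := hW
  refine hyW fun w' hw' => ?_
  induction hC.neighbor_chain y w₀ w' (hWy hw₀) hw' with
  | refl => exact hw₀
  | tail _ hstep ih =>
    obtain ⟨x, x', h, h'⟩ := hstep
    by_contra hw'W
    exact hcon _ (ih ⟨x, x', h⟩) _ hw'W x x' h h'

/-- The link of `y` is built by adding, one by one, the discs that the neighbours of `y` cut out of
it. Each disc after the first meets the previous ones in an edge, and this edge is removable since
the new boundary cycle contains none of those removed before. -/
lemma Normal.exists_removable_link_of_lt [Finite A] [Finite B] (hC : C.Normal) (y : B) (n : ℕ)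
    (hn : n < (C.swap.graph.neighborSet y).ncard) :
    ∃ W ⊆ C.swap.graph.neighborSet y, W.ncard = n + 1 ∧
      ∃ R ⊆ (C.link y).edgeSet, R.ncard = n ∧
        (∀ z ∉ W, Disjoint R (C.edgeLink y z).edgeSet) ∧ C.RemovableFrom (C.link y) R := by
  induction n with
  | zero =>
    obtain ⟨w, hw⟩ := hC.right.exists_adj y
    exact ⟨{w}, by simpa using hw, Set.ncard_singleton w, ∅, Set.empty_subset _,
      Set.ncard_empty _, fun _ _ => Set.empty_disjoint _, removableFrom_empty⟩
  | succ n ih =>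
    obtain ⟨W, hWy, hWcard, R, hR, hRcard, hRW, hrem⟩ := ih (by omega)
    have hWne : W.Nonempty := Set.nonempty_of_ncard_ne_zero (by omega)
    have hyW : ¬ C.swap.graph.neighborSet y ⊆ W := fun h => by
      have := Set.ncard_le_ncard h (Set.toFinite _)
      omega
    obtain ⟨w, hw, w', hw', x, x', h, h'⟩ := hC.left.exists_fac_of_not_subset hWne hWy hyW
    have hxR : s(x, x') ∉ R := Set.disjoint_right.1 (hRW w' hw') h'
    refine ⟨insert w' W, Set.insert_subset ⟨x, x', h'⟩ hWy, ?_, insert s(x, x') R,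
      Set.insert_subset ⟨w, h⟩ hR, ?_, fun z hz => ?_,
      hrem.insert hC.left h' (C.edgeLink_le_link y w') (hRW w' hw')⟩
    · rw [Set.ncard_insert_of_notMem hw', hWcard]
    · rw [Set.ncard_insert_of_notMem hxR, hRcard]
    · obtain ⟨hzw', hzW⟩ := not_or.1 hz
      refine Set.disjoint_insert_left.2 ⟨fun hxz => ?_, hRW z hzW⟩
      rcases hC.eq_or_eq_of_fac h h' (ne_of_mem_of_not_mem hw hw') hxz with rfl | rfl
      exacts [hzW hw, hzw' rfl]

lemma Normal.exists_removable_link [Finite A] [Finite B] (hC : C.Normal) (y : B) :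
    ∃ R ⊆ (C.link y).edgeSet, R.ncard + 1 = (C.swap.graph.neighborSet y).ncard ∧
      C.RemovableFrom (C.link y) R := by
  have hpos : 0 < (C.swap.graph.neighborSet y).ncard :=
    (Set.ncard_pos (Set.toFinite _)).2 (hC.right.exists_adj y)
  obtain ⟨-, -, -, R, hR, hRcard, -, hrem⟩ :=
    hC.exists_removable_link_of_lt y _ (Nat.pred_lt hpos.ne')
  exact ⟨R, hR, by rw [hRcard]; exact Nat.succ_pred hpos.ne', hrem⟩

/-- The Euler characteristic of the link of `y` is at most two: its vertices are those of
`C.link y` and the neighbours of `y`, and the latter may be regarded as its 2-cells. -/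
lemma Normal.link_euler [Finite A] [Finite B] (hC : C.Normal) (y : B) :
    (C.swap.graph.neighborSet y).ncard + (C.link y).support.ncard
      ≤ (C.link y).edgeSet.ncard + 2 := by
  obtain ⟨R, hR, hRcard, hrem⟩ := hC.exists_removable_link y
  obtain ⟨r, hr⟩ := link_support_nonempty hC y
  have hsupp : (C.link y).support ⊆ (((C.link y).deleteEdges R).connectedComponentMk r).supp :=
    fun v hv => SimpleGraph.ConnectedComponent.eq.2
      (hrem.reachable_deleteEdges (hC.left.link_connected y hv hr))
  have hle := (Set.ncard_le_ncard hsupp (Set.toFinite _)).trans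
    (ncard_supp_le_ncard_edgeSet_add_one _)
  rw [SimpleGraph.edgeSet_deleteEdges] at hle
  have := Set.ncard_sdiff_add_ncard_of_subset hR (Set.toFinite _)
  omega

lemma LinkClosed.le_of_reachable {S : SimpleGraph A} (hS : C.LinkClosed S) {y : B}
    {F : SimpleGraph A} (hFy : F ≤ C.link y) (hreach : F.Reachable = (C.link y).Reachable)
    (hFS : F ≤ S) : C.link y ≤ S := fun u v huv =>
  hS y u v huv ((hreach ▸ huv.reachable : F.Reachable u v).mono (le_inf hFy hFS))

/-- The edges outside a spanning tree of the link of `y` are removable. -/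
lemma Normal.exists_removable_of_rank [Finite A] (hC : C.Normal) (y : B) (k : ℕ)
    (h : (C.link y).support.ncard + k ≤ (C.link y).edgeSet.ncard + 1) :
    ∃ R ⊆ C.graph.edgeSet, R.ncard = k ∧ C.RemovableFrom C.graph R := by
  obtain ⟨r, hr⟩ := link_support_nonempty hC y
  obtain ⟨F, hFy, hF, hreach⟩ := (C.link y).exists_isAcyclic_reachable_eq_le
  have hsupp : (F.connectedComponentMk r).supp = (C.link y).support := by
    rw [← (hC.left.link_connected y).supp_connectedComponentMk hr]
    ext v
    simp only [SimpleGraph.ConnectedComponent.mem_supp_iff, SimpleGraph.ConnectedComponent.eq,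
      hreach]
  have hFcard := ncard_edgeSet_add_one_of_isAcyclic hF
    (hsupp ▸ SimpleGraph.support_mono hFy : F.support ⊆ (F.connectedComponentMk r).supp)
  have hFle := SimpleGraph.edgeSet_mono hFy
  have hdiff := Set.ncard_sdiff_add_ncard_of_subset hFle (Set.toFinite _)
  obtain ⟨R, hR, hRcard⟩ :=
    Set.exists_subset_card_eq (s := (C.link y).edgeSet \ F.edgeSet) (n := k) (by
      rw [hsupp] at hFcard; omega)
  have hRy : R ⊆ (C.link y).edgeSet := hR.trans Set.sdiff_subset
  refine ⟨R, hRy.trans (SimpleGraph.edgeSet_mono (C.link_le_graph y)), hRcard, fun S hS hle => ?_⟩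
  have hyS : C.link y ≤ S := hS.le_of_reachable hFy hreach fun u v huv =>
    hle (SimpleGraph.deleteEdges_adj.2 ⟨C.link_le_graph y (hFy huv), fun hc => (hR hc).2 huv⟩)
  intro u v huv
  by_cases hc : s(u, v) ∈ R
  · exact hyS (hRy hc)
  · exact hle (SimpleGraph.deleteEdges_adj.2 ⟨huv, hc⟩)

end Links

section Counting

open Classical in
lemma Normal.sum_fac [Fintype B] (hC : C.Normal) (x x' : A) (y : B) :
    (∑ y', if C.Fac x x' y y' then 1 else 0) = 2 * if (C.link y).Adj x x' then 1 else 0 := by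
  rw [← Finset.card_filter, ← Set.ncard_coe_finset, Finset.coe_filter_univ]
  split_ifs with h
  · exact hC.ncard_setOf_fac h.choose_spec
  · have hempty : {y' | C.Fac x x' y y'} = ∅ :=
      Set.eq_empty_of_forall_notMem fun y' hy' => h ⟨y', hy'⟩
    rw [hempty, Set.ncard_empty]

variable [Finite A]

lemma sum_ncard_link_support [Fintype B] (C : FacetSystem A B) :
    ∑ y, (C.link y).support.ncard = C.crossEdges.ncard := by
  classical
  have := Fintype.ofFinite A
  rw [crossEdges, Set.ncard_eq_toFinset_card', Set.toFinset_ofPred, Finset.card_filter,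
    Fintype.sum_prod_type_right]
  refine Finset.sum_congr rfl fun y _ => ?_
  rw [← Finset.card_filter, ← Set.ncard_coe_finset]
  congr 1
  ext x
  simp [SimpleGraph.mem_support, link]

/-- Each edge of the link of `y` has two orientations and lies in two facets at `y`. -/
lemma Normal.four_mul_sum_ncard_link_edgeSet [Fintype B] (hC : C.Normal) :
    4 * ∑ y, (C.link y).edgeSet.ncard = C.orderedFacets.ncard := by
  classical
  have := Fintype.ofFinite A
  have hlink : ∀ y, ∑ x, ∑ x', (if (C.link y).Adj x x' then 1 else 0) =
      2 * (C.link y).edgeSet.ncard := fun y => by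
    rw [← sum_ncard_neighborSet]
    refine Finset.sum_congr rfl fun x _ => ?_
    rw [← Finset.card_filter, ← Set.ncard_coe_finset, Finset.coe_filter_univ]
    rfl
  rw [orderedFacets, Set.ncard_eq_toFinset_card', Set.toFinset_ofPred, Finset.card_filter]
  simp only [Fintype.sum_prod_type, hC.sum_fac, ← Finset.mul_sum]
  rw [Finset.sum_congr rfl fun x _ => Finset.sum_comm, Finset.sum_comm,
    Finset.sum_congr rfl fun y _ => hlink y, ← Finset.mul_sum, ← mul_assoc]
  rfl

lemma Normal.two_mul_ncard_edgeSet_le [Finite B] (hC : C.Normal) {p : ℕ}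
    (hp : C.orderedFacets.ncard = 4 * p) :
    2 * C.swap.graph.edgeSet.ncard + C.crossEdges.ncard ≤ p + 2 * Nat.card B := by
  have := Fintype.ofFinite B
  have heuler := Finset.sum_le_sum fun y (_ : y ∈ Finset.univ) => hC.link_euler y
  rw [Finset.sum_add_distrib, Finset.sum_add_distrib, sum_ncard_link_support,
    sum_ncard_neighborSet, Finset.sum_const, Finset.card_univ, ← Nat.card_eq_fintype_card,
    smul_eq_mul] at heuler
  have := hC.four_mul_sum_ncard_link_edgeSet
  omega

end Counting

end FacetSystem

section Cocycles

variable {V G : Type*} [Group G] {F : Set (Finset V)} {g : V → V → G}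

/-- A `G`-valued 1-cocycle on the simplicial complex generated by the vertex sets in `F`. -/
def IsCocycle (F : Set (Finset V)) (g : V → V → G) : Prop :=
  ∀ s ∈ F, ∀ u ∈ s, ∀ v ∈ s, ∀ w ∈ s, g u v * g v w = g u w

/-- The values of `g` on the ordered edges of the complex generated by `F`. -/
def edgeValues (F : Set (Finset V)) (g : V → V → G) : Set G :=
  {h | ∃ s ∈ F, ∃ u ∈ s, ∃ v ∈ s, h = g u v}

/-- The cocycle that is cohomologous to `g` by means of the 0-cochain `τ`. -/
def gaugeTransform (τ : V → G) (g : V → V → G) (u v : V) : G := τ u * g u v * (τ v)⁻¹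

lemma isCocycle_gaugeTransform (hg : IsCocycle F g) (τ : V → G) :
    IsCocycle F (gaugeTransform τ g) := by
  intro s hs u hu v hv w hw
  simp only [gaugeTransform, ← hg s hs u hu v hv w hw]
  group

lemma IsCocycle.self (hg : IsCocycle F g) {s : Finset V} (hs : s ∈ F) {u : V} (hu : u ∈ s) :
    g u u = 1 := by
  simpa only [mul_eq_left] using hg s hs u hu u hu u hu

lemma IsCocycle.inv (hg : IsCocycle F g) {s : Finset V} (hs : s ∈ F) {u v : V} (hu : u ∈ s)
    (hv : v ∈ s) : (g u v)⁻¹ = g v u := by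
  rw [inv_eq_iff_mul_eq_one, hg s hs u hu v hv u hu, hg.self hs hu]

/-- The product of the values of `g` along a walk. -/
def walkProd {T : SimpleGraph V} (g : V → V → G) : ∀ {u v : V}, T.Walk u v → G
  | _, _, .nil => 1
  | u, _, .cons (v := v) _ p => g u v * walkProd g p

lemma walkProd_concat {T : SimpleGraph V} {u v w : V} (p : T.Walk u v) (h : T.Adj v w) :
    walkProd g (p.concat h) = walkProd g p * g v w := by
  induction p with
  | nil => simp only [SimpleGraph.Walk.concat_nil, walkProd, mul_one, one_mul]
  | cons _ _ ih => simp only [SimpleGraph.Walk.concat_cons, walkProd, ih, mul_assoc]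

lemma exists_gaugeTransform_eq_one_of_isTree {T : SimpleGraph V} (hT : T.IsTree)
    (hg : ∀ ⦃u v⦄, T.Adj u v → (g u v)⁻¹ = g v u) (r : V) :
    ∃ τ : V → G, τ r = 1 ∧ ∀ ⦃u v⦄, T.Adj u v → gaugeTransform τ g u v = 1 := by
  choose p hp huniq using fun v => hT.existsUnique_path r v
  have hstep : ∀ {u v}, T.Adj u v → u ∈ (p v).support →
      gaugeTransform (fun v => walkProd g (p v)) g u v = 1 := fun {u v} huv hu => by
    rw [gaugeTransform, hT.isAcyclic.path_concat (hp u) (hp v) huv hu, walkProd_concat,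
      mul_inv_cancel]
  refine ⟨fun v => walkProd g (p v), ?_, fun u v huv => ?_⟩
  · change walkProd g (p r) = 1
    rw [← huniq r _ SimpleGraph.Walk.IsPath.nil, walkProd]
  · by_cases hu : u ∈ (p v).support
    · exact hstep huv hu
    · have hv := hT.isAcyclic.mem_support_of_ne_mem_support_of_adj_of_isPath (hp u) (hp v) huv hu
      have h := congrArg (·⁻¹) (hstep huv.symm hv)
      simpa only [gaugeTransform, mul_inv_rev, inv_inv, inv_one, hg huv.symm, mul_assoc] using h

lemma groupRank_le_of_closure {S : Set G} (hS : Subgroup.closure S = ⊤) :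
    groupRank G ≤ S.encard :=
  iInf_le_of_le ⟨S, hS⟩ le_rfl

/-- One generator for each unoriented edge in `E`. -/
lemma exists_closure_mem_of_sym2 {E : Set (Sym2 V)} (hE : E.Finite) (γ : V → V → G)
    (hγ : ∀ u v, s(u, v) ∈ E → (γ u v)⁻¹ = γ v u) :
    ∃ S : Set G, S.encard ≤ E.ncard ∧ ∀ u v, s(u, v) ∈ E → γ u v ∈ Subgroup.closure S := by
  refine ⟨(fun e => γ e.out.1 e.out.2) '' E, ?_, fun u v huv => ?_⟩
  · rw [hE.cast_ncard_eq]
    exact Set.encard_image_le _ _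
  · have hmem := SetLike.mem_coe.1 <| Subgroup.subset_closure <|
      Set.mem_image_of_mem (fun e => γ e.out.1 e.out.2) huv
    have hout : s((s(u, v) : Sym2 V).out.1, (s(u, v) : Sym2 V).out.2) = s(u, v) := Quot.out_eq _
    rcases Sym2.eq_iff.1 hout with ⟨hu, hv⟩ | ⟨hv, hu⟩
    · simpa only [hu, hv] using hmem
    · rw [← hγ v u (Sym2.eq_swap ▸ huv)]
      exact inv_mem (by simpa only [hu, hv] using hmem)

end Cocycles

namespace FacetSystem

variable {A B G : Type*} [Group G] {C : FacetSystem A B}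

/-- The vertex sets of the facets. -/
def simplices [DecidableEq A] [DecidableEq B] (C : FacetSystem A B) : Set (Finset (A ⊕ B)) :=
  {s | ∃ x x' y y', C.Fac x x' y y' ∧ s = {.inl x, .inl x', .inr y, .inr y'}}

/-- The edges of `C.graph` on which `γ` takes values in `H`. -/
def subgroupGraph (C : FacetSystem A B) (γ : A ⊕ B → A ⊕ B → G) (H : Subgroup G) :
    SimpleGraph A where
  Adj u v := C.graph.Adj u v ∧ γ (.inl u) (.inl v) ∈ H ∧ γ (.inl v) (.inl u) ∈ H
  symm := ⟨fun _ _ h => ⟨h.1.symm, h.2.2, h.2.1⟩⟩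
  loopless := ⟨fun _ h => h.1.ne rfl⟩

variable [DecidableEq A] [DecidableEq B]

lemma exists_mem_simplices {x x' : A} {y y' : B} (h : C.Fac x x' y y') :
    ∃ s ∈ C.simplices, .inl x ∈ s ∧ .inl x' ∈ s ∧ .inr y ∈ s ∧ .inr y' ∈ s :=
  ⟨_, ⟨x, x', y, y', h, rfl⟩, by simp, by simp, by simp, by simp⟩

lemma inv_of_isCocycle {γ : A ⊕ B → A ⊕ B → G} (hγ : IsCocycle C.simplices γ) {u v : A}
    (huv : C.graph.Adj u v) : (γ (.inl u) (.inl v))⁻¹ = γ (.inl v) (.inl u) := by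
  obtain ⟨_, _, h⟩ := huv
  obtain ⟨s, hs, hu, hv, -⟩ := exists_mem_simplices h
  exact hγ.inv hs hu hv

section Cocycle

variable {γ : A ⊕ B → A ⊕ B → G} {H : Subgroup G}

lemma mul_mem_of_reachable (hγ : IsCocycle C.simplices γ) {y : B} {x x' : A}
    (h : (C.link y ⊓ C.subgroupGraph γ H).Reachable x x') (hx : x ∈ (C.link y).support) :
    γ (.inl x) (.inr y) * γ (.inr y) (.inl x') ∈ H := by
  obtain ⟨p⟩ := h
  induction p with
  | nil =>
    obtain ⟨x', y', hf⟩ := (SimpleGraph.mem_support _).1 hx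
    obtain ⟨s, hs, hxs, -, hys, -⟩ := exists_mem_simplices hf
    rw [hγ s hs _ hxs _ hys _ hxs, hγ.self hs hxs]
    exact H.one_mem
  | @cons u v w huv _ ih =>
    obtain ⟨⟨y', hf⟩, -, hH, -⟩ := huv
    obtain ⟨s, hs, hus, hvs, hys, -⟩ := exists_mem_simplices hf
    rw [← hγ s hs _ hus _ hvs _ hys, mul_assoc]
    exact H.mul_mem hH (ih ((SimpleGraph.mem_support _).2 ⟨u, y', C.symm_left hf⟩))

lemma linkClosed_subgroupGraph (hγ : IsCocycle C.simplices γ) :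
    C.LinkClosed (C.subgroupGraph γ H) := by
  intro y x x' hxx' hreach
  have hmem := mul_mem_of_reachable hγ hreach ((SimpleGraph.mem_support _).2 ⟨x', hxx'⟩)
  have hadj := C.link_le_graph y hxx'
  obtain ⟨y', hf⟩ := hxx'
  obtain ⟨s, hs, hxs, hxs', hys, -⟩ := exists_mem_simplices hf
  rw [hγ s hs _ hxs _ hys _ hxs'] at hmem
  exact ⟨hadj, hmem, inv_of_isCocycle hγ hadj ▸ H.inv_mem hmem⟩

lemma HalfNormal.mem_of_le_subgroupGraph (hC : C.HalfNormal) (hγ : IsCocycle C.simplices γ)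
    (hβ : ∀ y, ∃ x ∈ (C.link y).support, γ (.inl x) (.inr y) = 1)
    (hH : C.graph ≤ C.subgroupGraph γ H) {s : Finset (A ⊕ B)} (hs : s ∈ C.simplices)
    {u v : A ⊕ B} (hu : u ∈ s) (hv : v ∈ s) : γ u v ∈ H := by
  have hAB : ∀ {x y}, x ∈ (C.link y).support → γ (.inl x) (.inr y) ∈ H := by
    intro x y hx
    obtain ⟨b, hb, hb₁⟩ := hβ y
    have hmem := mul_mem_of_reachable hγ ((hC.link_connected y hx hb).mono
      (le_inf le_rfl ((C.link_le_graph y).trans hH))) hx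
    obtain ⟨_, _, hf⟩ := (SimpleGraph.mem_support _).1 hb
    obtain ⟨t, ht, hbt, -, hyt, -⟩ := exists_mem_simplices hf
    rwa [← hγ.inv ht hbt hyt, hb₁, inv_one, mul_one] at hmem
  have hs' := hs
  obtain ⟨x, x', y, y', hf, rfl⟩ := hs'
  have hx : ∀ z ∈ ({.inl x, .inl x', .inr y, .inr y'} : Finset (A ⊕ B)), γ (.inl x) z ∈ H := by
    simp only [Finset.mem_insert, Finset.mem_singleton]
    rintro z (rfl | rfl | rfl | rfl)
    · rw [hγ.self hs (by simp)]
      exact H.one_mem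
    · exact (hH ⟨y, y', hf⟩).2.1
    · exact hAB ⟨x', y', hf⟩
    · exact hAB ⟨x', y, C.symm_right hf⟩
  rw [← hγ _ hs u hu (.inl x) (by simp) v hv, ← hγ.inv hs (by simp) hu]
  exact H.mul_mem (H.inv_mem (hx u hu)) (hx v hv)

end Cocycle

lemma exists_gaugeTransform_eq_one (hC : C.Normal) {g : A ⊕ B → A ⊕ B → G}
    (hg : IsCocycle C.simplices g) {T : SimpleGraph A} (hT : T.IsTree) (hTC : T ≤ C.graph) (r : A) :
    ∃ τ : A ⊕ B → G, τ (.inl r) = 1 ∧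
      (∀ ⦃u v⦄, T.Adj u v → gaugeTransform τ g (.inl u) (.inl v) = 1) ∧
      ∀ y, ∃ x ∈ (C.link y).support, gaugeTransform τ g (.inl x) (.inr y) = 1 := by
  obtain ⟨τ, hr, hτ⟩ := exists_gaugeTransform_eq_one_of_isTree
    (g := fun u v => g (.inl u) (.inl v)) hT (fun _ _ huv => inv_of_isCocycle hg (hTC huv)) r
  choose β hβ using link_support_nonempty hC
  exact ⟨Sum.elim τ fun y => τ (β y) * g (.inl (β y)) (.inr y), hr, hτ,
    fun y => ⟨β y, hβ y, mul_inv_cancel _⟩⟩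

/-- After a change of gauge, `g` is trivial on a spanning tree of what remains of `C.graph` without
`R`. Its values on the other edges of the remainder then generate all of its values. -/
lemma Normal.groupRank_le [Finite A] (hC : C.Normal) (r : A) {g : A ⊕ B → A ⊕ B → G}
    (hg : IsCocycle C.simplices g)
    (hgen : ∀ τ, τ (.inl r) = 1 →
      Subgroup.closure (edgeValues C.simplices (gaugeTransform τ g)) = ⊤)
    {R : Set (Sym2 A)} (hRC : R ⊆ C.graph.edgeSet) (hR : C.RemovableFrom C.graph R) :
    groupRank G + R.ncard + Nat.card A ≤ C.graph.edgeSet.ncard + 1 := by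
  classical
  have := Fintype.ofFinite A
  have hconn : (C.graph.deleteEdges R).Connected :=
    have : Nonempty A := ⟨r⟩
    ⟨fun u v => hR.reachable_deleteEdges (hC.left.connected u v)⟩
  obtain ⟨T, hT, hTree⟩ := hconn.exists_isTree_le
  obtain ⟨τ, hr, hτT, hτB⟩ :=
    exists_gaugeTransform_eq_one hC hg hTree (hT.trans (SimpleGraph.deleteEdges_le R)) r
  have hγ := isCocycle_gaugeTransform hg τ
  obtain ⟨S, hScard, hS⟩ := exists_closure_mem_of_sym2
    (E := (C.graph.deleteEdges R).edgeSet \ T.edgeSet) (Set.toFinite _)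
    (fun u v => gaugeTransform τ g (.inl u) (.inl v))
    (fun u v h => inv_of_isCocycle hγ (SimpleGraph.deleteEdges_le R h.1))
  have hle : C.graph.deleteEdges R ≤ C.subgroupGraph (gaugeTransform τ g) (Subgroup.closure S) := by
    have hmem : ∀ {u v}, (C.graph.deleteEdges R).Adj u v →
        gaugeTransform τ g (.inl u) (.inl v) ∈ Subgroup.closure S := fun {u v} huv => by
      by_cases h : T.Adj u v
      · exact hτT h ▸ one_mem _
      · exact hS u v ⟨huv, h⟩
    exact fun u v huv => ⟨SimpleGraph.deleteEdges_le R huv, hmem huv, hmem huv.symm⟩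
  have htop : Subgroup.closure S = ⊤ := by
    rw [eq_top_iff, ← hgen τ hr, Subgroup.closure_le]
    rintro _ ⟨s, hs, u, hu, v, hv, rfl⟩
    exact hC.left.mem_of_le_subgroupGraph hγ hτB (hR _ (linkClosed_subgroupGraph hγ) hle) hs hu hv
  have hrank := (groupRank_le_of_closure htop).trans hScard
  have hTcard : T.edgeSet.ncard + 1 = Nat.card A := by
    rw [← SimpleGraph.coe_edgeFinset, Set.ncard_coe_finset, hTree.card_edgeFinset,
      Nat.card_eq_fintype_card]
  have hTR := Set.ncard_sdiff_add_ncard_of_subset (SimpleGraph.edgeSet_mono hT) (Set.toFinite _)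
  have hRcard := Set.ncard_sdiff_add_ncard_of_subset hRC (Set.toFinite _)
  rw [SimpleGraph.edgeSet_deleteEdges] at hTR hrank
  calc groupRank G + R.ncard + Nat.card A
      ≤ ((C.graph.edgeSet \ R) \ T.edgeSet).ncard + R.ncard + Nat.card A := by gcongr
    _ ≤ C.graph.edgeSet.ncard + 1 := by norm_cast; omega

end FacetSystem

/-! ### The fundamental group of a realization -/

section FundamentalGroups

open CategoryTheory unitInterval

lemma groupRank_le_of_mulEquiv {G H : Type*} [Group G] [Group H] (e : G ≃* H) :
    groupRank H ≤ groupRank G := by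
  refine le_iInf fun S => iInf_le_of_le ⟨e '' S, ?_⟩ (Set.encard_image_le _ _)
  have hmap := e.toMonoidHom.map_closure S.1
  rw [S.2, ← MonoidHom.range_eq_map, MonoidHom.range_eq_top.2 e.surjective] at hmap
  exact hmap.symm

lemma groupRank_congr {G H : Type*} [Group G] [Group H] (e : G ≃* H) :
    groupRank G = groupRank H :=
  (groupRank_le_of_mulEquiv e.symm).antisymm (groupRank_le_of_mulEquiv e)

lemma groupRank_fundamentalGroup_congr {X Y : Type*} [TopologicalSpace X] [TopologicalSpace Y]
    [PathConnectedSpace X] (e : X ≃ₜ Y) (x : X) (y : Y) :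
    groupRank (FundamentalGroup X x) = groupRank (FundamentalGroup Y y) := by
  have : PathConnectedSpace Y := e.surjective.pathConnectedSpace e.continuous
  let E := FundamentalGroupoidFunctor.equivOfHomotopyEquiv e.toHomotopyEquiv
  let f : FundamentalGroup X x ≃* FundamentalGroup Y (E.functor.obj (.mk x)).as :=
    E.fullyFaithfulFunctor.mulEquivEnd (.mk x)
  exact groupRank_congr
    (f.trans (FundamentalGroup.fundamentalGroupMulEquivOfPathConnected _ _))

section Paths

variable {X : Type*} [TopologicalSpace X]

lemma path_induction_of_openCover {ι : Type*} {U : ι → Set X} (hU : ∀ i, IsOpen (U i))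
    (hcov : ∀ x, ∃ i, x ∈ U i)
    {P : ∀ x y : X, (FundamentalGroupoid.mk x ⟶ FundamentalGroupoid.mk y) → Prop}
    (hloc : ∀ i x y (γ : Path x y), (∀ t, γ t ∈ U i) → P x y (Path.Homotopic.Quotient.mk γ))
    (htrans : ∀ x y z p q, P x y p → P y z q → P x z (p ≫ q)) {x y : X} (γ : Path x y) :
    P x y (Path.Homotopic.Quotient.mk γ) := by
  obtain ⟨t, ht0, hmono, ⟨n, hn⟩, ht⟩ := exists_monotone_Icc_subset_open_cover_unitInterval
    (c := fun i => γ ⁻¹' U i) (fun i => (hU i).preimage γ.continuous)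
    (fun s _ => Set.mem_iUnion.2 (hcov (γ s)))
  have hpiece : ∀ m, P _ _ (Path.Homotopic.Quotient.mk (γ.subpath (t m) (t (m + 1)))) := by
    intro m
    obtain ⟨i, hi⟩ := ht m
    refine hloc i _ _ _ fun s => ?_
    have hs := Set.mem_range_self (f := γ.subpath (t m) (t (m + 1))) s
    rw [Path.range_subpath_of_le _ _ _ (hmono m.le_succ)] at hs
    exact Set.image_subset_iff.2 hi hs
  have hinit : ∀ m, P _ _ (Path.Homotopic.Quotient.mk (γ.subpath (t 0) (t m))) := by
    intro m
    induction m with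
    | zero =>
      obtain ⟨i, hi⟩ := hcov (γ (t 0))
      exact hloc i _ _ _ fun s => by simpa using hi
    | succ m ih =>
      have hcomp := (Path.Homotopic.Quotient.eq.2
        ⟨Path.Homotopy.subpathTransSubpath γ (t 0) (t m) (t (m + 1))⟩).symm
      rw [Path.Homotopic.Quotient.mk_trans] at hcomp
      rw [hcomp]
      exact htrans _ _ _ _ _ ih (hpiece m)
  have hfull := hinit n
  rw [ht0, hn n le_rfl, Path.subpath_zero_one] at hfull
  have hcast : ∀ {a b a' b' : X} (δ : Path a b) (ha : a' = a) (hb : b' = b),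
      P a' b' (Path.Homotopic.Quotient.mk (δ.cast ha hb)) →
        P a b (Path.Homotopic.Quotient.mk δ) := by
    rintro a b _ _ δ rfl rfl h
    exact h
  exact hcast γ γ.source γ.target hfull

lemma path_homotopic_of_starConvex {E : Type*} [AddCommGroup E] [Module ℝ E] [TopologicalSpace E]
    [ContinuousAdd E] [ContinuousSMul ℝ E] {X S : Set E} (hSX : S ⊆ X) {c : E}
    (hS : StarConvex ℝ c S) {x y : X} (p q : Path x y) (hp : ∀ t, (p t : E) ∈ S)
    (hq : ∀ t, (q t : E) ∈ S) : p.Homotopic q := by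
  have hx : (x : E) ∈ S := by simpa using hp 0
  have hy : (y : E) ∈ S := by simpa using hp 1
  have := hS.contractibleSpace ⟨x, hx⟩
  let lift : ∀ r : Path x y, (∀ t, (r t : E) ∈ S) → Path (⟨x, hx⟩ : S) ⟨y, hy⟩ := fun r hr =>
    { toFun := fun t => ⟨r t, hr t⟩
      continuous_toFun := by fun_prop
      source' := by simp
      target' := by simp }
  exact (SimplyConnectedSpace.paths_homotopic (lift p hp) (lift q hq)).map
    ⟨Set.inclusion hSX, continuous_inclusion hSX⟩

lemma forall_trans_mem {x y z : X} {S : Set X} {p : Path x y} {q : Path y z}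
    (hp : ∀ t, p t ∈ S) (hq : ∀ t, q t ∈ S) (t : I) : p.trans q t ∈ S := by
  have ht := Set.mem_range_self (f := p.trans q) t
  rw [Path.trans_range] at ht
  rcases ht with ⟨s, hs⟩ | ⟨s, hs⟩
  · exact hs ▸ hp s
  · exact hs ▸ hq s

/-- The loop at `x₀` determined by `c` and a choice of paths from `x₀` to all points. It runs
backwards along `c` since in `FundamentalGroup` the second factor of a product is run first. -/
noncomputable def loopOf {x₀ : X}
    (β : ∀ x : X, FundamentalGroupoid.mk x₀ ⟶ FundamentalGroupoid.mk x) {x y : X}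
    (c : FundamentalGroupoid.mk x ⟶ FundamentalGroupoid.mk y) : FundamentalGroup X x₀ :=
  β y ≫ Groupoid.inv c ≫ Groupoid.inv (β x)

lemma loopOf_comp {x₀ : X} (β : ∀ x : X, FundamentalGroupoid.mk x₀ ⟶ FundamentalGroupoid.mk x)
    {x y z : X} (c : FundamentalGroupoid.mk x ⟶ FundamentalGroupoid.mk y)
    (c' : FundamentalGroupoid.mk y ⟶ FundamentalGroupoid.mk z) :
    loopOf β (c ≫ c') = loopOf β c * loopOf β c' := by
  change β z ≫ Groupoid.inv (c ≫ c') ≫ Groupoid.inv (β x) =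
    (β z ≫ Groupoid.inv c' ≫ Groupoid.inv (β y)) ≫ (β y ≫ Groupoid.inv c ≫ Groupoid.inv (β x))
  simp

end Paths

section Realization

variable {V : Type*} [Fintype V]

/-- The standard simplex on the vertices in `s`. -/
def cell (s : Finset V) : Set (V → ℝ) :=
  {b | (∀ v, 0 ≤ b v) ∧ ∑ v, b v = 1 ∧ ∀ v, b v ≠ 0 → v ∈ s}

/-- The geometric realization of the complex whose facets are the sets in `F`. -/
def Realization (F : Set (Finset V)) : Set (V → ℝ) := ⋃ s ∈ F, cell s

/-- The union of the simplices that contain `v`. -/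
def closedStar (F : Set (Finset V)) (v : V) : Set (V → ℝ) := ⋃ s ∈ {s ∈ F | v ∈ s}, cell s

variable {F : Set (Finset V)} {s : Finset V}

lemma mem_realization {b : V → ℝ} : b ∈ Realization F ↔ ∃ s ∈ F, b ∈ cell s := by
  simp [Realization]

lemma mem_closedStar {b : V → ℝ} {v : V} :
    b ∈ closedStar F v ↔ ∃ s ∈ F, v ∈ s ∧ b ∈ cell s := by
  simp [closedStar, and_assoc]

lemma cell_subset_realization (hs : s ∈ F) : cell s ⊆ Realization F :=
  Set.subset_biUnion_of_mem hs

lemma cell_subset_closedStar (hs : s ∈ F) {v : V} (hv : v ∈ s) : cell s ⊆ closedStar F v :=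
  fun _ hb => mem_closedStar.2 ⟨s, hs, hv, hb⟩

lemma closedStar_subset_realization (F : Set (Finset V)) (v : V) :
    closedStar F v ⊆ Realization F :=
  Set.iUnion₂_subset fun _ hs => cell_subset_realization hs.1

lemma convex_cell (s : Finset V) : Convex ℝ (cell s) := by
  rintro b ⟨hb, hbsum, hbs⟩ c ⟨hc, hcsum, hcs⟩ α β hα hβ hαβ
  refine ⟨fun v => ?_, ?_, fun v hv => ?_⟩
  · exact add_nonneg (mul_nonneg hα (hb v)) (mul_nonneg hβ (hc v))
  · simp only [Pi.add_apply, Pi.smul_apply, smul_eq_mul, Finset.sum_add_distrib,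
      ← Finset.mul_sum, hbsum, hcsum, mul_one, hαβ]
  · by_contra hvs
    have hbv : b v = 0 := by_contra fun h => hvs (hbs v h)
    have hcv : c v = 0 := by_contra fun h => hvs (hcs v h)
    exact hv (by simp [hbv, hcv])

lemma single_mem_cell [DecidableEq V] {v : V} (hv : v ∈ s) : Pi.single v 1 ∈ cell s := by
  refine ⟨fun w => ?_, by simp, fun w hw => ?_⟩
  · exact (Pi.single_nonneg.2 zero_le_one : (0 : V → ℝ) ≤ Pi.single v 1) w
  · rwa [show w = v from by_contra fun h => hw (Pi.single_eq_of_ne h _)]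

lemma starConvex_closedStar [DecidableEq V] (F : Set (Finset V)) (v : V) :
    StarConvex ℝ (Pi.single v 1) (closedStar F v) :=
  starConvex_iUnion fun s => starConvex_iUnion fun hs =>
    (convex_cell s).starConvex (single_mem_cell hs.2)

lemma exists_apply_pos {b : V → ℝ} (hb : b ∈ cell s) : ∃ v, 0 < b v := by
  by_contra! h
  linarith [hb.2.1, Finset.sum_nonpos fun v (_ : v ∈ Finset.univ) => h v]

lemma mem_closedStar_of_pos {b : V → ℝ} (hb : b ∈ Realization F) {v : V} (hv : 0 < b v) :
    b ∈ closedStar F v := by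
  obtain ⟨s, hs, hbs⟩ := mem_realization.1 hb
  exact cell_subset_closedStar hs (hbs.2.2 v hv.ne') hbs

lemma exists_mem_closedStar {b : V → ℝ} (hb : b ∈ Realization F) : ∃ v, b ∈ closedStar F v := by
  obtain ⟨s, -, hbs⟩ := mem_realization.1 hb
  obtain ⟨v, hv⟩ := exists_apply_pos hbs
  exact ⟨v, mem_closedStar_of_pos hb hv⟩

lemma exists_path_in_cells {x y : Realization F}
    (h : ∃ s ∈ F, (x : V → ℝ) ∈ cell s ∧ (y : V → ℝ) ∈ cell s) :
    ∃ p : Path x y, ∀ s, (x : V → ℝ) ∈ cell s → (y : V → ℝ) ∈ cell s →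
      ∀ t, (p t : V → ℝ) ∈ cell s := by
  have hmem : ∀ s, (x : V → ℝ) ∈ cell s → (y : V → ℝ) ∈ cell s →
      ∀ t : I, AffineMap.lineMap (x : V → ℝ) y (t : ℝ) ∈ cell s := fun s hx hy t =>
    (convex_cell s).segment_subset hx hy (by rw [segment_eq_image_lineMap]; exact ⟨t, t.2, rfl⟩)
  obtain ⟨s, hs, hx, hy⟩ := h
  refine ⟨{ toFun := fun t => ⟨_, cell_subset_realization hs (hmem s hx hy t)⟩,
            continuous_toFun := Continuous.subtype_mk ?_ _,
            source' := by simp, target' := by simp }, hmem⟩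
  simp only [AffineMap.lineMap_apply_module]
  fun_prop

lemma pathConnectedSpace_realization {v₀ : V} (hv₀ : ∃ s ∈ F, v₀ ∈ s)
    (hF : ∀ v, Relation.ReflTransGen (fun u w => ∃ s ∈ F, u ∈ s ∧ w ∈ s) v₀ v) :
    PathConnectedSpace (Realization F) := by
  classical
  obtain ⟨s₀, hs₀, hv₀⟩ := hv₀
  let b₀ : Realization F := ⟨_, cell_subset_realization hs₀ (single_mem_cell hv₀)⟩
  have hjoin : ∀ v (y : Realization F), (y : V → ℝ) ∈ closedStar F v → Joined b₀ y := by
    intro v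
    induction hF v with
    | refl =>
      intro y hy
      obtain ⟨s, hs, hv₀s, hys⟩ := mem_closedStar.1 hy
      exact ⟨(exists_path_in_cells ⟨s, hs, single_mem_cell hv₀s, hys⟩).choose⟩
    | @tail u w _ huw ih =>
      obtain ⟨s, hs, hu, hw⟩ := huw
      intro y hy
      obtain ⟨t, ht, hwt, hyt⟩ := mem_closedStar.1 hy
      let z : Realization F := ⟨_, cell_subset_realization hs (single_mem_cell hw)⟩
      exact (ih z (cell_subset_closedStar hs hu (single_mem_cell hw))).trans
        ⟨(exists_path_in_cells ⟨t, ht, single_mem_cell hwt, hyt⟩).choose⟩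
  have hall : ∀ y, Joined b₀ y := fun y =>
    let ⟨v, hv⟩ := exists_mem_closedStar y.2
    hjoin v y hv
  exact ⟨⟨b₀⟩, fun y z => (hall y).symm.trans (hall z)⟩

/-- `E` sends two points of a common simplex to the homotopy class of the paths in that simplex
which join them. -/
def IsSegmentMap (E : ∀ x y : Realization F,
    FundamentalGroupoid.mk x ⟶ FundamentalGroupoid.mk y) : Prop :=
  ∀ s ∈ F, ∀ ⦃x y : Realization F⦄ (p : Path x y), (∀ t, (p t : V → ℝ) ∈ cell s) →
    E x y = Path.Homotopic.Quotient.mk p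

lemma exists_isSegmentMap (F : Set (Finset V)) [PathConnectedSpace (Realization F)] :
    ∃ E : ∀ x y : Realization F, FundamentalGroupoid.mk x ⟶ FundamentalGroupoid.mk y,
      IsSegmentMap E := by
  have hseg : ∀ x y : Realization F, ∃ c : FundamentalGroupoid.mk x ⟶ FundamentalGroupoid.mk y,
      ∀ s ∈ F, ∀ p : Path x y, (∀ t, (p t : V → ℝ) ∈ cell s) →
        c = Path.Homotopic.Quotient.mk p := by
    intro x y
    by_cases h : ∃ s ∈ F, (x : V → ℝ) ∈ cell s ∧ (y : V → ℝ) ∈ cell s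
    · obtain ⟨q, hq⟩ := exists_path_in_cells h
      refine ⟨Path.Homotopic.Quotient.mk q, fun s hs p hp => Path.Homotopic.Quotient.eq.2 ?_⟩
      have hx : (x : V → ℝ) ∈ cell s := by simpa using hp 0
      have hy : (y : V → ℝ) ∈ cell s := by simpa using hp 1
      exact path_homotopic_of_starConvex (cell_subset_realization hs)
        ((convex_cell s).starConvex hx) q p (hq s hx hy) hp
    · refine ⟨Path.Homotopic.Quotient.mk (PathConnectedSpace.somePath x y), fun s hs p hp => ?_⟩
      exact absurd ⟨s, hs, by simpa using hp 0, by simpa using hp 1⟩ h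
  choose E hE using hseg
  exact ⟨E, fun s hs x y => hE x y s hs⟩

section SegmentMap

variable {E : ∀ x y : Realization F, FundamentalGroupoid.mk x ⟶ FundamentalGroupoid.mk y}

lemma IsSegmentMap.exists_path (hE : IsSegmentMap E) (hs : s ∈ F) {x y : Realization F}
    (hx : (x : V → ℝ) ∈ cell s) (hy : (y : V → ℝ) ∈ cell s) :
    ∃ p : Path x y, (∀ t, (p t : V → ℝ) ∈ cell s) ∧ E x y = Path.Homotopic.Quotient.mk p := by
  obtain ⟨p, hp⟩ := exists_path_in_cells ⟨s, hs, hx, hy⟩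
  exact ⟨p, hp s hx hy, hE s hs p (hp s hx hy)⟩

lemma IsSegmentMap.comp (hE : IsSegmentMap E) (hs : s ∈ F) {x y z : Realization F}
    (hx : (x : V → ℝ) ∈ cell s) (hy : (y : V → ℝ) ∈ cell s) (hz : (z : V → ℝ) ∈ cell s) :
    E x y ≫ E y z = E x z := by
  obtain ⟨p, hp, hxy⟩ := hE.exists_path hs hx hy
  obtain ⟨q, hq, hyz⟩ := hE.exists_path hs hy hz
  rw [hxy, hyz, hE s hs (p.trans q) (forall_trans_mem (S := Subtype.val ⁻¹' cell s) hp hq)]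
  rfl

lemma IsSegmentMap.self (hE : IsSegmentMap E) (x : Realization F) : E x x = 𝟙 _ := by
  obtain ⟨s, hs, hx⟩ := mem_realization.1 x.2
  exact hE s hs (Path.refl x) fun _ => hx

/-- The open star of `v` is simply connected in the realization, so a path in it may be replaced
by a detour through `v`. -/
lemma IsSegmentMap.comp_comp [DecidableEq V] (hE : IsSegmentMap E) {v : V}
    {a b x y z : Realization F} (hz : (z : V → ℝ) = Pi.single v 1) (γ : Path x y)
    (hγ : ∀ t, 0 < (γ t : V → ℝ) v)
    (hax : ∃ s ∈ F, (a : V → ℝ) ∈ cell s ∧ (x : V → ℝ) ∈ cell s)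
    (hyb : ∃ s ∈ F, (y : V → ℝ) ∈ cell s ∧ (b : V → ℝ) ∈ cell s) :
    E a x ≫ Path.Homotopic.Quotient.mk γ ≫ E y b = E a z ≫ E z b := by
  obtain ⟨s, hs, has, hxs⟩ := hax
  obtain ⟨t, ht, hyt, hbt⟩ := hyb
  have hvs : v ∈ s := hxs.2.2 v (by simpa using (hγ 0).ne')
  have hvt : v ∈ t := hyt.2.2 v (by simpa using (hγ 1).ne')
  obtain ⟨p, hp, hpE⟩ := hE.exists_path hs has hxs
  obtain ⟨q, hq, hqE⟩ := hE.exists_path ht hyt hbt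
  obtain ⟨p', hp', hpE'⟩ := hE.exists_path hs has (hz ▸ single_mem_cell hvs)
  obtain ⟨q', hq', hqE'⟩ := hE.exists_path ht (hz ▸ single_mem_cell hvt) hbt
  have hsv := cell_subset_closedStar hs hvs
  have htv := cell_subset_closedStar ht hvt
  rw [hpE, hqE, hpE', hqE']
  have hdetour : (p.trans (γ.trans q)).Homotopic (p'.trans q') := by
    refine path_homotopic_of_starConvex (closedStar_subset_realization F v)
      (starConvex_closedStar F v) _ _ ?_ ?_
    · exact forall_trans_mem (S := Subtype.val ⁻¹' closedStar F v) (fun t => hsv (hp t))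
        (forall_trans_mem (fun t => mem_closedStar_of_pos (γ t).2 (hγ t)) fun t => htv (hq t))
    · exact forall_trans_mem (S := Subtype.val ⁻¹' closedStar F v) (fun t => hsv (hp' t))
        fun t => htv (hq' t)
  exact Path.Homotopic.Quotient.eq.2 hdetour

/-- Once the values on edges lie in `H`, so do the values on paths: cut a path into pieces that lie
in open stars, and push the endpoints of the pieces and the pieces themselves to vertices. -/
lemma IsSegmentMap.loopOf_mem [DecidableEq V] (hE : IsSegmentMap E) {p : V → Realization F}
    (hp : ∀ v, (p v : V → ℝ) = Pi.single v 1) {x₀ : Realization F}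
    {β : ∀ x, FundamentalGroupoid.mk x₀ ⟶ FundamentalGroupoid.mk x}
    {τ : V → FundamentalGroup (Realization F) x₀}
    {H : Subgroup (FundamentalGroup (Realization F) x₀)}
    (hH : ∀ s ∈ F, ∀ u ∈ s, ∀ v ∈ s, τ u * loopOf β (E (p u) (p v)) * (τ v)⁻¹ ∈ H)
    {x y : Realization F} (γ : Path x y) {u w : V} (hx : (x : V → ℝ) ∈ closedStar F u)
    (hy : (y : V → ℝ) ∈ closedStar F w) :
    τ u * loopOf β (E (p u) x ≫ Path.Homotopic.Quotient.mk γ ≫ E y (p w)) * (τ w)⁻¹ ∈ H := by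
  have hcell : ∀ {s : Finset V} {v}, v ∈ s → (p v : V → ℝ) ∈ cell s := fun hv =>
    hp _ ▸ single_mem_cell hv
  refine path_induction_of_openCover (U := fun v => {b : Realization F | 0 < (b : V → ℝ) v})
    (P := fun x y c => ∀ {u w}, (x : V → ℝ) ∈ closedStar F u → (y : V → ℝ) ∈ closedStar F w →
      τ u * loopOf β (E (p u) x ≫ c ≫ E y (p w)) * (τ w)⁻¹ ∈ H)
    (fun v => isOpen_lt continuous_const ((continuous_apply v).comp continuous_subtype_val))
    (fun x => ?_) (fun v x y γ hγ u w hx hy => ?_) (fun x y z c c' hc hc' u w hx hz => ?_) γ hx hy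
  · obtain ⟨s, -, hx⟩ := mem_realization.1 x.2
    exact exists_apply_pos hx
  · obtain ⟨s, hs, hu, hxs⟩ := mem_closedStar.1 hx
    obtain ⟨t, ht, hw, hyt⟩ := mem_closedStar.1 hy
    have hpos : ∀ t, 0 < (γ t : V → ℝ) v := hγ
    have hvs : v ∈ s := hxs.2.2 v (by simpa using (hpos 0).ne')
    have hvt : v ∈ t := hyt.2.2 v (by simpa using (hpos 1).ne')
    rw [hE.comp_comp (hp v) γ hpos ⟨s, hs, hcell hu, hxs⟩ ⟨t, ht, hyt, hcell hw⟩, loopOf_comp]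
    convert H.mul_mem (hH s hs u hu v hvs) (hH t ht v hvt w hw) using 1
    group
  · obtain ⟨v, hy⟩ := exists_mem_closedStar y.2
    obtain ⟨s, hs, hv, hys⟩ := mem_closedStar.1 hy
    have hdetour : E y (p v) ≫ E (p v) y = 𝟙 _ := by rw [hE.comp hs hys (hcell hv) hys, hE.self]
    have hsplit : E (p u) x ≫ (c ≫ c') ≫ E z (p w) =
        (E (p u) x ≫ c ≫ E y (p v)) ≫ E (p v) y ≫ c' ≫ E z (p w) := by
      simp only [Category.assoc, reassoc_of% hdetour]
    rw [hsplit, loopOf_comp]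
    convert H.mul_mem (hc hx hy) (hc' hy hz) using 1
    group

end SegmentMap

/-- The fundamental group is generated by the edges of the complex. The base point is joined to the
vertices in an arbitrary way, so this applies to all gauge transforms of the cocycle of edges. -/
lemma exists_generating_cocycle [DecidableEq V] (p : V → Realization F)
    (hp : ∀ v, (p v : V → ℝ) = Pi.single v 1) (v₀ : V) [PathConnectedSpace (Realization F)] :
    ∃ g : V → V → FundamentalGroup (Realization F) (p v₀), IsCocycle F g ∧
      ∀ τ, τ v₀ = 1 → Subgroup.closure (edgeValues F (gaugeTransform τ g)) = ⊤ := by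
  obtain ⟨E, hE⟩ := exists_isSegmentMap F
  have hcell : ∀ {s : Finset V} {v}, v ∈ s → (p v : V → ℝ) ∈ cell s := fun hv =>
    hp _ ▸ single_mem_cell hv
  let β : ∀ x : Realization F, FundamentalGroupoid.mk (p v₀) ⟶ FundamentalGroupoid.mk x := E (p v₀)
  refine ⟨fun u v => loopOf β (E (p u) (p v)), fun s hs u hu v hv w hw => ?_,
    fun τ hτ => (Subgroup.eq_top_iff' _).2 fun c => ?_⟩
  · rw [← loopOf_comp, hE.comp hs (hcell hu) (hcell hv) (hcell hw)]
  obtain ⟨γ, hγ⟩ := Path.Homotopic.Quotient.mk_surjective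
    (c⁻¹ : FundamentalGroup (Realization F) (p v₀))
  have hv₀ : (p v₀ : V → ℝ) ∈ closedStar F v₀ :=
    mem_closedStar_of_pos (p v₀).2 (by simp [hp])
  have hmem := hE.loopOf_mem hp (β := β) (τ := τ)
    (H := Subgroup.closure (edgeValues F (gaugeTransform τ fun u v => loopOf β (E (p u) (p v)))))
    (fun s hs u hu v hv => Subgroup.subset_closure ⟨s, hs, u, hu, v, hv, rfl⟩) γ hv₀ hv₀
  have hc : loopOf β (E (p v₀) (p v₀) ≫ Path.Homotopic.Quotient.mk γ ≫ E (p v₀) (p v₀)) = c := by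
    rw [hγ, hE.self]
    change E (p v₀) (p v₀) ≫ Groupoid.inv (𝟙 _ ≫ Groupoid.inv c ≫ 𝟙 _) ≫
      Groupoid.inv (E (p v₀) (p v₀)) = c
    rw [hE.self]
    simp
  rwa [hc, hτ, inv_one, one_mul, mul_one] at hmem

end Realization

end FundamentalGroups

section Realization

variable {V : Type*} [Fintype V]

lemma isCompact_cell (s : Finset V) : IsCompact (cell s) := by
  have hcell : cell s = stdSimplex ℝ V ∩ ⋂ v, ⋂ (_ : v ∉ s), {b | b v = 0} := by
    ext b
    simp only [cell, stdSimplex, Set.mem_ofPred_eq, Set.mem_inter_iff, Set.mem_iInter, and_assoc,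
      not_imp_comm]
  rw [hcell]
  exact (isCompact_stdSimplex ℝ V).inter_right <| isClosed_iInter fun v => isClosed_iInter fun _ =>
    isClosed_eq (continuous_apply v) continuous_const

lemma isCompact_realization (F : Set (Finset V)) : IsCompact (Realization F) :=
  (Set.toFinite F).isCompact_biUnion fun s _ => isCompact_cell s

lemma cell_inter [DecidableEq V] (s t : Finset V) : cell (s ∩ t) = cell s ∩ cell t := by
  ext b
  simp only [cell, Set.mem_ofPred_eq, Set.mem_inter_iff, Finset.mem_inter]
  exact ⟨fun ⟨h0, h1, h⟩ => ⟨⟨h0, h1, fun v hv => (h v hv).1⟩, h0, h1, fun v hv => (h v hv).2⟩,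
    fun ⟨⟨h0, h1, h⟩, _, _, h'⟩ => ⟨h0, h1, fun v hv => ⟨h v hv, h' v hv⟩⟩⟩

variable {E : Type*} [AddCommGroup E] [Module ℝ E]

lemma image_cell_eq_convexHull [DecidableEq E] (pos : V → E) (s : Finset V) :
    (fun b : V → ℝ => ∑ v, b v • pos v) '' cell s = convexHull ℝ (s.image pos : Set E) := by
  classical
  refine Set.Subset.antisymm ?_ (convexHull_min ?_ ?_)
  · rintro _ ⟨b, ⟨hb0, hb1, hbs⟩, rfl⟩
    have hzero : ∀ v ∈ Finset.univ, v ∉ s → b v = 0 := fun v _ hv => not_imp_comm.1 (hbs v) hv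
    have hsum := Finset.sum_subset s.subset_univ hzero
    have hsum' : ∑ v ∈ s, b v • pos v = ∑ v, b v • pos v :=
      Finset.sum_subset s.subset_univ fun v hv hvs => by rw [hzero v hv hvs, zero_smul]
    change ∑ v, b v • pos v ∈ _
    rw [← hsum']
    exact (convex_convexHull ℝ _).sum_mem (fun v _ => hb0 v) (hsum.trans hb1) fun v hv =>
      subset_convexHull ℝ _ (Finset.mem_coe.2 (Finset.mem_image_of_mem pos hv))
  · intro y hy
    obtain ⟨v, hv, rfl⟩ := Finset.mem_image.1 (Finset.mem_coe.1 hy)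
    exact ⟨_, single_mem_cell hv, by simp [Pi.single_apply]⟩
  · exact (convex_cell s).linear_image (Fintype.linearCombination ℝ pos)

lemma injOn_cell_of_affineIndependent [DecidableEq E] {pos : V → E} (hpos : Function.Injective pos)
    {s : Finset V} (hs : AffineIndependent ℝ ((↑) : s.image pos → E)) :
    Set.InjOn (fun b : V → ℝ => ∑ v, b v • pos v) (cell s) := by
  intro b hb c hc hbc
  let ι : s ↪ s.image pos := ⟨fun v => ⟨pos v, Finset.mem_image_of_mem pos v.2⟩, fun v w hvw =>
    Subtype.ext (hpos (congrArg Subtype.val hvw))⟩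
  have hind : AffineIndependent ℝ (fun v : s => pos v) := hs.comp_embedding ι
  have hzero : ∀ v ∈ Finset.univ, v ∉ s → b v - c v = 0 := fun v _ hv => by
    rw [not_imp_comm.1 (hb.2.2 v) hv, not_imp_comm.1 (hc.2.2 v) hv, sub_zero]
  have hsum : ∑ v : s, (b v - c v) = 0 := by
    rw [Finset.sum_coe_sort s (fun v => b v - c v), Finset.sum_subset s.subset_univ hzero,
      Finset.sum_sub_distrib, hb.2.1, hc.2.1, sub_self]
  have hsum' : ∑ v : s, (b v - c v) • pos v = 0 := by
    rw [Finset.sum_coe_sort s (fun v => (b v - c v) • pos v),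
      Finset.sum_subset s.subset_univ fun v hv hvs => by rw [hzero v hv hvs, zero_smul]]
    simp only [sub_smul, Finset.sum_sub_distrib]
    exact sub_eq_zero.2 hbc
  funext v
  by_cases hv : v ∈ s
  · exact sub_eq_zero.1 (affineIndependent_iff.1 hind Finset.univ (fun v => b v - c v) hsum hsum'
      ⟨v, hv⟩ (Finset.mem_univ _))
  · exact sub_eq_zero.1 (hzero v (Finset.mem_univ v) hv)

section SimplicialComplex

variable [DecidableEq E] {K : SimplicialComplex ℝ E} {F : Set (Finset V)} {pos : V → E}

lemma image_realization_eq_space (hF : ∀ s ∈ F, s.image pos ∈ K.faces)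
    (hK : ∀ t ∈ K.faces, ∃ s ∈ F, t ⊆ s.image pos) :
    (fun b : V → ℝ => ∑ v, b v • pos v) '' Realization F = K.space := by
  ext x
  simp only [Realization, Set.image_iUnion, image_cell_eq_convexHull, Set.mem_iUnion,
    SimplicialComplex.mem_space_iff, exists_prop]
  refine ⟨fun ⟨s, hs, hx⟩ => ⟨_, hF s hs, hx⟩, fun ⟨t, ht, hx⟩ => ?_⟩
  obtain ⟨s, hs, hts⟩ := hK t ht
  exact ⟨s, hs, convexHull_mono (Finset.coe_subset.2 hts) hx⟩

/-- Two points with the same image lie in two simplices, whose images meet in the image of their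
common face; affine independence applies in each of the two simplices. -/
lemma injOn_realization (hpos : Function.Injective pos) (hF : ∀ s ∈ F, s.image pos ∈ K.faces) :
    Set.InjOn (fun b : V → ℝ => ∑ v, b v • pos v) (Realization F) := by
  classical
  intro b hb c hc hbc
  obtain ⟨s, hs, hb⟩ := mem_realization.1 hb
  obtain ⟨t, ht, hc⟩ := mem_realization.1 hc
  have hmem : ∑ v, b v • pos v ∈ convexHull ℝ ((s ∩ t).image pos : Set E) := by
    rw [Finset.image_inter _ _ hpos, Finset.coe_inter]
    refine K.inter_subset_convexHull (hF s hs) (hF t ht) ?_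
    rw [← image_cell_eq_convexHull, ← image_cell_eq_convexHull]
    exact ⟨⟨b, hb, rfl⟩, c, hc, hbc.symm⟩
  rw [← image_cell_eq_convexHull, cell_inter] at hmem
  obtain ⟨d, ⟨hds, hdt⟩, hd⟩ := hmem
  exact (injOn_cell_of_affineIndependent hpos (K.indep (hF s hs)) hb hds hd.symm).trans
    (injOn_cell_of_affineIndependent hpos (K.indep (hF t ht)) hdt hc (hd.trans hbc))

lemma nonempty_realization_homeomorph_space [TopologicalSpace E] [T2Space E] [ContinuousAdd E]
    [ContinuousSMul ℝ E] (hpos : Function.Injective pos) (hF : ∀ s ∈ F, s.image pos ∈ K.faces)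
    (hK : ∀ t ∈ K.faces, ∃ s ∈ F, t ⊆ s.image pos) :
    Nonempty (Realization F ≃ₜ K.space) := by
  have := isCompact_iff_compactSpace.1 (isCompact_realization F)
  let f := Set.BijOn.equiv _ ((injOn_realization hpos hF).bijOn_image)
  have hf : Continuous f := Continuous.subtype_mk (continuous_finsetSum _ fun v _ =>
    ((continuous_apply v).comp continuous_subtype_val).smul continuous_const) _
  exact ⟨(Continuous.homeoOfEquivCompactToT2 hf).trans
    (Homeomorph.setCongr (image_realization_eq_space hF hK))⟩

end SimplicialComplex

end Realization

namespace FacetSystem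

variable {A B : Type*} {C : FacetSystem A B}

lemma Normal.groupRank_fundamentalGroup_le [Fintype A] [Fintype B] [DecidableEq A] [DecidableEq B]
    (hC : C.Normal) {M : Type*} [TopologicalSpace M] [PathConnectedSpace M]
    (e : Realization C.simplices ≃ₜ M) (x : M) {R : Set (Sym2 A)} (hRC : R ⊆ C.graph.edgeSet)
    (hR : C.RemovableFrom C.graph R) :
    groupRank (FundamentalGroup M x) + R.ncard + Nat.card A ≤ C.graph.edgeSet.ncard + 1 := by
  have : PathConnectedSpace (Realization C.simplices) :=
    e.symm.surjective.pathConnectedSpace e.symm.continuous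
  obtain ⟨r⟩ := hC.left.connected.nonempty
  have hvertex : ∀ v, Pi.single v 1 ∈ Realization C.simplices := by
    rintro (a | b)
    · obtain ⟨_, _, _, h⟩ := hC.left.exists_adj a
      obtain ⟨s, hs, ha, -⟩ := exists_mem_simplices h
      exact cell_subset_realization hs (single_mem_cell ha)
    · obtain ⟨_, _, _, h⟩ := hC.right.exists_adj b
      obtain ⟨s, hs, -, -, hb, -⟩ := exists_mem_simplices (C := C) h
      exact cell_subset_realization hs (single_mem_cell hb)
  obtain ⟨g, hg, hgen⟩ :=
    exists_generating_cocycle (fun v => ⟨_, hvertex v⟩) (fun _ => rfl) (.inl r)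
  rw [← groupRank_fundamentalGroup_congr e _ x]
  exact hC.groupRank_le r hg hgen hRC hR

end FacetSystem

/-! ### Arcs, circles and theta graphs -/

section Arc

open SimpleGraph

variable {V : Type*} {G : SimpleGraph V} {p q : V}

/-- The edges of `G` form a path with the endpoints `p ≠ q`. There may be isolated vertices. -/
def IsArc (G : SimpleGraph V) (p q : V) : Prop :=
  p ≠ q ∧ ∃ w : G.Walk p q, w.IsPath ∧ ∀ e ∈ G.edgeSet, e ∈ w.edges

lemma neighborSet_subset_of_ncard_le_two [Finite V] {a v b : V} (hv : (G.neighborSet v).ncard ≤ 2)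
    (ha : G.Adj v a) (hb : G.Adj v b) (hab : a ≠ b) : G.neighborSet v ⊆ {a, b} := by
  have hsub : ({a, b} : Set V) ⊆ G.neighborSet v := by rintro _ (rfl | rfl) <;> assumption
  exact (Set.eq_of_subset_of_ncard_le hsub (by rwa [Set.ncard_pair hab])).ge

lemma mk_mem_edges_of_adj_getVert [Finite V] (hp : (G.neighborSet p).ncard ≤ 1)
    (hdeg : ∀ v, (G.neighborSet v).ncard ≤ 2) {z : V} {w : G.Walk p z} (hw : w.IsPath) {k : ℕ}
    (hk : k < w.length) {u : V} (hu : G.Adj (w.getVert k) u) : s(w.getVert k, u) ∈ w.edges := by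
  have hnext := w.adj_getVert_succ hk
  rcases k with _ | k
  · rw [w.getVert_zero] at hu hnext ⊢
    rw [(Set.ncard_le_one_iff (Set.toFinite _)).1 hp hu hnext]
    exact (Walk.mk_mem_edges_iff_exists _).2 ⟨0, hk, by rw [w.getVert_zero]⟩
  · have hprev := w.adj_getVert_succ (k.lt_succ_self.trans hk)
    have hne : w.getVert k ≠ w.getVert (k + 1 + 1) := fun h => by
      have := hw.getVert_injOn (show k ≤ w.length by omega) (show k + 1 + 1 ≤ w.length by omega) h
      omega
    rcases neighborSet_subset_of_ncard_le_two (hdeg _) hprev.symm hnext hne hu with rfl | rfl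
    · exact (Walk.mk_mem_edges_iff_exists _).2 ⟨k, k.lt_succ_self.trans hk, Sym2.eq_swap⟩
    · exact (Walk.mk_mem_edges_iff_exists _).2 ⟨k + 1, hk, rfl⟩

lemma exists_isPath_forall_adj_mem_support [Finite V] (G : SimpleGraph V) (p : V) :
    ∃ (z : V) (w : G.Walk p z), w.IsPath ∧ ∀ u, G.Adj z u → u ∈ w.support := by
  have := Fintype.ofFinite V
  have hfin : {n | ∃ (z : V) (w : G.Walk p z), w.IsPath ∧ w.length = n}.Finite :=
    (Set.finite_lt_nat (Fintype.card V)).subset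
      (by rintro _ ⟨z, w, hw, rfl⟩; exact hw.length_lt)
  obtain ⟨_, ⟨z, w, hw, rfl⟩, hmax⟩ := hfin.exists_maximal ⟨0, p, .nil, .nil, rfl⟩
  refine ⟨z, w, hw, fun u hu => by_contra fun hmem => ?_⟩
  have := hmax ⟨u, w.concat hu, hw.concat hmem hu, rfl⟩ (by simp [Walk.length_concat])
  simp [Walk.length_concat] at this

lemma exists_isPath_forall_adj_mk_mem_edges [Finite V] (hp : (G.neighborSet p).ncard ≤ 1)
    (hle : ∀ v, (G.neighborSet v).ncard ≤ 2) :
    ∃ (z : V) (w : G.Walk p z), w.IsPath ∧ ∀ v ∈ w.support, ∀ u, G.Adj v u → s(v, u) ∈ w.edges := by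
  obtain ⟨z, w, hw, hz⟩ := exists_isPath_forall_adj_mem_support G p
  refine ⟨z, w, hw, fun v hv u hu => ?_⟩
  obtain ⟨k, rfl, hk⟩ := Walk.mem_support_iff_exists_getVert.1 hv
  rcases hk.lt_or_eq with hk | rfl
  · exact mk_mem_edges_of_adj_getVert hp hle hw hk hu
  rw [w.getVert_length] at hu ⊢
  obtain ⟨m, rfl, hm⟩ := Walk.mem_support_iff_exists_getVert.1 (hz u hu)
  have hm' : m < w.length := hm.lt_of_ne fun h => by
    rw [h, w.getVert_length] at hu
    exact hu.ne rfl
  rw [Sym2.eq_swap]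
  exact mk_mem_edges_of_adj_getVert hp hle hw hm' hu.symm

lemma isArc_of_ncard_neighborSet [Finite V] (hpq : p ≠ q) (hp : (G.neighborSet p).ncard = 1)
    (hq : (G.neighborSet q).ncard ≤ 1)
    (hdeg : ∀ v, v ≠ p → v ≠ q → (G.neighborSet v).Nonempty → (G.neighborSet v).ncard = 2)
    (hreach : ∀ v, (G.neighborSet v).Nonempty → G.Reachable p v ∨ G.Reachable q v) :
    IsArc G p q := by
  have hle : ∀ v, (G.neighborSet v).ncard ≤ 2 := fun v => by
    by_cases hvp : v = p
    · rw [hvp]; omega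
    by_cases hvq : v = q
    · rw [hvq]; omega
    rcases (G.neighborSet v).eq_empty_or_nonempty with h | h
    · simp [h]
    · exact (hdeg v hvp hvq h).le
  obtain ⟨z, w, hw, hedge⟩ := exists_isPath_forall_adj_mk_mem_edges hp.le hle
  have hzp : z ≠ p := by
    rintro rfl
    obtain ⟨u, hu⟩ := Set.nonempty_of_ncard_ne_zero (hp ▸ one_ne_zero)
    have := hedge z w.end_mem_support u hu
    simp [Walk.edges_eq_nil.2 (Walk.isPath_iff_nil.1 hw)] at this
  have hnil : ¬ w.Nil := Walk.not_nil_of_ne hzp.symm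
  obtain rfl : z = q := by
    by_contra hzq
    have h2 := hdeg z hzp hzq ⟨_, (w.adj_penultimate hnil).symm⟩
    obtain ⟨u, hu, hne⟩ := Set.exists_ne_of_one_lt_ncard (h2.symm ▸ one_lt_two) w.penultimate
    exact hne (hw.eq_penultimate_of_mem_edges (Sym2.eq_swap ▸ hedge z w.end_mem_support u hu))
  refine ⟨hpq, w, hw, Sym2.ind fun v u (hvu : G.Adj v u) => hedge v ?_ u hvu⟩
  have hclosed : ∀ {a b}, G.Reachable a b → a ∈ w.support → b ∈ w.support := fun {a b} hab ha => by
    obtain ⟨c⟩ := hab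
    induction c with
    | nil => exact ha
    | cons h _ ih => exact ih (w.snd_mem_support_of_mem_edges (hedge _ ha _ h))
  exact (hreach v ⟨u, hvu⟩).elim (hclosed · w.start_mem_support) (hclosed · w.end_mem_support)

/-- The edges of `G` with the label `i`. -/
def labelGraph {ι : Type*} (G : SimpleGraph V) (l : Sym2 V → ι) (i : ι) : SimpleGraph V where
  Adj v w := G.Adj v w ∧ l s(v, w) = i
  symm := ⟨fun _ _ h => ⟨h.1.symm, by rw [Sym2.eq_swap]; exact h.2⟩⟩
  loopless := ⟨fun _ h => h.1.ne rfl⟩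

end Arc

section Height

open SimpleGraph

variable {V ι : Type*} {G : SimpleGraph V} {l : Sym2 V → ι} {p q : V}

/-- A height function on the geometric realization of a graph whose edges with each given label form
an arc from the vertex of height `1` to the vertex of height `-1`. It is affine on the edges, and
each arc has exactly one point of each height in `[-1, 1]` (`surj`, `inj`). In `inj` the points
are rescaled by a common factor and compared by all functions that are affine on edges. -/
structure IsHeight (G : SimpleGraph V) (l : Sym2 V → ι) (h : V → ℝ) : Prop where
  abs_le : ∀ v, |h v| ≤ 1
  eq_of_abs : ∀ v w, |h v| = 1 → h v = h w → v = w
  abs_eq : ∀ v w w', G.Adj v w → G.Adj v w' → l s(v, w) ≠ l s(v, w') → |h v| = 1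
  surj : ∀ i s, |s| ≤ 1 → ∃ v w r, G.Adj v w ∧ l s(v, w) = i ∧ 0 ≤ r ∧ r ≤ 1 ∧
    s = (1 - r) * h v + r * h w
  inj : ∀ v w v' w' α β α' β', G.Adj v w → G.Adj v' w' → l s(v, w) = l s(v', w') → 0 ≤ α → 0 ≤ β →
    0 ≤ α' → 0 ≤ β' → α + β = α' + β' → α * h v + β * h w = α' * h v' + β' * h w' →
    ∀ f : V → ℝ, α * f v + β * f w = α' * f v' + β' * f w'

lemma length_pos_of_ne (w : G.Walk p q) (hpq : p ≠ q) : 0 < w.length :=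
  Walk.not_nil_iff_lt_length.1 (Walk.not_nil_of_ne hpq)

lemma exists_nat_mem_Icc_lt {L : ℕ} (hL : 0 < L) {t : ℝ} (ht₀ : 0 ≤ t) (htL : t ≤ L) :
    ∃ k < L, (k : ℝ) ≤ t ∧ t ≤ k + 1 := by
  rcases htL.lt_or_eq with h | rfl
  · exact ⟨⌊t⌋₊, (Nat.floor_lt ht₀).2 h, Nat.floor_le ht₀, (Nat.lt_floor_add_one t).le⟩
  · refine ⟨L - 1, by omega, by exact_mod_cast Nat.sub_le _ _, ?_⟩
    rw [Nat.cast_sub hL]; simp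

lemma nat_interpolation_eq {k m : ℕ} {a b a' b' : ℝ} (ha : 0 ≤ a) (hb : 0 ≤ b) (ha' : 0 ≤ a')
    (hb' : 0 ≤ b') (hmass : a + b = a' + b')
    (hmean : a * k + b * (k + 1) = a' * m + b' * (m + 1)) (f : ℕ → ℝ) :
    a * f k + b * f (k + 1) = a' * f m + b' * f (m + 1) := by
  wlog hkm : k ≤ m generalizing k m a b a' b'
  · exact (this ha' hb' ha hb hmass.symm hmean.symm (by omega)).symm
  have hdiff : (a + b) * (m - k) = b - b' := by linear_combination m * hmass - hmean
  obtain ⟨n, rfl⟩ := Nat.exists_eq_add_of_le hkm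
  rcases n with _ | n
  · have hbb : b = b' := by simpa [sub_eq_zero, eq_comm] using hdiff
    subst hbb
    rw [add_right_cancel hmass]
    rfl
  · push_cast at hdiff
    have hn : 0 ≤ (a + b) * n := by positivity
    have hsum : (a + b) * n + a + b' = 0 := by linear_combination hdiff
    obtain ⟨rfl, rfl⟩ : a = 0 ∧ b' = 0 := ⟨by linarith, by linarith⟩
    rcases n with _ | n
    · rw [show b = a' by linarith]; ring
    · push_cast at hsum
      have hbn : 0 ≤ b * n := by positivity
      obtain rfl : b = 0 := by linarith
      rw [show a' = 0 by linarith]; ring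

lemma exists_interpolation_getVert {w : G.Walk p q} {v u : V} (h : s(v, u) ∈ w.edges) {α β : ℝ}
    (hα : 0 ≤ α) (hβ : 0 ≤ β) :
    ∃ k < w.length, ∃ a b : ℝ, 0 ≤ a ∧ 0 ≤ b ∧ a + b = α + β ∧
      ∀ f : V → ℝ, α * f v + β * f u = a * f (w.getVert k) + b * f (w.getVert (k + 1)) := by
  obtain ⟨k, hk, heq⟩ := (Walk.mk_mem_edges_iff_exists _).1 h
  rcases Sym2.eq_iff.1 heq with ⟨rfl, rfl⟩ | ⟨rfl, rfl⟩
  · exact ⟨k, hk, α, β, hα, hβ, rfl, fun f => rfl⟩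
  · exact ⟨k, hk, β, α, hβ, hα, add_comm _ _, fun f => add_comm _ _⟩

lemma div_length_eq_of_getVert_eq {W : ∀ i, (labelGraph G l i).Walk p q} (hW : ∀ i, (W i).IsPath)
    (hpq : p ≠ q)
    (hlab : ∀ v w w', v ≠ p → v ≠ q → G.Adj v w → G.Adj v w' → l s(v, w) = l s(v, w'))
    {i j : ι} {k m : ℕ} (hk : k ≤ (W i).length) (hm : m ≤ (W j).length)
    (h : (W i).getVert k = (W j).getVert m) :
    (k : ℝ) / (W i).length = m / (W j).length := by
  have hlen : ∀ i, ((W i).length : ℝ) ≠ 0 := fun i => mod_cast (length_pos_of_ne _ hpq).ne'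
  by_cases hp : (W i).getVert k = p
  · rw [((hW i).getVert_eq_start_iff hk).1 hp, ((hW j).getVert_eq_start_iff hm).1 (h ▸ hp)]
    simp
  by_cases hq : (W i).getVert k = q
  · rw [((hW i).getVert_eq_end_iff hk).1 hq, ((hW j).getVert_eq_end_iff hm).1 (h ▸ hq),
      div_self (hlen i), div_self (hlen j)]
  have hk' : k < (W i).length := hk.lt_of_ne fun h' => hq (by rw [h', Walk.getVert_length])
  have hm' : m < (W j).length := hm.lt_of_ne fun h' => hq (by rw [h, h', Walk.getVert_length])
  obtain ⟨hadj, hi⟩ := (W i).adj_getVert_succ hk'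
  obtain ⟨hadj', hj⟩ := (W j).adj_getVert_succ hm'
  rw [← h] at hadj' hj
  obtain rfl : i = j := by rw [← hi, ← hj, hlab _ _ _ hp hq hadj hadj']
  rw [(hW i).getVert_injOn hk hm h]

lemma exists_height_getVert {W : ∀ i, (labelGraph G l i).Walk p q} (hW : ∀ i, (W i).IsPath)
    (hpq : p ≠ q)
    (hlab : ∀ v w w', v ≠ p → v ≠ q → G.Adj v w → G.Adj v w' → l s(v, w) = l s(v, w'))
    (hcover : ∀ v, ∃ i, v ∈ (W i).support) :
    ∃ h : V → ℝ, ∀ i, ∀ k ≤ (W i).length, h ((W i).getVert k) = 1 - 2 * (k / (W i).length) := by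
  choose c hc using hcover
  choose n hn hle using fun v => Walk.mem_support_iff_exists_getVert.1 (hc v)
  exact ⟨fun v => 1 - 2 * (n v / (W (c v)).length), fun i k hk => by
    dsimp only
    rw [div_length_eq_of_getVert_eq hW hpq hlab (hle _) hk (hn _)]⟩

lemma height_bounds_of_getVert {h : V → ℝ} {w : G.Walk p q} (hpq : p ≠ q)
    (hh : ∀ k ≤ w.length, h (w.getVert k) = 1 - 2 * (k / w.length)) {v : V} (hv : v ∈ w.support) :
    |h v| ≤ 1 ∧ (h v = 1 → v = p) ∧ (h v = -1 → v = q) := by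
  have hlen : (0 : ℝ) < w.length := mod_cast length_pos_of_ne w hpq
  obtain ⟨k, rfl, hk⟩ := Walk.mem_support_iff_exists_getVert.1 hv
  have hk₀ : (0 : ℝ) ≤ k / w.length := by positivity
  have hk₁ : (k : ℝ) / w.length ≤ 1 := div_le_one_of_le₀ (mod_cast hk) hlen.le
  rw [hh k hk]
  refine ⟨abs_le.2 ⟨by linarith, by linarith⟩, fun h1 => ?_, fun h1 => ?_⟩
  · have hzero : (k : ℝ) / w.length = 0 := by linarith
    obtain rfl : k = 0 := by simpa [hlen.ne'] using hzero
    exact w.getVert_zero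
  · have hone : (k : ℝ) / w.length = 1 := by linarith
    obtain rfl : k = w.length := mod_cast (div_eq_one_iff_eq hlen.ne').1 hone
    exact w.getVert_length

lemma exists_adj_height_eq_of_getVert {h : V → ℝ} {w : G.Walk p q} (hpq : p ≠ q)
    (hh : ∀ k ≤ w.length, h (w.getVert k) = 1 - 2 * (k / w.length)) {s : ℝ} (hs : |s| ≤ 1) :
    ∃ v u r, G.Adj v u ∧ 0 ≤ r ∧ r ≤ 1 ∧ s = (1 - r) * h v + r * h u := by
  have hlen : (0 : ℝ) < w.length := mod_cast length_pos_of_ne w hpq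
  obtain ⟨hs₀, hs₁⟩ := abs_le.1 hs
  obtain ⟨k, hk, hkt, htk⟩ := exists_nat_mem_Icc_lt (length_pos_of_ne w hpq)
    (t := (1 - s) / 2 * w.length) (mul_nonneg (by linarith) hlen.le)
    (mul_le_of_le_one_left hlen.le (by linarith))
  refine ⟨_, _, (1 - s) / 2 * w.length - k, w.adj_getVert_succ hk, by linarith, by linarith, ?_⟩
  rw [hh k hk.le, hh (k + 1) hk]
  push_cast
  field_simp
  ring

lemma interpolation_eq_of_height_eq {h : V → ℝ} {w : G.Walk p q} (hpq : p ≠ q)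
    (hh : ∀ k ≤ w.length, h (w.getVert k) = 1 - 2 * (k / w.length)) {v u v' u' : V}
    (he : s(v, u) ∈ w.edges) (he' : s(v', u') ∈ w.edges) {α β α' β' : ℝ} (hα : 0 ≤ α)
    (hβ : 0 ≤ β) (hα' : 0 ≤ α') (hβ' : 0 ≤ β') (hmass : α + β = α' + β')
    (hmean : α * h v + β * h u = α' * h v' + β' * h u') (f : V → ℝ) :
    α * f v + β * f u = α' * f v' + β' * f u' := by
  have hlen : (0 : ℝ) < w.length := mod_cast length_pos_of_ne w hpq
  obtain ⟨k, hk, a, b, ha, hb, hab, heq⟩ := exists_interpolation_getVert he hα hβ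
  obtain ⟨m, hm, a', b', ha', hb', hab', heq'⟩ := exists_interpolation_getVert he' hα' hβ'
  rw [heq, heq'] at hmean ⊢
  refine nat_interpolation_eq ha hb ha' hb' (by linarith) ?_ fun n => f (w.getVert n)
  rw [hh k hk.le, hh (k + 1) hk, hh m hm.le, hh (m + 1) hm] at hmean
  push_cast at hmean
  field_simp at hmean
  linear_combination w.length / 2 * (hab.trans (hmass.trans hab'.symm)) - hmean / 2

lemma exists_isHeight (harc : ∀ i, IsArc (labelGraph G l i) p q)
    (hnon : ∀ v, (G.neighborSet v).Nonempty)
    (hlab : ∀ v w w', v ≠ p → v ≠ q → G.Adj v w → G.Adj v w' → l s(v, w) = l s(v, w')) :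
    ∃ h : V → ℝ, IsHeight G l h := by
  choose hpq W hW hedges using harc
  have hcover : ∀ v, ∃ i, v ∈ (W i).support := fun v => by
    obtain ⟨u, hu⟩ := hnon v
    exact ⟨l s(v, u), (W _).fst_mem_support_of_mem_edges (hedges _ s(v, u) ⟨hu, rfl⟩)⟩
  choose c hc using hcover
  have hpq' : p ≠ q := hpq (c p)
  obtain ⟨h, hh⟩ := exists_height_getVert hW hpq' hlab fun v => ⟨c v, hc v⟩
  have hval v := height_bounds_of_getVert hpq' (hh (c v)) (hc v)
  have hp : h p = 1 := by simpa using hh (c p) 0 (Nat.zero_le _)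
  have hq : h q = -1 := by
    have hend := hh (c p) _ le_rfl
    rw [div_self (mod_cast (length_pos_of_ne (W (c p)) hpq').ne'), Walk.getVert_length] at hend
    rw [hend]
    norm_num
  refine ⟨h, fun v => (hval v).1, fun v w hv hvw => ?_, fun v w w' hw hw' hne => ?_,
    fun i s hs => ?_, fun v w v' w' α β α' β' hvw hvw' hl hα hβ hα' hβ' hmass hmean =>
      interpolation_eq_of_height_eq hpq' (hh (l s(v, w))) (hedges _ s(v, w) ⟨hvw, rfl⟩)
        (hedges _ s(v', w') ⟨hvw', hl.symm⟩) hα hβ hα' hβ' hmass hmean⟩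
  · rcases eq_or_eq_neg_of_abs_eq hv with hv | hv
    · rw [(hval v).2.1 hv, (hval w).2.1 (hvw ▸ hv)]
    · rw [(hval v).2.2 hv, (hval w).2.2 (hvw ▸ hv)]
  · have hend : v = p ∨ v = q := by
      by_contra! hv
      exact hne (hlab v w w' hv.1 hv.2 hw hw')
    rcases hend with rfl | rfl <;> simp [hp, hq]
  · obtain ⟨v, u, r, ⟨hadj, hi⟩, hr⟩ := exists_adj_height_eq_of_getVert hpq' (hh i) hs
    exact ⟨v, u, r, hadj, hi, hr⟩

end Height

section Theta

open SimpleGraph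

variable {V ι : Type*} {G : SimpleGraph V}

lemma exists_reachable_labelGraph {l : Sym2 V → ι} {P : V → Prop}
    (hlab : ∀ v w w', ¬ P v → G.Adj v w → G.Adj v w' → l s(v, w) = l s(v, w')) {i : ι} {v b : V}
    (hvb : G.Reachable v b) (hb : P b) (hv : ((labelGraph G l i).neighborSet v).Nonempty) :
    ∃ b, P b ∧ (labelGraph G l i).Reachable v b := by
  obtain ⟨W⟩ := hvb
  induction W with
  | nil => exact ⟨_, hb, .rfl⟩
  | @cons v c b hvc _ ih =>
    by_cases hPv : P v
    · exact ⟨v, hPv, .rfl⟩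
    obtain ⟨w, hw, hi⟩ := hv
    have hc : (labelGraph G l i).Adj v c := ⟨hvc, by rw [hlab v c w hPv hvc hw, hi]⟩
    obtain ⟨b', hb', hreach⟩ := ih hb ⟨v, hc.symm⟩
    exact ⟨b', hb', hc.reachable.trans hreach⟩

variable [Finite V]

lemma ncard_neighborSet_eq_sum_labelGraph [Fintype ι] (l : Sym2 V → ι) (v : V) :
    (G.neighborSet v).ncard = ∑ i, ((labelGraph G l i).neighborSet v).ncard := by
  have hunion : G.neighborSet v = ⋃ i, (labelGraph G l i).neighborSet v := by
    ext w
    simp [labelGraph]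
  rw [hunion, Set.ncard_iUnion_of_finite (fun _ => Set.toFinite _), finsum_eq_sum_of_fintype]
  exact fun i j hij => Set.disjoint_left.2 fun w hi hj => hij (hi.2.symm.trans hj.2)

lemma ncard_neighborSet_labelGraph_add {l : Sym2 V → ι} {i : ι}
    (hcyc : (G \ labelGraph G l i).IsCycles) (v : V) :
    (G.neighborSet v).ncard = ((labelGraph G l i).neighborSet v).ncard ∨
      (G.neighborSet v).ncard = ((labelGraph G l i).neighborSet v).ncard + 2 := by
  have hdiff : (G \ labelGraph G l i).neighborSet v =
      G.neighborSet v \ (labelGraph G l i).neighborSet v := by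
    ext w
    simp
  have hadd := Set.ncard_sdiff_add_ncard_of_subset (s := (labelGraph G l i).neighborSet v)
    (t := G.neighborSet v) (fun w hw => hw.1) (Set.toFinite _)
  rw [← hdiff] at hadd
  rcases ((G \ labelGraph G l i).neighborSet v).eq_empty_or_nonempty with h | h
  · left; rw [← hadd, h, Set.ncard_empty, zero_add]
  · right; rw [← hadd, hcyc h, add_comm]

variable {l : Sym2 V → Fin 3}

lemma ncard_labelGraph_cases (hcyc : ∀ i, (G \ labelGraph G l i).IsCycles) {v : V}
    (hv : (G.neighborSet v).Nonempty) :
    (∀ i, ((labelGraph G l i).neighborSet v).ncard = 1) ∨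
      ∃ i, ((labelGraph G l i).neighborSet v).ncard = 2 ∧
        ∀ j ≠ i, ((labelGraph G l j).neighborSet v).ncard = 0 := by
  have hsum := ncard_neighborSet_eq_sum_labelGraph (G := G) l v
  have hpos : 0 < (G.neighborSet v).ncard := (Set.ncard_pos (Set.toFinite _)).2 hv
  have hcases i := ncard_neighborSet_labelGraph_add (hcyc i) v
  have h₀ := hcases 0
  have h₁ := hcases 1
  have h₂ := hcases 2
  rw [Fin.sum_univ_three] at hsum
  simp only [Fin.forall_fin_succ, Fin.exists_fin_succ, Fin.isValue, Fin.succ_zero_eq_one,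
    Fin.succ_one_eq_two, IsEmpty.forall_iff, IsEmpty.exists_iff, and_true, or_false, ne_eq,
    not_true_eq_false, true_and, zero_ne_one, one_ne_zero, not_false_eq_true,
    true_implies, Fin.reduceEq]
  omega

/-- Since `V + 1 = E`, counting edge ends leaves exactly two vertices of degree three. -/
lemma exists_branch_points (hcard : G.edgeSet.ncard = Nat.card V + 1)
    (hdeg : ∀ v, (G.neighborSet v).ncard = 2 ∨ (G.neighborSet v).ncard = 3) :
    ∃ p q, p ≠ q ∧ ∀ v, (G.neighborSet v).ncard = 3 ↔ v = p ∨ v = q := by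
  classical
  have := Fintype.ofFinite V
  have hsum := sum_ncard_neighborSet G
  have hdeg' : ∀ v, (G.neighborSet v).ncard =
      2 + if (G.neighborSet v).ncard = 3 then 1 else 0 := fun v => by
    rcases hdeg v with h | h <;> simp [h]
  rw [hcard, Nat.card_eq_fintype_card, Finset.sum_congr rfl fun v _ => hdeg' v,
    Finset.sum_add_distrib, ← Finset.card_filter, Finset.sum_const, Finset.card_univ,
    smul_eq_mul] at hsum
  obtain ⟨p, q, hpq, hpq'⟩ := Finset.card_eq_two.1
    (show {v | (G.neighborSet v).ncard = 3}.toFinset.card = 2 by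
      rw [Set.toFinset_ofPred]; omega)
  exact ⟨p, q, hpq, fun v => by simpa using Finset.ext_iff.1 hpq' v⟩

/-- Three labels, such that the edges outside each of them form a cycle, and cycle rank two: the
graph is a theta graph. -/
lemma exists_isArc_of_theta (hconn : G.Preconnected) (hnon : ∀ v, (G.neighborSet v).Nonempty)
    (hcard : G.edgeSet.ncard = Nat.card V + 1) (hcyc : ∀ i, (G \ labelGraph G l i).IsCycles) :
    ∃ p q, (∀ i, IsArc (labelGraph G l i) p q) ∧
      ∀ v w w', v ≠ p → v ≠ q → G.Adj v w → G.Adj v w' → l s(v, w) = l s(v, w') := by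
  have hcases v := ncard_labelGraph_cases hcyc (hnon v)
  have hbranch₃ : ∀ v, (G.neighborSet v).ncard = 3 →
      ∀ i, ((labelGraph G l i).neighborSet v).ncard = 1 := fun v hv =>
    (hcases v).resolve_right fun ⟨i, hi, hj⟩ => by
      rw [ncard_neighborSet_eq_sum_labelGraph l v,
        Finset.sum_eq_single i (fun j _ => hj j) (by simp), hi] at hv
      omega
  obtain ⟨p, q, hpq, hbranch⟩ := exists_branch_points hcard fun v => by
    rw [ncard_neighborSet_eq_sum_labelGraph l v]
    rcases hcases v with h | ⟨i, hi, hj⟩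
    · simp [h]
    · left
      rw [Finset.sum_eq_single i (fun j _ => hj j) (by simp), hi]
  have hp := hbranch₃ p ((hbranch p).2 (.inl rfl))
  have hq := hbranch₃ q ((hbranch q).2 (.inr rfl))
  have hinner : ∀ v i w, v ≠ p → v ≠ q → (labelGraph G l i).Adj v w →
      ((labelGraph G l i).neighborSet v).ncard = 2 ∧
        ∀ j ≠ i, ((labelGraph G l j).neighborSet v).ncard = 0 := fun v i w hvp hvq hw => by
    have hpos : ((labelGraph G l i).neighborSet v).ncard ≠ 0 :=
      ((Set.ncard_pos (Set.toFinite _)).2 ⟨w, hw⟩).ne'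
    rcases hcases v with h | ⟨j, hj, hj'⟩
    · have h3 : (G.neighborSet v).ncard = 3 := by
        rw [ncard_neighborSet_eq_sum_labelGraph l v]; simp [h]
      exact (((hbranch v).1 h3).elim hvp hvq).elim
    · obtain rfl : i = j := by_contra fun hij => hpos (hj' i hij)
      exact ⟨hj, hj'⟩
  have hlab : ∀ v w w', v ≠ p → v ≠ q → G.Adj v w → G.Adj v w' → l s(v, w) = l s(v, w') :=
    fun v w w' hvp hvq hw hw' => by_contra fun hne =>
      ((Set.ncard_pos (s := (labelGraph G l (l s(v, w))).neighborSet v) (Set.toFinite _)).2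
        ⟨w, hw, rfl⟩).ne' ((hinner v (l s(v, w')) w' hvp hvq ⟨hw', rfl⟩).2 _ hne)
  refine ⟨p, q, fun i => isArc_of_ncard_neighborSet hpq (hp i) (hq i).le
    (fun v hvp hvq ⟨w, hw⟩ => (hinner v i w hvp hvq hw).1) fun v hv => ?_, hlab⟩
  obtain ⟨b, rfl | rfl, hb⟩ := exists_reachable_labelGraph (P := fun v => v = p ∨ v = q)
    (fun v w w' hP => hlab v w w' (fun h => hP (.inl h)) (fun h => hP (.inr h))) (hconn v p)
    (.inl rfl) hv
  exacts [.inl hb.symm, .inr hb.symm]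

end Theta

section Cycle

open SimpleGraph

variable {V : Type*} {G : SimpleGraph V} {p q : V}

lemma isArc_of_forall_edge (hpq : G.Adj p q) (h : ∀ e ∈ G.edgeSet, e = s(p, q)) : IsArc G p q :=
  ⟨hpq.ne, .cons hpq .nil, by simp [hpq.ne], by simpa using h⟩

lemma ncard_neighborSet_deleteEdges (hG : G.IsCycles) (hpq : G.Adj p q) :
    ((G.deleteEdges {s(p, q)}).neighborSet p).ncard = 1 := by
  have h : (G.deleteEdges {s(p, q)}).neighborSet p = G.neighborSet p \ {q} := by
    ext w
    have := hpq.ne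
    simp only [mem_neighborSet, deleteEdges_adj, Set.mem_sdiff, Set.mem_singleton_iff, Sym2.eq_iff]
    tauto
  rw [h, Set.ncard_sdiff_singleton_of_mem ((mem_neighborSet ..).2 hpq), hG ⟨q, hpq⟩]

lemma isArc_deleteEdges_of_isCycles [Finite V] (hG : G.IsCycles) (hconn : G.Connected)
    (hpq : G.Adj p q) : IsArc (G.deleteEdges {s(p, q)}) p q := by
  refine isArc_of_ncard_neighborSet hpq.ne (ncard_neighborSet_deleteEdges hG hpq) ?_
    (fun v hvp hvq ⟨w, hw⟩ => ?_) fun v _ => .inl <| reachable_of_le_reachGraph (H := G)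
      (fun a b hab => ⟨hab.ne, ?_⟩) (hconn p v)
  · rw [Sym2.eq_swap]
    exact (ncard_neighborSet_deleteEdges hG hpq.symm).le
  · have h : (G.deleteEdges {s(p, q)}).neighborSet v = G.neighborSet v := by
      ext w
      simp [deleteEdges_adj, hvp, hvq]
    rw [h, hG ⟨w, h ▸ hw⟩]
  · by_cases h : s(a, b) = s(p, q)
    · rcases Sym2.eq_iff.1 h with ⟨rfl, rfl⟩ | ⟨rfl, rfl⟩
      exacts [hG.reachable_deleteEdges hpq, (hG.reachable_deleteEdges hpq).symm]
    · exact Adj.reachable (deleteEdges_adj.2 ⟨hab, h⟩)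

/-- A cycle is the union of an edge and another arc with the same end points. -/
lemma exists_isHeight_of_isCycles [Finite V] (hG : G.IsCycles) (hconn : G.Connected)
    (hnon : ∀ v, (G.neighborSet v).Nonempty) :
    ∃ (l : Sym2 V → Fin 2) (h : V → ℝ), IsHeight G l h := by
  classical
  obtain ⟨p⟩ := hconn.nonempty
  obtain ⟨q, hpq⟩ : ∃ q, G.Adj p q := hnon p
  let l : Sym2 V → Fin 2 := fun e => if e = s(p, q) then 0 else 1
  have hl₁ : labelGraph G l 1 = G.deleteEdges {s(p, q)} := by
    ext v w
    simp [labelGraph, l]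
  refine ⟨l, exists_isHeight (p := p) (q := q) (Fin.forall_fin_two.2 ⟨?_, ?_⟩) hnon
    fun v w w' hvp hvq _ _ => by simp [l, hvp, hvq]⟩
  · refine isArc_of_forall_edge ⟨hpq, by simp [l]⟩ (Sym2.ind fun v w ⟨_, hvw⟩ => ?_)
    by_contra h
    simp [l, h] at hvw
  · rw [hl₁]
    exact isArc_deleteEdges_of_isCycles hG hconn hpq

lemma eq_of_isCycles_of_le [Finite V] {H : SimpleGraph V} (hG : G.IsCycles) (hH : H.IsCycles)
    (hle : G ≤ H) (hconn : SupportConnected H) (hne : G ≠ ⊥) : G = H := by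
  obtain ⟨a, b, hab⟩ := ne_bot_iff_exists_adj.1 hne
  have hnb : ∀ {v w}, G.Adj v w → ∀ {u}, H.Adj v u → G.Adj v u := fun {v w} hvw {u} hvu => by
    have h : G.neighborSet v = H.neighborSet v :=
      Set.eq_of_subset_of_ncard_le (fun u hu => hle hu)
        (by rw [hG ⟨w, hvw⟩, hH ⟨u, hvu⟩]) (Set.toFinite _)
    exact (Set.ext_iff.1 h u).2 hvu
  have hsupp : ∀ {u v}, H.Walk u v → u ∈ G.support → v ∈ G.support := fun W => by
    induction W with
    | nil => exact id
    | cons huc _ ih => exact fun ⟨w, hw⟩ => ih ⟨_, (hnb hw huc).symm⟩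
  refine le_antisymm hle fun v w hvw => ?_
  obtain ⟨W⟩ := hconn (u := a) ⟨b, hle hab⟩ (v := v) ⟨w, hvw⟩
  obtain ⟨u, hu⟩ := hsupp W ⟨b, hab⟩
  exact hnb hu hvw

end Cycle

section ComplementaryLabels

variable {E F : Type*} {R : E → F → Prop}

/-- If no element of `E` misses two elements of `F` that have different neighbours, and nothing
dominates, then `R` relates everything up to a labelling: all elements missed by the same element
have the same set of neighbours, which is used as a label. -/
lemma exists_labels_of_not_triangular
    (htri : ∀ {e₁ e₂ e₃ f₁ f₂ f₃}, R e₁ f₁ → R e₂ f₂ → R e₃ f₃ → ¬ R e₁ f₂ → ¬ R e₁ f₃ → R e₂ f₃)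
    (hleft : ∀ {e e' f}, R e f → (∀ f, R e f → R e' f) → ∀ f, R e' f → R e f)
    (hright : ∀ {f f' e}, R e f → (∀ e, R e f → R e f') → ∀ e, R e f' → R e f)
    (hnot : ∃ e f e' f', R e f' ∧ R e' f ∧ ¬ R e f) :
    ∃ (a : E → Set E) (b : F → Set E),
      (∀ e f, R e f ↔ (∃ f', R e f') ∧ (∃ e', R e' f) ∧ a e ≠ b f) ∧
      a '' {e | ∃ f, R e f} = b '' {f | ∃ e, R e f} := by
  obtain ⟨e₀, f₀, e₁, f₁, h₀, h₁, h₀₀⟩ := hnot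
  have hmiss : ∀ e, ∃ f, (∃ e', R e' f) ∧ ¬ R e f := fun e => by
    by_contra! h
    exact h₀₀ (hleft h₀ (fun f hf => h f ⟨e₀, hf⟩) f₀ (h f₀ ⟨e₁, h₁⟩))
  have hmiss' : ∀ f, ∃ e, (∃ f', R e f') ∧ ¬ R e f := fun f => by
    by_contra! h
    exact h₀₀ (hright h₁ (fun e he => h e ⟨f₀, he⟩) e₀ (h e₀ ⟨f₁, h₀⟩))
  choose missed hmissed hnotR using hmiss
  have hsub : ∀ {e f f'}, (∃ f, R e f) → ¬ R e f → (∃ e', R e' f') → ¬ R e f' →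
      {e' | R e' f} ⊆ {e' | R e' f'} := fun ⟨_, he⟩ hf ⟨_, hf'⟩ hef' _ h => htri he h hf' hf hef'
  have hlabel : ∀ {e f}, (∃ f, R e f) → (∃ e', R e' f) → ¬ R e f →
      {e' | R e' (missed e)} = {e' | R e' f} := fun he hf h =>
    (hsub he (hnotR _) hf h).antisymm (hsub he h (hmissed _) (hnotR _))
  refine ⟨fun e => {e' | R e' (missed e)}, fun f => {e' | R e' f}, fun e f => ?_, ?_⟩
  · refine ⟨fun h => ⟨⟨f, h⟩, ⟨e, h⟩, fun heq => hnotR e ?_⟩, fun ⟨he, hf, hne⟩ =>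
      by_contra fun h => hne (hlabel he hf h)⟩
    exact (Set.ext_iff.1 heq e).2 h
  · refine Set.Subset.antisymm ?_ ?_
    · rintro _ ⟨e, -, rfl⟩
      exact ⟨missed e, hmissed e, rfl⟩
    · rintro _ ⟨f, hf, rfl⟩
      obtain ⟨e, he, h⟩ := hmiss' f
      exact ⟨e, he, hlabel he hf h⟩

lemma exists_adj_label_ne {V ι : Type*} {G : SimpleGraph V} (hG : G.Preconnected)
    {l : Sym2 V → ι} {e e' : Sym2 V} (he : e ∈ G.edgeSet) (he' : e' ∈ G.edgeSet)
    (hne : l e ≠ l e') : ∃ v w w', G.Adj v w ∧ G.Adj v w' ∧ l s(v, w) ≠ l s(v, w') := by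
  by_contra! h
  have hwalk : ∀ {u v}, G.Walk u v → ∀ {u' v'}, G.Adj u u' → G.Adj v v' →
      l s(u, u') = l s(v, v') := fun W => by
    induction W with
    | nil => exact h _ _ _
    | cons huc _ ih =>
      intro u' v' hu hv
      rw [h _ _ _ hu huc, Sym2.eq_swap]
      exact ih huc.symm hv
  induction e with | h u u' =>
  induction e' with | h v v' =>
  obtain ⟨W⟩ := hG u v
  exact hne (hwalk W he he')

/-- If each label is avoided by none or by exactly two of at most three elements, two of which have
different labels, then there are three elements with different labels and no further labels. -/
lemma exists_range_eq_of_ncard_eq_two {B ι : Type*} {N : Set B} {L : Set ι} {l : B → ι}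
    (hfin : N.Finite) (hN : N.ncard ≤ 3) (hL : ∀ z ∈ N, l z ∈ L)
    (htwo : ∀ i ∈ L, ∀ z ∈ N, i ≠ l z → {z ∈ N | i ≠ l z}.ncard = 2) {w₁ w₂ : B} (hw₁ : w₁ ∈ N)
    (hw₂ : w₂ ∈ N) (hne : l w₁ ≠ l w₂) :
    ∃ z : Fin 3 → B, N = Set.range z ∧ Function.Injective (l ∘ z) ∧ L ⊆ Set.range (l ∘ z) := by
  obtain ⟨w₃, ⟨hw₃, hne₁₃⟩, hw₃₂⟩ := Set.exists_ne_of_one_lt_ncard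
    ((htwo _ (hL w₁ hw₁) w₂ hw₂ hne).symm ▸ one_lt_two) w₂
  have hcard : ({w₁, w₂, w₃} : Set B).ncard = 3 := Set.ncard_eq_three.2
    ⟨w₁, w₂, w₃, ne_of_apply_ne l hne, ne_of_apply_ne l hne₁₃, hw₃₂.symm, rfl⟩
  have hNeq : {w₁, w₂, w₃} = N := Set.eq_of_subset_of_ncard_le
    (by rintro _ (rfl | rfl | rfl) <;> assumption) (hcard ▸ hN) hfin
  have hne₂₃ : l w₂ ≠ l w₃ := fun heq => by
    have hsub : {z ∈ N | l w₂ ≠ l z} ⊆ {w₁} := by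
      rintro z ⟨hz, hz'⟩
      rcases hNeq.symm.subset hz with rfl | rfl | rfl
      exacts [rfl, (hz' rfl).elim, (hz' heq).elim]
    have := Set.ncard_le_ncard hsub
    rw [htwo _ (hL w₂ hw₂) w₁ hw₁ hne.symm, Set.ncard_singleton] at this
    omega
  have hrange : N = Set.range ![w₁, w₂, w₃] := by
    simp only [← hNeq, Matrix.range_cons, Matrix.range_empty, Set.union_empty, Set.singleton_union]
  refine ⟨![w₁, w₂, w₃], hrange, fun i j hij => ?_, fun i hi => ?_⟩
  · fin_cases i <;> fin_cases j <;> simp_all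
  · by_contra h
    have hall : {z ∈ N | i ≠ l z} = N := Set.sep_eq_self_iff_mem_true.2 fun z hz heq => by
      obtain ⟨k, rfl⟩ := hrange.subset hz
      exact h ⟨k, heq.symm⟩
    have := htwo i hi w₁ hw₁ (hall.symm.subset hw₁).2
    rw [hall, ← hNeq, hcard] at this
    omega

end ComplementaryLabels

namespace FacetSystem

variable {A B ι : Type*} {C : FacetSystem A B}

/-- There are no three edges in the first graph that can be removed together. -/
def NoRemovableTriple (C : FacetSystem A B) : Prop :=
  ¬ ∃ R ⊆ C.graph.edgeSet, R.ncard = 3 ∧ C.RemovableFrom C.graph R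

lemma Normal.ncard_neighborSet_le [Finite A] [Finite B] (hC : C.Normal) (hA : C.NoRemovableTriple)
    (y : B) : (C.swap.graph.neighborSet y).ncard ≤ 3 := by
  have heuler := hC.link_euler y
  by_contra! h
  exact hA (hC.exists_removable_of_rank y 3 (by omega))

lemma Normal.ncard_edgeSet_eq [Finite A] [Finite B] (hC : C.Normal) (hA : C.NoRemovableTriple)
    {y : B} (hy : (C.swap.graph.neighborSet y).ncard = 3) (hall : C.graph ≤ C.link y) :
    C.graph.edgeSet.ncard = Nat.card A + 1 := by
  have heuler := hC.link_euler y
  have hsupp : C.graph.support = Set.univ := Set.eq_univ_of_forall hC.left.exists_adj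
  have hrank : ¬ Nat.card A + 3 ≤ C.graph.edgeSet.ncard + 1 := fun h => hA <|
    hC.exists_removable_of_rank y 3 <| by
      rwa [(C.link_le_graph y).antisymm hall, hsupp, Set.ncard_univ]
  rw [(C.link_le_graph y).antisymm hall, hsupp, Set.ncard_univ] at heuler
  omega

/-- An edge of one graph and an edge of the other one are joined if they span a facet. -/
def Joined (C : FacetSystem A B) (e : Sym2 A) (f : Sym2 B) : Prop :=
  ∃ x x' y y', e = s(x, x') ∧ f = s(y, y') ∧ C.Fac x x' y y'

@[simp]
lemma joined_mk {x x' : A} {y y' : B} : C.Joined s(x, x') s(y, y') ↔ C.Fac x x' y y' := by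
  refine ⟨fun ⟨u, u', v, v', hx, hy, h⟩ => ?_, fun h => ⟨x, x', y, y', rfl, rfl, h⟩⟩
  rcases Sym2.eq_iff.1 hx with ⟨rfl, rfl⟩ | ⟨rfl, rfl⟩ <;>
    rcases Sym2.eq_iff.1 hy with ⟨rfl, rfl⟩ | ⟨rfl, rfl⟩
  exacts [h, C.symm_right h, C.symm_left h, C.symm_left (C.symm_right h)]

lemma joined_swap {e : Sym2 A} {f : Sym2 B} : C.swap.Joined f e ↔ C.Joined e f :=
  ⟨fun ⟨y, y', x, x', hf, he, h⟩ => ⟨x, x', y, y', he, hf, h⟩,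
    fun ⟨x, x', y, y', he, hf, h⟩ => ⟨y, y', x, x', hf, he, h⟩⟩

lemma exists_joined_iff {e : Sym2 A} : (∃ f, C.Joined e f) ↔ e ∈ C.graph.edgeSet := by
  induction e with | h x x' =>
  exact ⟨fun ⟨f, h⟩ => by induction f with | h y y' => exact ⟨y, y', joined_mk.1 h⟩,
    fun ⟨y, y', h⟩ => ⟨s(y, y'), joined_mk.2 h⟩⟩

lemma HalfNormal.joined_of_subset [Finite A] (hC : C.HalfNormal) {f f' : Sym2 B} {e : Sym2 A}
    (he : C.Joined e f) (h : ∀ e, C.Joined e f → C.Joined e f') :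
    ∀ e, C.Joined e f' → C.Joined e f := by
  induction f with | h y y' =>
  induction f' with | h z z' =>
  induction e with | h x x' =>
  have heq : C.edgeLink y y' = C.edgeLink z z' :=
    eq_of_isCycles_of_le (hC.edgeLink_isCycles y y') (hC.edgeLink_isCycles z z')
      (fun u u' hu => joined_mk.1 (h _ (joined_mk.2 hu))) (hC.edgeLink_connected z z')
      (SimpleGraph.ne_bot_iff_exists_adj.2 ⟨x, x', joined_mk.1 he⟩)
  intro e' he'
  induction e' with | h u u' =>
  exact joined_mk.2 (show (C.edgeLink y y').Adj u u' from heq ▸ joined_mk.1 he')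

lemma HalfNormal.joined_of_noRemovableTriple [Finite A] (hC : C.HalfNormal)
    (hA : C.NoRemovableTriple) {e₁ e₂ e₃ : Sym2 A} {f₁ f₂ f₃ : Sym2 B} (h₁ : C.Joined e₁ f₁)
    (h₂ : C.Joined e₂ f₂) (h₃ : C.Joined e₃ f₃) (h₁₂ : ¬ C.Joined e₁ f₂) (h₁₃ : ¬ C.Joined e₁ f₃) :
    C.Joined e₂ f₃ := by
  by_contra h₂₃
  induction e₁; induction e₂; induction e₃; induction f₁; induction f₂; induction f₃
  rw [joined_mk] at *
  exact hA (hC.exists_removable_of_triangular h₁ h₂ h₃ h₁₂ h₁₃ h₂₃)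

/-- The facets are the pairs of edges with different labels. -/
structure IsLabelling (C : FacetSystem A B) (a : Sym2 A → ι) (b : Sym2 B → ι) : Prop where
  fac_iff : ∀ {x x' y y'}, C.Fac x x' y y' ↔
    C.graph.Adj x x' ∧ C.swap.graph.Adj y y' ∧ a s(x, x') ≠ b s(y, y')
  image_eq : a '' C.graph.edgeSet = b '' C.swap.graph.edgeSet

lemma IsLabelling.swap {a : Sym2 A → ι} {b : Sym2 B → ι} (h : C.IsLabelling a b) :
    C.swap.IsLabelling b a where
  fac_iff := h.fac_iff.trans ⟨fun ⟨h₁, h₂, h₃⟩ => ⟨h₂, h₁, h₃.symm⟩,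
    fun ⟨h₁, h₂, h₃⟩ => ⟨h₂, h₁, h₃.symm⟩⟩
  image_eq := h.image_eq.symm

lemma Normal.exists_isLabelling [Finite A] [Finite B] (hC : C.Normal) (hA : C.NoRemovableTriple)
    (hall : ¬ ∀ x x' y y', C.graph.Adj x x' → C.swap.graph.Adj y y' → C.Fac x x' y y') :
    ∃ (a : Sym2 A → Set (Sym2 A)) (b : Sym2 B → Set (Sym2 A)), C.IsLabelling a b := by
  push Not at hall
  obtain ⟨x, x', y, y', ⟨z, z', hx⟩, ⟨u, u', hy⟩, hxy⟩ := hall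
  obtain ⟨a, b, hab, himage⟩ := exists_labels_of_not_triangular (R := C.Joined)
    (hC.left.joined_of_noRemovableTriple hA)
    (fun {e e' f} h => by simpa only [joined_swap] using
      hC.right.joined_of_subset (f := e) (f' := e') (e := f) (joined_swap.2 h))
    hC.left.joined_of_subset
    ⟨s(x, x'), s(y, y'), s(u, u'), s(z, z'), joined_mk.2 hx, joined_mk.2 hy,
      fun h => hxy (joined_mk.1 h)⟩
  have hedge : ∀ {f : Sym2 B}, (∃ e, C.Joined e f) ↔ f ∈ C.swap.graph.edgeSet := fun {f} => by
    simp only [← exists_joined_iff, joined_swap]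
  simp only [exists_joined_iff, hedge] at hab himage
  exact ⟨a, b, fun {x x' y y'} => joined_mk.symm.trans (hab _ _), himage⟩

section Branch

variable {a : Sym2 A → ι} {b : Sym2 B → ι}

lemma IsLabelling.ncard_setOf_label_ne (hab : C.IsLabelling a b) (hC : C.Normal) {e : Sym2 A}
    (he : e ∈ C.graph.edgeSet) {y w : B} (hw : C.swap.graph.Adj y w) (hne : a e ≠ b s(y, w)) :
    {z ∈ C.swap.graph.neighborSet y | a e ≠ b s(y, z)}.ncard = 2 := by
  induction e with | h x x' =>
  rw [← hC.ncard_setOf_fac (hab.fac_iff.2 ⟨he, hw, hne⟩)]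
  congr 1
  ext z
  exact ⟨fun h => hab.fac_iff.2 ⟨he, h⟩, fun h => (hab.fac_iff.1 h).2⟩

variable [Finite A] [Finite B]

lemma IsLabelling.exists_branch (hab : C.IsLabelling a b) (hC : C.Normal)
    (hA : C.NoRemovableTriple) :
    ∃ y, ∃ z : Fin 3 → B, C.swap.graph.neighborSet y = Set.range z ∧
      Function.Injective (fun i => b s(y, z i)) ∧
      a '' C.graph.edgeSet ⊆ Set.range fun i => b s(y, z i) := by
  obtain ⟨x⟩ := hC.left.connected.nonempty
  obtain ⟨x', y₀, y₀', h⟩ := hC.left.exists_adj x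
  obtain ⟨hx, hy₀, hne₀⟩ := hab.fac_iff.1 h
  obtain ⟨f, hf, hfx⟩ := hab.image_eq.subset ⟨s(x, x'), hx, rfl⟩
  obtain ⟨y, w₁, w₂, hw₁, hw₂, hne⟩ := exists_adj_label_ne hC.right.connected.preconnected hf hy₀
    (hfx ▸ hne₀)
  refine ⟨y, exists_range_eq_of_ncard_eq_two (l := fun z => b s(y, z)) (Set.toFinite _)
    (hC.ncard_neighborSet_le hA y) (fun z hz => hab.image_eq.symm.subset ⟨s(y, z), hz, rfl⟩) ?_
    hw₁ hw₂ hne⟩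
  rintro _ ⟨e, he, rfl⟩ z hz hez
  exact hab.ncard_setOf_label_ne hC he hz hez

lemma IsLabelling.ncard_edgeSet_eq (hab : C.IsLabelling a b) (hC : C.Normal)
    (hA : C.NoRemovableTriple) : C.graph.edgeSet.ncard = Nat.card A + 1 := by
  obtain ⟨y, z, hz, hinj, -⟩ := hab.exists_branch hC hA
  have hinj' : Function.Injective z := fun i j hij => hinj (congrArg (fun w => b s(y, w)) hij)
  have hadj : ∀ i, C.swap.graph.Adj y (z i) := fun i => hz.symm.subset ⟨i, rfl⟩
  refine hC.ncard_edgeSet_eq hA (y := y) ?_ fun x x' hx => ?_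
  · rw [hz, ← Set.image_univ, Set.ncard_image_of_injective _ hinj', Set.ncard_univ, Nat.card_fin]
  · by_cases h : a s(x, x') = b s(y, z 0)
    · exact ⟨z 1, hab.fac_iff.2 ⟨hx, hadj 1, h ▸ hinj.ne (by decide)⟩⟩
    · exact ⟨z 0, hab.fac_iff.2 ⟨hx, hadj 0, h⟩⟩

lemma IsLabelling.exists_fin (hab : C.IsLabelling a b) (hC : C.Normal)
    (hA : C.NoRemovableTriple) : ∃ (a : Sym2 A → Fin 3) (b : Sym2 B → Fin 3),
      C.IsLabelling a b ∧ a '' C.graph.edgeSet = Set.univ := by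
  obtain ⟨y, z, hz, hinj, hrange⟩ := hab.exists_branch hC hA
  let t : Fin 3 → ι := fun i => b s(y, z i)
  have ht : Function.LeftInverse (Function.invFun t) t := Function.leftInverse_invFun hinj
  have hinjOn : Set.InjOn (Function.invFun t) (Set.range t) := by
    rintro _ ⟨i, rfl⟩ _ ⟨j, rfl⟩ hij
    rw [← ht i, hij, ht j]
  refine ⟨Function.invFun t ∘ a, Function.invFun t ∘ b, ⟨fun {x x' y y'} => ?_, ?_⟩, ?_⟩
  · rw [hab.fac_iff]
    refine and_congr_right fun hx => and_congr_right fun hy => not_congr ?_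
    exact (hinjOn.eq_iff (hrange ⟨_, hx, rfl⟩)
      (hrange (hab.image_eq.symm.subset ⟨s(y, y'), hy, rfl⟩))).symm
  · rw [Set.image_comp, Set.image_comp, hab.image_eq]
  · refine Set.eq_univ_of_forall fun i => ?_
    rw [Set.image_comp, hab.image_eq]
    exact ⟨t i, ⟨s(y, z i), hz.symm.subset ⟨i, rfl⟩, rfl⟩, ht i⟩

lemma IsLabelling.exists_isHeight {a : Sym2 A → Fin 3} {b : Sym2 B → Fin 3}
    (hab : C.IsLabelling a b) (hC : C.Normal) (hA : C.NoRemovableTriple)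
    (hb : b '' C.swap.graph.edgeSet = Set.univ) : ∃ h : A → ℝ, IsHeight C.graph a h := by
  have hcyc : ∀ i, (C.graph \ labelGraph C.graph a i).IsCycles := fun i => by
    obtain ⟨f, hf, rfl⟩ : i ∈ b '' C.swap.graph.edgeSet := hb ▸ Set.mem_univ i
    induction f with | h y y' =>
    convert hC.left.edgeLink_isCycles y y' using 1
    ext x x'
    refine Iff.trans ⟨fun h => ⟨h.1, hf, fun heq => h.2 ⟨h.1, heq⟩⟩,
      fun h => ⟨h.1, fun h' => h.2.2 h'.2⟩⟩ hab.fac_iff.symm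
  obtain ⟨p, q, harc, hlab⟩ := exists_isArc_of_theta hC.left.connected.preconnected
    hC.left.exists_adj (hab.ncard_edgeSet_eq hC hA) hcyc
  exact _root_.exists_isHeight harc hC.left.exists_adj hlab

end Branch

/-- The facets are the pairs of edges whose labels satisfy `J`, and the edges with a given label
form an arc. -/
structure ArcModel (C : FacetSystem A B) (J : ι → ι → Prop) where
  labA : Sym2 A → ι
  labB : Sym2 B → ι
  htA : A → ℝ
  htB : B → ℝ
  isHeightA : IsHeight C.graph labA htA
  isHeightB : IsHeight C.swap.graph labB htB
  fac_iff : ∀ x x' y y', C.Fac x x' y y' ↔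
    C.graph.Adj x x' ∧ C.swap.graph.Adj y y' ∧ J (labA s(x, x')) (labB s(y, y'))

lemma Normal.nonempty_arcModel_of_not_forall [Finite A] [Finite B] (hC : C.Normal)
    (hA : C.NoRemovableTriple) (hB : C.swap.NoRemovableTriple)
    (hall : ¬ ∀ x x' y y', C.graph.Adj x x' → C.swap.graph.Adj y y' → C.Fac x x' y y') :
    Nonempty (C.ArcModel fun i j : Fin 3 => i ≠ j) := by
  obtain ⟨_, _, hab'⟩ := hC.exists_isLabelling hA hall
  obtain ⟨a, b, hab, ha⟩ := hab'.exists_fin hC hA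
  obtain ⟨h, hh⟩ := hab.exists_isHeight hC hA (hab.image_eq ▸ ha)
  obtain ⟨h', hh'⟩ := hab.swap.exists_isHeight hC.swap hB ha
  exact ⟨⟨a, b, h, h', hh, hh', fun _ _ _ _ => hab.fac_iff⟩⟩

lemma Normal.exists_isHeight_of_forall [Finite A] (hC : C.Normal)
    (hall : ∀ x x' y y', C.graph.Adj x x' → C.swap.graph.Adj y y' → C.Fac x x' y y') :
    ∃ (l : Sym2 A → Fin 2) (h : A → ℝ), IsHeight C.graph l h := by
  obtain ⟨x⟩ := hC.left.connected.nonempty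
  obtain ⟨x', y, y', h⟩ := hC.left.exists_adj x
  have heq : C.graph = C.edgeLink y y' := le_antisymm (fun _ _ hu => hall _ _ y y' hu ⟨x, x', h⟩)
    ((C.edgeLink_le_link y y').trans (C.link_le_graph y))
  exact exists_isHeight_of_isCycles (heq ▸ hC.left.edgeLink_isCycles y y') hC.left.connected
    hC.left.exists_adj

lemma Normal.nonempty_arcModel_of_forall [Finite A] [Finite B] (hC : C.Normal)
    (hall : ∀ x x' y y', C.graph.Adj x x' → C.swap.graph.Adj y y' → C.Fac x x' y y') :
    Nonempty (C.ArcModel fun _ _ : Fin 2 => True) := by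
  obtain ⟨a, h, hh⟩ := hC.exists_isHeight_of_forall hall
  obtain ⟨b, h', hh'⟩ :=
    hC.swap.exists_isHeight_of_forall fun y y' x x' hy hx => hall x x' y y' hx hy
  exact ⟨⟨a, b, h, h', hh, hh', fun x x' y y' =>
    ⟨fun h => ⟨⟨y, y', h⟩, ⟨x, x', h⟩, trivial⟩, fun h => hall x x' y y' h.1 h.2.1⟩⟩⟩

end FacetSystem

/-! ### Radial homeomorphisms onto the sphere -/

section Fan

/-- Every vector has an expression `s • U i + t • U' j` with `J i j` and nonnegative coefficients,
which is unique up to the indices of zero coefficients. -/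
structure IsFan {ι E : Type*} [AddCommGroup E] [Module ℝ E] (J : ι → ι → Prop) (U U' : ι → E) :
    Prop where
  exists_eq : ∀ w, ∃ i j, ∃ s t : ℝ, J i j ∧ 0 ≤ s ∧ 0 ≤ t ∧ w = s • U i + t • U' j
  unique : ∀ {i j i' j'} {s t s' t' : ℝ}, J i j → J i' j' → 0 ≤ s → 0 ≤ t → 0 ≤ s' → 0 ≤ t' →
    s • U i + t • U' j = s' • U i' + t' • U' j' →
    s = s' ∧ t = t' ∧ (0 < s → i = i') ∧ (0 < t → j = j')

lemma isFan_quadrants :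
    IsFan (fun _ _ : Fin 2 => True) ![((1, 0) : ℝ × ℝ), (-1, 0)] ![(0, 1), (0, -1)] where
  exists_eq := by
    rintro ⟨a, b⟩
    rcases le_total 0 a with ha | ha <;> rcases le_total 0 b with hb | hb
    · exact ⟨0, 0, a, b, trivial, ha, hb, by simp⟩
    · exact ⟨0, 1, a, -b, trivial, ha, by linarith, by simp⟩
    · exact ⟨1, 0, -a, b, trivial, by linarith, hb, by simp⟩
    · exact ⟨1, 1, -a, -b, trivial, by linarith, by linarith, by simp⟩
  unique := by
    intro i j i' j' s t s' t' _ _ hs ht hs' ht' h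
    fin_cases i <;> fin_cases j <;> fin_cases i' <;> fin_cases j' <;> simp at h ⊢ <;> grind

lemma isFan_hexagon : IsFan (fun i j : Fin 3 => i ≠ j) ![((1, 0) : ℝ × ℝ), (0, 1), (-1, -1)]
    ![(-1, 0), (0, -1), (1, 1)] where
  exists_eq := by
    rintro ⟨a, b⟩
    rcases le_total 0 a with ha | ha <;> rcases le_total 0 b with hb | hb
    · rcases le_total a b with hab | hab
      · exact ⟨1, 2, b - a, a, by decide, by linarith, ha, by simp⟩
      · exact ⟨0, 2, a - b, b, by decide, by linarith, hb, by simp⟩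
    · exact ⟨0, 1, a, -b, by decide, ha, by linarith, by simp⟩
    · exact ⟨1, 0, b, -a, by decide, hb, by linarith, by simp⟩
    · rcases le_total a b with hab | hab
      · exact ⟨2, 0, -b, b - a, by decide, by linarith, by linarith, by simp⟩
      · exact ⟨2, 1, -a, a - b, by decide, by linarith, by linarith, by simp⟩
  unique := by
    intro i j i' j' s t s' t' hij hij' hs ht hs' ht' h
    fin_cases i <;> fin_cases j <;> fin_cases i' <;> fin_cases j' <;> simp at h hij hij' ⊢ <;> grind

end Fan

section EdgeWeight

open Matrix

variable {V ι E : Type*} {G : SimpleGraph V} {l : Sym2 V → ι} {h : V → ℝ} {x x' z z' : V}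
  {c d : V → ℝ}

/-- A point of the cone over the geometric realization of `G`, on the cone over an edge. -/
structure IsEdgeWeight (G : SimpleGraph V) (x x' : V) (c : V → ℝ) : Prop where
  adj : G.Adj x x'
  nonneg : ∀ v, 0 ≤ c v
  eq_or_eq : ∀ v, c v ≠ 0 → v = x ∨ v = x'

namespace IsEdgeWeight

lemma symm (hc : IsEdgeWeight G x x' c) : IsEdgeWeight G x' x c :=
  ⟨hc.adj.symm, hc.nonneg, fun v hv => (hc.eq_or_eq v hv).symm⟩

lemma smul {r : ℝ} (hr : 0 ≤ r) (hc : IsEdgeWeight G x x' c) : IsEdgeWeight G x x' (r • c) :=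
  ⟨hc.adj, fun v => mul_nonneg hr (hc.nonneg v),
    fun v hv => hc.eq_or_eq v (right_ne_zero_of_mul hv)⟩

variable [Fintype V]

lemma sum_eq {M : Type*} [AddCommMonoid M] (hc : IsEdgeWeight G x x' c) {F : V → M}
    (hF : ∀ v, c v = 0 → F v = 0) : ∑ v, F v = F x + F x' :=
  Fintype.sum_eq_add x x' hc.adj.ne fun v ⟨hv, hv'⟩ => hF v <| by_contra fun h =>
    (hc.eq_or_eq v h).elim hv hv'

lemma sum (hc : IsEdgeWeight G x x' c) : ∑ v, c v = c x + c x' := hc.sum_eq fun _ => id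

lemma dotProduct (hc : IsEdgeWeight G x x' c) (f : V → ℝ) : c ⬝ᵥ f = c x * f x + c x' * f x' :=
  hc.sum_eq fun v hv => by rw [hv, zero_mul]

lemma eq_single [DecidableEq V] (hc : IsEdgeWeight G x x' c) (h : c x' = 0) :
    c = Pi.single x (∑ v, c v) := by
  ext v
  by_cases hv : v = x
  · rw [hv, Pi.single_eq_same, hc.sum, h, add_zero]
  · rw [Pi.single_eq_of_ne hv]
    by_contra hcv
    exact (hc.eq_or_eq v hcv).elim hv fun hvx => hcv (hvx ▸ h)

end IsEdgeWeight

variable [Fintype V]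

lemma IsHeight.abs_dotProduct_le (hh : IsHeight G l h) (hc : ∀ v, 0 ≤ c v) :
    |c ⬝ᵥ h| ≤ ∑ v, c v :=
  (Finset.abs_sum_le_sum_abs _ _).trans <| Finset.sum_le_sum fun v _ => by
    rw [abs_mul, abs_of_nonneg (hc v)]
    exact mul_le_of_le_one_right (hc v) (hh.abs_le v)

lemma IsHeight.eq_single_of_abs_dotProduct [DecidableEq V] (hh : IsHeight G l h)
    (hc : IsEdgeWeight G x x' c) (hpos : 0 < ∑ v, c v) (heq : |c ⬝ᵥ h| = ∑ v, c v) :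
    ∃ v, |h v| = 1 ∧ c = Pi.single v (∑ v, c v) := by
  have hsingle : ∃ v, c = Pi.single v (∑ v, c v) := by
    by_cases hx' : c x' = 0
    · exact ⟨x, hc.eq_single hx'⟩
    by_cases hx : c x = 0
    · exact ⟨x', hc.symm.eq_single hx⟩
    have hpos : 0 < c x := (hc.nonneg x).lt_of_ne' hx
    have hpos' : 0 < c x' := (hc.nonneg x').lt_of_ne' hx'
    rw [hc.sum, hc.dotProduct] at heq
    have hle := _root_.abs_le.1 (hh.abs_le x)
    have hle' := _root_.abs_le.1 (hh.abs_le x')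
    have hhx : h x = h x' ∧ |h x| = 1 := by
      rcases abs_cases (c x * h x + c x' * h x') with ⟨h', -⟩ | ⟨h', -⟩
      · have : h x = 1 := by nlinarith
        have : h x' = 1 := by nlinarith
        simp [*]
      · have : h x = -1 := by nlinarith
        have : h x' = -1 := by nlinarith
        simp [*]
    exact (hc.adj.ne (hh.eq_of_abs x x' hhx.2 hhx.1)).elim
  obtain ⟨v, hv⟩ := hsingle
  refine ⟨v, ?_, hv⟩
  rw [hv, single_dotProduct, ← hv, abs_mul, abs_of_pos hpos] at heq
  exact mul_left_cancel₀ hpos.ne' (heq.trans (mul_one _).symm)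

/-- The label of a point is determined by the height unless the point is an endpoint of all arcs. -/
lemma IsHeight.eq_of_dotProduct_eq (hh : IsHeight G l h) (hc : IsEdgeWeight G x x' c)
    (hd : IsEdgeWeight G z z' d) (hsum : ∑ v, c v = ∑ v, d v) (hdot : c ⬝ᵥ h = d ⬝ᵥ h)
    (hl : 0 < ∑ v, c v - |c ⬝ᵥ h| → l s(x, x') = l s(z, z')) : c = d := by
  classical
  rcases (hh.abs_dotProduct_le hc.nonneg).eq_or_lt with heq | hlt
  · rcases (Finset.sum_nonneg fun v _ => hc.nonneg v).eq_or_lt with hzero | hpos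
    · ext v
      rw [(Finset.sum_eq_zero_iff_of_nonneg fun v _ => hc.nonneg v).1 hzero.symm v
        (Finset.mem_univ v), (Finset.sum_eq_zero_iff_of_nonneg fun v _ => hd.nonneg v).1
        (hsum ▸ hzero.symm) v (Finset.mem_univ v)]
    · obtain ⟨v, hv, hcv⟩ := hh.eq_single_of_abs_dotProduct hc hpos heq
      obtain ⟨w, -, hdw⟩ := hh.eq_single_of_abs_dotProduct hd (hsum ▸ hpos) (hdot ▸ hsum ▸ heq)
      rw [← hsum] at hdw
      rw [hcv, hdw, single_dotProduct, single_dotProduct] at hdot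
      rw [hdw, ← hh.eq_of_abs v w hv (mul_left_cancel₀ hpos.ne' hdot), ← hcv]
  · refine dotProduct_eq c d fun f => ?_
    rw [hc.dotProduct, hd.dotProduct]
    rw [hc.dotProduct, hd.dotProduct] at hdot
    rw [hc.sum, hd.sum] at hsum
    exact hh.inj _ _ _ _ _ _ _ _ hc.adj hd.adj (hl (sub_pos.2 hlt)) (hc.nonneg x) (hc.nonneg x')
      (hd.nonneg z) (hd.nonneg z') hsum hdot f

lemma IsHeight.exists_isEdgeWeight (hh : IsHeight G l h) (i : ι) {r s : ℝ} (hr : 0 ≤ r) :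
    ∃ x x' c, IsEdgeWeight G x x' c ∧ l s(x, x') = i ∧ ∑ v, c v = r + |s| ∧ c ⬝ᵥ h = s := by
  classical
  have hm : 0 ≤ r + |s| := add_nonneg hr (abs_nonneg s)
  have hs : |s| ≤ r + |s| := le_add_of_nonneg_left hr
  obtain ⟨x, x', q, hx, hi, hq₀, hq₁, hq⟩ := hh.surj i (s / (r + |s|))
    (by rw [abs_div, abs_of_nonneg hm]; exact div_le_one_of_le₀ hs hm)
  have hs₀ : r + |s| = 0 → s = 0 := fun h => abs_nonpos_iff.1 (hs.trans h.le)
  refine ⟨x, x', Pi.single x ((r + |s|) * (1 - q)) + Pi.single x' ((r + |s|) * q),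
    ⟨hx, fun v => add_nonneg ?_ ?_, fun v hv => ?_⟩, hi, ?_, ?_⟩
  · exact (Pi.single_nonneg (α := fun _ => ℝ)).2 (mul_nonneg hm (sub_nonneg.2 hq₁)) v
  · exact (Pi.single_nonneg (α := fun _ => ℝ)).2 (mul_nonneg hm hq₀) v
  · by_contra! hne
    simp [hne.1, hne.2] at hv
  · simp only [Pi.add_apply, Finset.sum_add_distrib, Finset.sum_pi_single', Finset.mem_univ,
      if_true]
    ring
  · rw [add_dotProduct, single_dotProduct, single_dotProduct, mul_assoc, mul_assoc, ← mul_add,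
      ← hq, mul_div_cancel_of_imp' hs₀]

variable [NormedAddCommGroup E] [NormedSpace ℝ E]

open Classical in
/-- A continuous map that sends a point `c` of the cone over an edge with label `i` to
`(∑ v, c v - |c ⬝ᵥ h|) • U i`, see `IsHeight.arcMap_eq`. The vertex `nb v` is any neighbor of `v`.
-/
noncomputable def arcMap (G : SimpleGraph V) (l : Sym2 V → ι) (h : V → ℝ) (U : ι → E)
    (nb : V → V) (c : V → ℝ) : E :=
  ∑ v, ((1 - |h v|) * c v) • U (l s(v, nb v)) +
    (1 / 2 : ℝ) • ∑ v, ∑ w, if G.Adj v w then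
      (|h v| * c v + |h w| * c w - |c v * h v + c w * h w|) • U (l s(v, w)) else 0

lemma continuous_arcMap (U : ι → E) (nb : V → V) : Continuous (arcMap G l h U nb) := by
  unfold arcMap
  refine .add (by fun_prop) (.const_smul (continuous_finsetSum _ fun v _ =>
    continuous_finsetSum _ fun w _ => ?_) _)
  split_ifs <;> fun_prop

lemma IsHeight.arcMap_eq (hh : IsHeight G l h) (U : ι → E) {nb : V → V}
    (hnb : ∀ v, G.Adj v (nb v)) (hc : IsEdgeWeight G x x' c) :
    arcMap G l h U nb c = (∑ v, c v - |c ⬝ᵥ h|) • U (l s(x, x')) := by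
  have hlabel {v w} (hvw : G.Adj v w) :
      ((1 - |h v|) * c v) • U (l s(v, nb v)) = ((1 - |h v|) * c v) • U (l s(v, w)) := by
    by_cases hl : l s(v, nb v) = l s(v, w)
    · rw [hl]
    · rw [hh.abs_eq v _ _ (hnb v) hvw hl, sub_self, zero_mul, zero_smul, zero_smul]
  have hzero {v w} (hw : c w = 0) : |h v| * c v + |h w| * c w - |c v * h v + c w * h w| = 0 := by
    rw [hw, mul_zero, zero_mul, add_zero, add_zero, abs_mul, abs_of_nonneg (hc.nonneg v), mul_comm,
      sub_self]
  have hzero' {v w} (hv : c v = 0) : |h v| * c v + |h w| * c w - |c v * h v + c w * h w| = 0 := by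
    rw [add_comm, add_comm (c v * h v), hzero hv]
  rw [arcMap, hc.sum_eq fun v hv => by rw [hv, mul_zero, zero_smul],
    hc.sum_eq fun v hv => Finset.sum_eq_zero fun w _ => by rw [hzero' hv, zero_smul, ite_self],
    hc.sum_eq fun w hw => by rw [hzero hw, zero_smul, ite_self],
    hc.sum_eq fun w hw => by rw [hzero hw, zero_smul, ite_self], hlabel hc.adj, hlabel hc.adj.symm,
    if_neg (G.irrefl), if_neg (G.irrefl), if_pos hc.adj, if_pos hc.adj.symm, Sym2.eq_swap (a := x'),
    hc.sum, hc.dotProduct, add_comm (c x' * h x')]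
  module

end EdgeWeight

section Radial

variable {X F : Type*} [TopologicalSpace X] [CompactSpace X] [NormedAddCommGroup F]
  [NormedSpace ℝ F]

/-- The radial projection of a map that is bijective onto a star-shaped hypersurface. -/
lemma nonempty_homeomorph_sphere_of_radial {Φ : X → F} (hΦ : Continuous Φ)
    (hinj : ∀ x y, ∀ t : ℝ, 0 ≤ t → Φ x = t • Φ y → t = 1 ∧ x = y)
    (hsurj : ∀ w ≠ 0, ∃ x, ∃ t : ℝ, 0 < t ∧ Φ x = t • w) :
    Nonempty (X ≃ₜ Metric.sphere (0 : F) 1) := by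
  have hne (x) : Φ x ≠ 0 := fun h => zero_ne_one (hinj x x 0 le_rfl (by rw [h, smul_zero])).1
  let f : X → Metric.sphere (0 : F) 1 := fun x => ⟨‖Φ x‖⁻¹ • Φ x, by
    rw [mem_sphere_zero_iff_norm, norm_smul, norm_inv, norm_norm,
      inv_mul_cancel₀ (norm_ne_zero_iff.2 (hne x))]⟩
  have hf : Continuous f :=
    ((hΦ.norm.inv₀ fun x => norm_ne_zero_iff.2 (hne x)).smul hΦ).subtype_mk _
  refine ⟨hf.homeoOfEquivCompactToT2 (f := .ofBijective f ⟨fun x y hxy => ?_, fun w => ?_⟩)⟩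
  · have hx : Φ x = (‖Φ x‖ * ‖Φ y‖⁻¹) • Φ y := by
      have hval : ‖Φ x‖⁻¹ • Φ x = ‖Φ y‖⁻¹ • Φ y := congrArg Subtype.val hxy
      rw [mul_smul, ← hval, smul_inv_smul₀ (norm_ne_zero_iff.2 (hne x))]
    exact (hinj x y _ (by positivity) hx).2
  · have hw : ‖(w : F)‖ = 1 := mem_sphere_zero_iff_norm.1 w.2
    obtain ⟨x, t, ht, hx⟩ := hsurj w (norm_ne_zero_iff.1 (hw.trans_ne one_ne_zero))
    refine ⟨x, Subtype.ext ?_⟩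
    change ‖Φ x‖⁻¹ • Φ x = w
    rw [hx, norm_smul, hw, mul_one, Real.norm_of_nonneg ht.le, inv_smul_smul₀ ht.ne']

end Radial

namespace FacetSystem

open Matrix

variable {A B ι E F : Type*} [Fintype A] [Fintype B] {C : FacetSystem A B} {J : ι → ι → Prop}

lemma mem_realization_simplices [DecidableEq A] [DecidableEq B] {b : A ⊕ B → ℝ} :
    b ∈ Realization C.simplices ↔ ∃ x x' y y', C.Fac x x' y y' ∧
      IsEdgeWeight C.graph x x' (b ∘ .inl) ∧ IsEdgeWeight C.swap.graph y y' (b ∘ .inr) ∧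
      ∑ v, (b ∘ .inl) v + ∑ v, (b ∘ .inr) v = 1 := by
  rw [mem_realization]
  constructor
  · rintro ⟨_, ⟨x, x', y, y', hf, rfl⟩, hnonneg, hsum, hsupp⟩
    refine ⟨x, x', y, y', hf, ⟨⟨y, y', hf⟩, fun v => hnonneg _, fun v hv => ?_⟩,
      ⟨⟨x, x', hf⟩, fun v => hnonneg _, fun v hv => ?_⟩, (Fintype.sum_sum_type b).symm.trans hsum⟩
    · simpa using hsupp _ hv
    · simpa using hsupp _ hv
  · rintro ⟨x, x', y, y', hf, hA, hB, hsum⟩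
    refine ⟨_, ⟨x, x', y, y', hf, rfl⟩, ?_, (Fintype.sum_sum_type b).trans hsum, ?_⟩
    · rintro (v | v)
      exacts [hA.nonneg v, hB.nonneg v]
    · rintro (v | v) hv
      · simpa using hA.eq_or_eq v hv
      · simpa using hB.eq_or_eq v hv

variable [NormedAddCommGroup E] [NormedSpace ℝ E]

namespace ArcModel

/-- The map of the cone over the realization of the system to `E × ℝ × ℝ` that is given by the arc
maps and the heights of both sides. -/
noncomputable def coneMap (m : C.ArcModel J) (U U' : ι → E) (na : A → A) (nb : B → B)
    (b : A ⊕ B → ℝ) : E × ℝ × ℝ :=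
  (arcMap C.graph m.labA m.htA U na (b ∘ .inl) + arcMap C.swap.graph m.labB m.htB U' nb (b ∘ .inr),
    (b ∘ .inl) ⬝ᵥ m.htA, (b ∘ .inr) ⬝ᵥ m.htB)

variable {m : C.ArcModel J} {U U' : ι → E} {na : A → A} {nb : B → B}

lemma continuous_coneMap : Continuous (m.coneMap U U' na nb) := by
  have hl : Continuous fun b : A ⊕ B → ℝ => b ∘ Sum.inl := by fun_prop
  have hr : Continuous fun b : A ⊕ B → ℝ => b ∘ Sum.inr := by fun_prop
  exact (((continuous_arcMap U na).comp hl).add ((continuous_arcMap U' nb).comp hr)).prodMk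
    ((hl.dotProduct continuous_const).prodMk (hr.dotProduct continuous_const))

lemma coneMap_eq (hna : ∀ v, C.graph.Adj v (na v)) (hnb : ∀ v, C.swap.graph.Adj v (nb v))
    {b : A ⊕ B → ℝ} {x x' : A} {y y' : B} (hA : IsEdgeWeight C.graph x x' (b ∘ .inl))
    (hB : IsEdgeWeight C.swap.graph y y' (b ∘ .inr)) :
    m.coneMap U U' na nb b = ((∑ v, (b ∘ .inl) v - |(b ∘ .inl) ⬝ᵥ m.htA|) • U (m.labA s(x, x')) +
      (∑ v, (b ∘ .inr) v - |(b ∘ .inr) ⬝ᵥ m.htB|) • U' (m.labB s(y, y')),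
      (b ∘ .inl) ⬝ᵥ m.htA, (b ∘ .inr) ⬝ᵥ m.htB) := by
  rw [coneMap, m.isHeightA.arcMap_eq U hna hA, m.isHeightB.arcMap_eq U' hnb hB]

variable [DecidableEq A] [DecidableEq B]

lemma eq_of_coneMap_eq_smul (hU : IsFan J U U') (hna : ∀ v, C.graph.Adj v (na v))
    (hnb : ∀ v, C.swap.graph.Adj v (nb v)) {b c : A ⊕ B → ℝ} (hb : b ∈ Realization C.simplices)
    (hc : c ∈ Realization C.simplices) {t : ℝ} (ht : 0 ≤ t)
    (h : m.coneMap U U' na nb b = t • m.coneMap U U' na nb c) : t = 1 ∧ b = c := by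
  obtain ⟨x, x', y, y', hf, hbA, hbB, hb₁⟩ := mem_realization_simplices.1 hb
  obtain ⟨z, z', u, u', hg, hcA, hcB, hc₁⟩ := mem_realization_simplices.1 hc
  rw [coneMap_eq hna hnb hbA hbB, coneMap_eq hna hnb hcA hcB] at h
  obtain ⟨hvec, hdotA, hdotB⟩ : _ ∧ _ ∧ _ := by simpa only [Prod.ext_iff] using h
  simp only [Prod.smul_fst, Prod.smul_snd, smul_eq_mul, smul_add, smul_smul] at hvec hdotA hdotB
  obtain ⟨hslackA, hslackB, hlabA, hlabB⟩ := hU.unique ((m.fac_iff ..).1 hf).2.2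
    ((m.fac_iff ..).1 hg).2.2 (sub_nonneg.2 (m.isHeightA.abs_dotProduct_le hbA.nonneg))
    (sub_nonneg.2 (m.isHeightB.abs_dotProduct_le hbB.nonneg))
    (mul_nonneg ht (sub_nonneg.2 (m.isHeightA.abs_dotProduct_le hcA.nonneg)))
    (mul_nonneg ht (sub_nonneg.2 (m.isHeightB.abs_dotProduct_le hcB.nonneg))) hvec
  have hsumA : ∑ v, (b ∘ .inl) v = t * ∑ v, (c ∘ .inl) v := by
    rw [hdotA, abs_mul, abs_of_nonneg ht] at hslackA
    linarith
  have hsumB : ∑ v, (b ∘ .inr) v = t * ∑ v, (c ∘ .inr) v := by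
    rw [hdotB, abs_mul, abs_of_nonneg ht] at hslackB
    linarith
  obtain rfl : t = 1 := by rw [hsumA, hsumB, ← mul_add, hc₁, mul_one] at hb₁; exact hb₁
  rw [one_mul] at hsumA hsumB hdotA hdotB
  refine ⟨rfl, funext (Sum.rec (congrFun ?_) (congrFun ?_))⟩
  · exact m.isHeightA.eq_of_dotProduct_eq hbA hcA hsumA hdotA hlabA
  · exact m.isHeightB.eq_of_dotProduct_eq hbB hcB hsumB hdotB hlabB

lemma exists_coneMap_eq_smul (hU : IsFan J U U') (hna : ∀ v, C.graph.Adj v (na v))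
    (hnb : ∀ v, C.swap.graph.Adj v (nb v)) {w : E × ℝ × ℝ} (hw : w ≠ 0) :
    ∃ b ∈ Realization C.simplices, ∃ t : ℝ, 0 < t ∧ m.coneMap U U' na nb b = t • w := by
  obtain ⟨w, p, q⟩ := w
  obtain ⟨i, j, r, s, hij, hr, hs, rfl⟩ := hU.exists_eq w
  obtain ⟨x, x', c, hc, hi, hcsum, hcdot⟩ := m.isHeightA.exists_isEdgeWeight i (s := p) hr
  obtain ⟨y, y', d, hd, hj, hdsum, hddot⟩ := m.isHeightB.exists_isEdgeWeight j (s := q) hs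
  have hT : 0 < r + |p| + (s + |q|) := by
    refine (by positivity : 0 ≤ r + |p| + (s + |q|)).lt_of_ne fun hT => hw ?_
    have hp := abs_nonneg p
    have hq := abs_nonneg q
    simp [show r = 0 by linarith, show s = 0 by linarith, abs_eq_zero.1 (by linarith : |p| = 0),
      abs_eq_zero.1 (by linarith : |q| = 0)]
  generalize hTdef : r + |p| + (s + |q|) = T at hT
  have hcT := hc.smul (inv_pos.2 hT).le
  have hdT := hd.smul (inv_pos.2 hT).le
  refine ⟨Sum.elim (T⁻¹ • c) (T⁻¹ • d), mem_realization_simplices.2 ⟨x, x', y, y',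
    (m.fac_iff ..).2 ⟨hc.adj, hd.adj, by rwa [hi, hj]⟩, hcT, hdT, ?_⟩, T⁻¹, inv_pos.2 hT, ?_⟩
  · simp only [Sum.elim_comp_inl, Sum.elim_comp_inr, Pi.smul_apply, smul_eq_mul,
      ← Finset.mul_sum]
    rw [hcsum, hdsum, ← mul_add, hTdef, inv_mul_cancel₀ hT.ne']
  · rw [coneMap_eq hna hnb hcT hdT, hi, hj]
    simp only [Sum.elim_comp_inl, Sum.elim_comp_inr, Pi.smul_apply, ← Finset.mul_sum,
      smul_dotProduct, hcsum, hdsum, hcdot, hddot, smul_eq_mul, abs_mul,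
      abs_of_pos (inv_pos.2 hT), ← mul_sub, add_sub_cancel_right, Prod.smul_mk, smul_add, smul_smul]

theorem nonempty_homeomorph_sphere [NormedAddCommGroup F] [NormedSpace ℝ F] (m : C.ArcModel J)
    (hC : C.Normal) (hU : IsFan J U U') (L : (E × ℝ × ℝ) ≃L[ℝ] F) :
    Nonempty (Realization C.simplices ≃ₜ Metric.sphere (0 : F) 1) := by
  choose na hna using hC.left.exists_adj
  choose nb hnb using hC.right.exists_adj
  have : CompactSpace (Realization C.simplices) :=
    isCompact_iff_compactSpace.1 (isCompact_realization _)
  refine nonempty_homeomorph_sphere_of_radial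
    (Φ := fun b : Realization C.simplices => L (m.coneMap U U' na nb b))
    (L.continuous.comp (continuous_coneMap.comp continuous_subtype_val)) (fun b c t ht h => ?_)
    fun w hw => ?_
  · obtain ⟨ht₁, hbc⟩ := m.eq_of_coneMap_eq_smul hU hna hnb b.2 c.2 ht
      (L.injective (h.trans (map_smul L t _).symm))
    exact ⟨ht₁, Subtype.ext hbc⟩
  · obtain ⟨b, hb, t, ht, hbt⟩ := m.exists_coneMap_eq_smul hU hna hnb
      ((map_ne_zero_iff L.symm L.symm.injective).2 hw)
    exact ⟨⟨b, hb⟩, t, ht, (congrArg L hbt).trans <| (map_smul L t _).trans <|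
      congrArg _ (L.apply_symm_apply w)⟩

end ArcModel

theorem Normal.nonempty_homeomorph_sphere [DecidableEq A] [DecidableEq B] (hC : C.Normal)
    (hA : C.NoRemovableTriple) (hB : C.swap.NoRemovableTriple) :
    Nonempty (Realization C.simplices ≃ₜ Metric.sphere (0 : EuclideanSpace ℝ (Fin 4)) 1) := by
  have L : ((ℝ × ℝ) × ℝ × ℝ) ≃L[ℝ] EuclideanSpace ℝ (Fin 4) :=
    ContinuousLinearEquiv.ofFinrankEq (by simp)
  by_cases hall : ∀ x x' y y', C.graph.Adj x x' → C.swap.graph.Adj y y' → C.Fac x x' y y'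
  · obtain ⟨m⟩ := hC.nonempty_arcModel_of_forall hall
    exact m.nonempty_homeomorph_sphere hC isFan_quadrants L
  · obtain ⟨m⟩ := hC.nonempty_arcModel_of_not_forall hA hB hall
    exact m.nonempty_homeomorph_sphere hC isFan_hexagon L

end FacetSystem

/-! ### Balanced pseudomanifolds of dimension three -/

/-- The facets of a balanced pseudomanifold of dimension three, `vtx σ c` being the vertex of the
facet `σ` of colour `c`. Faces do not occur: the facets around the face of `σ` with the colours `S`
are those whose vertices agree with those of `σ` on `S`. -/
structure ColoredFacets (F V : Type*) where
  vtx : F → Fin 4 → V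
  color_eq : ∀ {σ τ c d}, vtx σ c = vtx τ d → c = d
  injective : Function.Injective vtx
  exists_neighbor : ∀ σ c, ∃ τ ≠ σ, ∀ ρ, Set.EqOn (vtx ρ) (vtx σ) {c}ᶜ ↔ ρ = σ ∨ ρ = τ
  exists_chain : ∀ (S : Set (Fin 4)) (σ τ : F), Set.EqOn (vtx τ) (vtx σ) S →
    Relation.ReflTransGen (fun ρ ρ' => Set.EqOn (vtx ρ) (vtx σ) S ∧ Set.EqOn (vtx ρ') (vtx σ) S ∧
      ∃ c, Set.EqOn (vtx ρ) (vtx ρ') {c}ᶜ) σ τ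
  nonempty : Nonempty F

/-- A partition of the four colours into the pairs `{a false, a true}` and `{b false, b true}`. -/
structure IsColorSplit (a b : Bool → Fin 4) : Prop where
  injective_left : Function.Injective a
  injective_right : Function.Injective b
  ne : ∀ i j, a i ≠ b j
  cover : ∀ c, (∃ i, a i = c) ∨ ∃ j, b j = c

lemma IsColorSplit.swap {a b : Bool → Fin 4} (h : IsColorSplit a b) : IsColorSplit b a :=
  ⟨h.injective_right, h.injective_left, fun i j => (h.ne j i).symm, fun c => (h.cover c).symm⟩

/-- The colours in the positions `0` and `2` of the cyclic order `ε`. -/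
def evenColors (ε : Equiv.Perm (Fin 4)) (k : Bool) : Fin 4 := ε (cond k 2 0)

/-- The colours in the positions `1` and `3` of the cyclic order `ε`. -/
def oddColors (ε : Equiv.Perm (Fin 4)) (k : Bool) : Fin 4 := ε (cond k 3 1)

lemma isColorSplit_of_perm (ε : Equiv.Perm (Fin 4)) :
    IsColorSplit (evenColors ε) (oddColors ε) where
  injective_left := ε.injective.comp (by decide)
  injective_right := ε.injective.comp (by decide)
  ne i j := ε.injective.ne (by revert i j; decide)
  cover c := by
    obtain ⟨d, rfl⟩ := ε.surjective c
    simp only [evenColors, oddColors, ε.injective.eq_iff]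
    revert d
    decide

namespace ColoredFacets

variable {F V : Type*} (X : ColoredFacets F V) {a b : Bool → Fin 4}

/-- The vertices whose colour is one of the pair `a`. -/
def Side (a : Bool → Fin 4) : Type _ := {v : V // ∃ σ i, X.vtx σ (a i) = v}

/-- The vertex of the facet `σ` of colour `a i`. -/
def side (a : Bool → Fin 4) (σ : F) (i : Bool) : X.Side a := ⟨X.vtx σ (a i), σ, i, rfl⟩

variable {X}

lemma exists_eq_side (x : X.Side a) : ∃ σ i, x = X.side a σ i := by
  obtain ⟨v, σ, i, h⟩ := x
  exact ⟨σ, i, Subtype.ext h.symm⟩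

instance [Finite F] (a : Bool → Fin 4) : Finite (X.Side a) :=
  .of_surjective (fun t : F × Bool => X.side a t.1 t.2) fun x =>
    let ⟨σ, i, hx⟩ := exists_eq_side x
    ⟨(σ, i), hx.symm⟩

lemma side_congr {σ τ : F} {i : Bool} (h : X.vtx σ (a i) = X.vtx τ (a i)) :
    X.side a σ i = X.side a τ i :=
  Subtype.ext h

lemma side_eq_iff (ha : Function.Injective a) {σ τ : F} {i j : Bool} :
    X.side a σ i = X.side a τ j ↔ i = j ∧ X.vtx σ (a i) = X.vtx τ (a i) := by
  constructor
  · intro h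
    have hv : X.vtx σ (a i) = X.vtx τ (a j) := congrArg Subtype.val h
    obtain rfl := ha (X.color_eq hv)
    exact ⟨rfl, hv⟩
  · rintro ⟨rfl, h⟩
    exact side_congr h

lemma side_ne_side_not (ha : Function.Injective a) (σ : F) (i : Bool) :
    X.side a σ i ≠ X.side a σ !i := fun e => by
  simpa using ((side_eq_iff ha).1 e).1

lemma eqOn_range_of_side_eq (ha : Function.Injective a) {σ τ : F} {i : Bool}
    (h : X.side a σ i = X.side a τ i) (h' : (X.side a σ !i) = X.side a τ !i) :
    Set.EqOn (X.vtx σ) (X.vtx τ) (Set.range a) := by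
  rintro _ ⟨k, rfl⟩
  have hi := ((side_eq_iff ha).1 h).2
  have hi' := ((side_eq_iff ha).1 h').2
  cases i <;> cases k <;> assumption

lemma eq_of_eqOn_range (h : IsColorSplit a b) {σ τ : F}
    (ha : Set.EqOn (X.vtx σ) (X.vtx τ) (Set.range a))
    (hb : Set.EqOn (X.vtx σ) (X.vtx τ) (Set.range b)) : σ = τ :=
  X.injective <| funext fun c => (h.cover c).elim (fun hc => ha hc) fun hc => hb hc

lemma eq_of_eqOn_compl {σ τ : F} {c : Fin 4} (h : Set.EqOn (X.vtx σ) (X.vtx τ) {c}ᶜ)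
    (hc : X.vtx σ c = X.vtx τ c) : σ = τ :=
  X.injective <| funext fun d => if hd : d = c then hd ▸ hc else h hd

variable (X) in
/-- The facets, each given by its two vertices with colours in `a` and its two vertices with colours
in `b`. -/
def system (h : IsColorSplit a b) : FacetSystem (X.Side a) (X.Side b) where
  Fac x x' y y' := ∃ σ i j, x = X.side a σ i ∧ x' = X.side a σ (!i) ∧
    y = X.side b σ j ∧ y' = X.side b σ (!j)
  symm_left := by
    rintro _ _ _ _ ⟨σ, i, j, rfl, rfl, rfl, rfl⟩
    exact ⟨σ, !i, j, rfl, by rw [Bool.not_not], rfl, rfl⟩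
  symm_right := by
    rintro _ _ _ _ ⟨σ, i, j, rfl, rfl, rfl, rfl⟩
    exact ⟨σ, i, !j, rfl, rfl, rfl, by rw [Bool.not_not]⟩
  ne_left := by
    rintro _ _ _ _ ⟨σ, i, j, rfl, rfl, rfl, rfl⟩
    exact side_ne_side_not h.injective_left σ i
  ne_right := by
    rintro _ _ _ _ ⟨σ, i, j, rfl, rfl, rfl, rfl⟩
    exact side_ne_side_not h.injective_right σ j

lemma system_swap (h : IsColorSplit a b) : (X.system h).swap = X.system h.swap := by
  simp only [system, FacetSystem.swap, FacetSystem.mk.injEq]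
  funext y y' x x'
  refine propext ⟨?_, ?_⟩ <;>
  · rintro ⟨σ, i, j, hx, hx', hy, hy'⟩
    exact ⟨σ, j, i, hy, hy', hx, hx'⟩

section System

variable (h : IsColorSplit a b)

lemma fac_side (σ : F) (i j : Bool) :
    (X.system h).Fac (X.side a σ i) (X.side a σ !i) (X.side b σ j) (X.side b σ !j) :=
  ⟨σ, i, j, rfl, rfl, rfl, rfl⟩

lemma fac_side_of_eqOn {σ τ : F} {j : Bool} (hτ : Set.EqOn (X.vtx τ) (X.vtx σ) (Set.range b))
    (i : Bool) : (X.system h).Fac (X.side a τ i) (X.side a τ !i) (X.side b σ j) (X.side b σ !j) :=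
  ⟨τ, i, j, rfl, rfl, (side_congr (hτ ⟨j, rfl⟩)).symm, (side_congr (hτ ⟨_, rfl⟩)).symm⟩

lemma link_adj_side_of_eq {σ τ : F} {j : Bool} (hτ : X.vtx τ (b j) = X.vtx σ (b j)) (i : Bool) :
    ((X.system h).link (X.side b σ j)).Adj (X.side a τ i) (X.side a τ !i) :=
  ⟨X.side b τ !j, side_congr hτ ▸ fac_side h τ i j⟩

lemma exists_side_of_edgeLink_adj {x x' : X.Side a} {σ : F} {j : Bool}
    (hx : ((X.system h).edgeLink (X.side b σ j) (X.side b σ !j)).Adj x x') :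
    ∃ τ i, x = X.side a τ i ∧ x' = X.side a τ (!i) ∧
      Set.EqOn (X.vtx τ) (X.vtx σ) (Set.range b) := by
  obtain ⟨τ, i, j', rfl, rfl, hj, hj'⟩ := hx
  obtain ⟨rfl, -⟩ := (side_eq_iff h.injective_right).1 hj
  exact ⟨τ, i, rfl, rfl, (eqOn_range_of_side_eq h.injective_right hj hj').symm⟩

include h in
/-- Each of the two facets on either side of a common triangle has a vertex of the triangle with
colour in `a`. -/
lemma reachable_side (G : SimpleGraph (X.Side a)) (S : Set (Fin 4)) {σ τ : F}
    (hG : ∀ ρ, Set.EqOn (X.vtx ρ) (X.vtx σ) S → ∀ i, G.Adj (X.side a ρ i) (X.side a ρ !i))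
    (hτ : Set.EqOn (X.vtx τ) (X.vtx σ) S) (i j : Bool) :
    G.Reachable (X.side a σ i) (X.side a τ j) := by
  have hin (ρ) (hρ : Set.EqOn (X.vtx ρ) (X.vtx σ) S) (i j) :
      G.Reachable (X.side a ρ i) (X.side a ρ j) := by
    obtain rfl | rfl := Bool.eq_or_eq_not j i
    exacts [.refl _, (hG ρ hρ i).reachable]
  induction X.exists_chain S σ τ hτ generalizing j with
  | refl => exact hin σ (Set.eqOn_refl _ _) i j
  | tail _ hstep ih =>
    obtain ⟨hρ, hρ', c, hc⟩ := hstep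
    obtain ⟨k, hk⟩ : ∃ k, a k ≠ c := by
      by_contra! hcon
      exact Bool.false_ne_true (h.injective_left ((hcon _).trans (hcon _).symm))
    have hk' := ih hρ k
    rw [side_congr (hc hk)] at hk'
    exact hk'.trans (hin _ hρ' k j)

lemma exists_neighborSet_edgeLink_eq (σ : F) (i j : Bool) : ∃ τ ≠ σ,
    Set.EqOn (X.vtx τ) (X.vtx σ) {a !i}ᶜ ∧
    ((X.system h).edgeLink (X.side b σ j) (X.side b σ !j)).neighborSet (X.side a σ i) =
      {X.side a σ !i, X.side a τ !i} := by
  obtain ⟨τ, hne, hτ⟩ := X.exists_neighbor σ (a !i)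
  have hτσ := (hτ τ).2 (.inr rfl)
  refine ⟨τ, hne, hτσ, Set.ext fun x => ⟨fun hx => ?_, ?_⟩⟩
  · obtain ⟨ρ, i', hi, rfl, hb⟩ := exists_side_of_edgeLink_adj h hx
    obtain ⟨rfl, hvi⟩ := (side_eq_iff h.injective_left).1 hi
    have hρ : Set.EqOn (X.vtx ρ) (X.vtx σ) {a !i}ᶜ := by
      intro d hd
      obtain ⟨k, rfl⟩ | hd' := h.cover d
      · obtain rfl : k = i := by
          by_contra hk
          exact hd (by rw [Set.mem_singleton_iff, Bool.eq_not.2 hk])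
        exact hvi.symm
      · exact hb hd'
    exact ((hτ ρ).1 hρ).imp (fun e => by rw [e]) fun e => by rw [e, Set.mem_singleton_iff]
  · rintro (rfl | rfl)
    · exact fac_side h σ i j
    · have hi : X.side a τ i = X.side a σ i :=
        side_congr (hτσ fun e => by simpa using h.injective_left e)
      rw [← hi]
      refine fac_side_of_eqOn h (hτσ.mono ?_) i
      rintro _ ⟨k, rfl⟩ e
      exact h.ne _ _ (Set.mem_singleton_iff.1 e).symm

lemma isCycles_edgeLink_system (y y' : X.Side b) : ((X.system h).edgeLink y y').IsCycles := by
  rintro _ ⟨_, σ, i, j, rfl, rfl, rfl, rfl⟩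
  obtain ⟨τ, hne, hτ, hset⟩ := exists_neighborSet_edgeLink_eq h σ i j
  rw [hset, Set.ncard_pair]
  exact fun e => hne (eq_of_eqOn_compl hτ ((side_eq_iff h.injective_left).1 e).2.symm)

lemma connected_graph_system : (X.system h).graph.Connected := by
  obtain ⟨σ⟩ := X.nonempty
  have : Nonempty (X.Side a) := ⟨X.side a σ true⟩
  refine ⟨fun x x' => ?_⟩
  obtain ⟨σ, i, rfl⟩ := exists_eq_side x
  obtain ⟨τ, j, rfl⟩ := exists_eq_side x'
  exact reachable_side h (X.system h).graph ∅
    (fun ρ _ i => ⟨_, _, fac_side h ρ i true⟩) (Set.eqOn_empty _ _) i j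

lemma supportConnected_link_system (y : X.Side b) : SupportConnected ((X.system h).link y) := by
  rintro _ ⟨_, _, σ, i, j, rfl, rfl, rfl, rfl⟩ _ ⟨_, _, τ, i', j', rfl, rfl, hj, rfl⟩
  obtain ⟨rfl, hτ⟩ := (side_eq_iff h.injective_right).1 hj
  exact reachable_side h _ {b j} (fun ρ hρ => link_adj_side_of_eq h (hρ rfl))
    (Set.eqOn_singleton.2 hτ.symm) i i'

lemma supportConnected_edgeLink_system (y y' : X.Side b) :
    SupportConnected ((X.system h).edgeLink y y') := by
  rintro _ ⟨_, σ, i, j, rfl, rfl, rfl, rfl⟩ _ ⟨_, hv⟩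
  obtain ⟨τ, i', rfl, -, hτ⟩ := exists_side_of_edgeLink_adj h hv
  exact reachable_side h _ (Set.range b) (fun ρ hρ => fac_side_of_eqOn h hρ) hτ i i'

lemma neighbor_chain_system (y w w' : X.Side b) (hw : (X.system h).swap.graph.Adj y w)
    (hw' : (X.system h).swap.graph.Adj y w') :
    Relation.ReflTransGen (fun u v => ∃ x x', (X.system h).Fac x x' y u ∧
      (X.system h).Fac x x' y v) w w' := by
  obtain ⟨_, _, σ, i, j, rfl, rfl, rfl, rfl⟩ := hw
  obtain ⟨_, _, τ, i', j', rfl, rfl, hj, rfl⟩ := hw'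
  obtain ⟨rfl, hτ⟩ := (side_eq_iff h.injective_right).1 hj
  clear hj
  induction X.exists_chain {b j} σ τ (Set.eqOn_singleton.2 hτ.symm) with
  | refl => exact .refl
  | @tail ρ ρ' _ hstep ih =>
    obtain ⟨hρ, hρ', c, hc⟩ := hstep
    refine (ih (hρ rfl).symm).trans ?_
    by_cases hbc : (b !j) = c
    · refine .single ⟨X.side a ρ true, X.side a ρ !true, ?_, ?_⟩
      · rw [← side_congr (hρ rfl)]
        exact fac_side h ρ true j
      · have hside (k) : X.side a ρ k = X.side a ρ' k := side_congr (hc (hbc ▸ h.ne _ _))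
        rw [← side_congr (hρ' rfl), hside, hside]
        exact fac_side h ρ' true j
    · rw [side_congr (hc hbc)]

lemma halfNormal_system : (X.system h).HalfNormal where
  edgeLink_isCycles := isCycles_edgeLink_system h
  exists_adj x := by
    obtain ⟨σ, i, rfl⟩ := exists_eq_side x
    exact ⟨_, _, _, fac_side h σ i true⟩
  connected := connected_graph_system h
  link_connected := supportConnected_link_system h
  edgeLink_connected := supportConnected_edgeLink_system h
  neighbor_chain := neighbor_chain_system h

lemma normal_system : (X.system h).Normal where
  left := halfNormal_system h
  right := by
    rw [system_swap]
    exact halfNormal_system h.swap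

lemma ncard_orderedFacets_system : (X.system h).orderedFacets.ncard = 4 * Nat.card F := by
  let f : F × Bool × Bool → X.Side a × X.Side a × X.Side b × X.Side b := fun t =>
    (X.side a t.1 t.2.1, X.side a t.1 !t.2.1, X.side b t.1 t.2.2, X.side b t.1 !t.2.2)
  have hf : Function.Injective f := by
    rintro ⟨σ, i, j⟩ ⟨τ, i', j'⟩ e
    simp only [f, Prod.mk.injEq] at e
    obtain ⟨hi, hi', hj, hj'⟩ := e
    obtain ⟨rfl, -⟩ := (side_eq_iff h.injective_left).1 hi
    obtain ⟨rfl, -⟩ := (side_eq_iff h.injective_right).1 hj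
    rw [eq_of_eqOn_range h (eqOn_range_of_side_eq h.injective_left hi hi')
      (eqOn_range_of_side_eq h.injective_right hj hj')]
  have hrange : (X.system h).orderedFacets = Set.range f := by
    ext ⟨x, x', y, y'⟩
    constructor
    · rintro ⟨σ, i, j, rfl, rfl, rfl, rfl⟩
      exact ⟨(σ, i, j), rfl⟩
    · rintro ⟨⟨σ, i, j⟩, ⟨⟩⟩
      exact fac_side h σ i j
  rw [hrange, ← Nat.card_coe_set_eq, Nat.card_range_of_injective hf, Nat.card_prod, Nat.card_prod,
    Nat.card_eq_fintype_card (α := Bool), Fintype.card_bool]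
  ring

lemma two_mul_ncard_edgeSet_system_le [Finite F] :
    2 * (X.system h).graph.edgeSet.ncard + (X.system h).crossEdges.ncard ≤
      Nat.card F + 2 * Nat.card (X.Side a) := by
  have hle := (normal_system (X := X) h.swap).two_mul_ncard_edgeSet_le
    (ncard_orderedFacets_system h.swap)
  rwa [← FacetSystem.ncard_crossEdges_swap, system_swap h.swap] at hle

end System

section Dual

variable (X)

/-- The dual graph: two facets are adjacent when they share a triangle. -/
def dual : SimpleGraph F where
  Adj σ τ := σ ≠ τ ∧ ∃ c, Set.EqOn (X.vtx σ) (X.vtx τ) {c}ᶜ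
  symm := ⟨fun _ _ ⟨h, c, hc⟩ => ⟨h.symm, c, hc.symm⟩⟩
  loopless := ⟨fun _ h => h.1 rfl⟩

/-- The edges of the dual graph of colour `c` or `c'`, the colour of an edge being the one that its
triangle misses. -/
def bicolored (c c' : Fin 4) : SimpleGraph F where
  Adj σ τ := σ ≠ τ ∧ ∃ e, (e = c ∨ e = c') ∧ Set.EqOn (X.vtx σ) (X.vtx τ) {e}ᶜ
  symm := ⟨fun _ _ ⟨h, e, he, hστ⟩ => ⟨h.symm, e, he, hστ.symm⟩⟩
  loopless := ⟨fun _ h => h.1 rfl⟩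

variable {X}

lemma ncard_neighborSet_dual (σ : F) : (X.dual.neighborSet σ).ncard = 4 := by
  choose f hne hf using X.exists_neighbor σ
  have hfσ (c) : Set.EqOn (X.vtx (f c)) (X.vtx σ) {c}ᶜ := (hf c (f c)).2 (.inr rfl)
  have hinj : Function.Injective f := by
    intro c c' e
    by_contra hcc
    exact hne c (eq_of_eqOn_compl (hfσ c) (by rw [e]; exact hfσ c' hcc))
  have hrange : X.dual.neighborSet σ = Set.range f := by
    ext τ
    constructor
    · rintro ⟨hστ, c, hc⟩
      exact ⟨c, (((hf c τ).1 hc.symm).resolve_left hστ.symm).symm⟩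
    · rintro ⟨c, rfl⟩
      exact ⟨(hne c).symm, c, (hfσ c).symm⟩
  rw [hrange, ← Nat.card_coe_set_eq, Nat.card_range_of_injective hinj, Nat.card_fin]

lemma ncard_edgeSet_dual [Finite F] : X.dual.edgeSet.ncard = 2 * Nat.card F := by
  have := Fintype.ofFinite F
  have hsum := sum_ncard_neighborSet X.dual
  simp only [ncard_neighborSet_dual, Finset.sum_const, Finset.card_univ, smul_eq_mul] at hsum
  rw [Nat.card_eq_fintype_card]
  omega

lemma reachable_bicolored {c c' : Fin 4} {S : Set (Fin 4)} (hS : ∀ d, d ∈ S ∨ d = c ∨ d = c')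
    {σ τ : F} (hτ : Set.EqOn (X.vtx τ) (X.vtx σ) S) : (X.bicolored c c').Reachable σ τ := by
  induction X.exists_chain S σ τ hτ with
  | refl => exact .refl _
  | @tail ρ ρ' _ hstep ih =>
    obtain ⟨hρ, hρ', e, he⟩ := hstep
    refine (ih hρ).trans ?_
    by_cases hne : ρ = ρ'
    · rw [hne]
    · have heS : e ∉ S := fun heS => hne (eq_of_eqOn_compl he ((hρ heS).trans (hρ' heS).symm))
      exact SimpleGraph.Adj.reachable ⟨hne, e, (hS e).resolve_left heS, he⟩

/-- The cycles with colours `ε i` and `ε (i + 1)` surround the edges of the complex whose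
ends have the two other colours, one even and one odd. -/
lemma sum_card_connectedComponent_le [Finite F] (ε : Equiv.Perm (Fin 4)) :
    ∑ i : Fin 4, Nat.card (X.bicolored (ε i) (ε (i + 1))).ConnectedComponent ≤
      (X.system (isColorSplit_of_perm ε)).crossEdges.ncard := by
  have h := isColorSplit_of_perm ε
  let p : Fin 4 → Bool := ![true, false, false, true]
  let q : Fin 4 → Bool := ![true, true, false, false]
  have hpq : ∀ i j, p i = p j → q i = q j → i = j := by decide
  have hcov : ∀ i d, (d = cond (p i) 2 0 ∨ d = cond (q i) 3 1) ∨ d = i ∨ d = i + 1 := by decide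
  have hfin (i) : Finite (X.bicolored (ε i) (ε (i + 1))).ConnectedComponent := Quot.finite _
  rw [← Nat.card_sigma, ← Nat.card_coe_set_eq]
  refine Nat.card_le_card_of_injective (fun t => ⟨(X.side (evenColors ε) t.2.out (p t.1),
    X.side (oddColors ε) t.2.out (q t.1)), _, _, fac_side h t.2.out (p t.1) (q t.1)⟩) ?_
  rintro ⟨i, C⟩ ⟨j, C'⟩ e
  obtain ⟨heven, hodd⟩ := Prod.mk.inj (congrArg Subtype.val e)
  obtain ⟨hp, heven⟩ := (side_eq_iff h.injective_left).1 heven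
  obtain ⟨hq, hodd⟩ := (side_eq_iff h.injective_right).1 hodd
  obtain rfl := hpq i j hp hq
  have hr : (X.bicolored (ε i) (ε (i + 1))).Reachable C.out C'.out := by
    refine reachable_bicolored (S := {evenColors ε (p i), oddColors ε (q i)}) (fun d => ?_) ?_
    · obtain ⟨d, rfl⟩ := ε.surjective d
      simpa [evenColors, oddColors, ε.injective.eq_iff] using hcov i d
    · rintro _ (rfl | rfl)
      exacts [heven.symm, hodd.symm]
  rw [← Quot.out_eq C, ← Quot.out_eq C']
  exact congrArg (Sigma.mk _) (SimpleGraph.ConnectedComponent.sound hr)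

end Dual

end ColoredFacets

section Star

variable {E : Type*} [AddCommGroup E] [Module ℝ E] {K : SimplicialComplex ℝ E} {d : ℕ}

/-- The type of the facets of a complex. -/
abbrev Facet (K : SimplicialComplex ℝ E) : Type _ := {σ : Finset E // σ ∈ K.facets}

open Classical in
/-- Two facets in the star of `σ` that have at least `d` common vertices, so that in a complex of
dimension `d` they coincide or share a ridge. -/
def StarAdj (d : ℕ) (σ : Finset E) (s t : Facet K) : Prop :=
  σ ⊆ s.1 ∧ σ ⊆ t.1 ∧ d ≤ (s.1 ∩ t.1).card

open Classical in
lemma starAdj_of_le_card {σ : Finset E} {s t : Facet K} (hd : d ≤ σ.card) (hs : σ ⊆ s.1)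
    (ht : σ ⊆ t.1) : StarAdj d σ s t :=
  ⟨hs, ht, hd.trans (Finset.card_le_card (Finset.subset_inter hs ht))⟩

lemma StarAdj.anti {σ σ' : Finset E} (h : σ ⊆ σ') {s t : Facet K} (hst : StarAdj d σ' s t) :
    StarAdj d σ s t :=
  ⟨h.trans hst.1, h.trans hst.2.1, hst.2.2⟩

namespace IsNormalPseudomanifold

lemma exists_facet (hK : IsNormalPseudomanifold d K) {s : Finset E} (hs : s ∈ K.faces) :
    ∃ t : Facet K, s ⊆ t.1 := by
  obtain ⟨t, hst, ht⟩ := hK.finite.exists_le_maximal hs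
  exact ⟨⟨t, ht.prop, fun u hu htu => le_antisymm htu (ht.2 hu htu)⟩, hst⟩

lemma nonempty_facet (hK : IsNormalPseudomanifold (d + 1) K) : Nonempty (Facet K) := by
  obtain ⟨v⟩ := (hK.connected_link ∅ (.inl rfl) (by simp)).nonempty
  exact (hK.exists_facet v.2.1).nonempty

lemma finite_facet (hK : IsNormalPseudomanifold d K) : Finite (Facet K) :=
  (hK.finite.subset fun _ h => h.1).to_subtype

lemma exists_link_vertex (hK : IsNormalPseudomanifold d K) {σ : Finset E} (hσ : σ.card < d)
    {s : Facet K} (hσs : σ ⊆ s.1) : ∃ v : {v : E // {v} ∈ linkFaces K σ}, (v : E) ∈ s.1 := by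
  have hcard : σ.card < s.1.card := by
    rw [hK.pure s s.2]
    omega
  obtain ⟨v, hvs, hvσ⟩ := Finset.exists_mem_notMem_of_card_lt_card hcard
  have hvs' : {v} ⊆ s.1 := Finset.singleton_subset_iff.2 hvs
  refine ⟨⟨v, K.down_closed s.2.1 hvs' (Finset.singleton_nonempty v),
    Finset.disjoint_singleton_left.2 hvσ, K.down_closed s.2.1 ?_ ?_⟩, hvs⟩
  · classical exact Finset.union_subset hvs' hσs
  · classical exact (Finset.singleton_nonempty v).inl

open Classical in
lemma exists_chain_of_walk (hK : IsNormalPseudomanifold d K) {σ : Finset E}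
    (hchain : ∀ v ∉ σ, insert v σ ∈ K.faces → ∀ s t : Facet K, insert v σ ⊆ s.1 →
      insert v σ ⊆ t.1 → Relation.ReflTransGen (StarAdj d σ) s t)
    {v w : {v : E // {v} ∈ linkFaces K σ}} (p : (linkGraph K σ).Walk v w) {s t : Facet K}
    (hs : σ ⊆ s.1) (ht : σ ⊆ t.1) (hv : (v : E) ∈ s.1) (hw : (w : E) ∈ t.1) :
    Relation.ReflTransGen (StarAdj d σ) s t := by
  have hlink (u : {v : E // {v} ∈ linkFaces K σ}) {s t : Facet K} (hs : σ ⊆ s.1) (ht : σ ⊆ t.1)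
      (hus : (u : E) ∈ s.1) (hut : (u : E) ∈ t.1) : Relation.ReflTransGen (StarAdj d σ) s t :=
    hchain u (Finset.disjoint_singleton_left.1 u.2.2.1) u.2.2.2 s t (Finset.insert_subset hus hs)
      (Finset.insert_subset hut ht)
  induction p generalizing s with
  | nil => exact hlink _ hs ht hv hw
  | @cons u u' _ hadj _ ih =>
    obtain ⟨r, hr⟩ := hK.exists_facet hadj.2.2.2
    have hσr : σ ⊆ r.1 := Finset.union_subset_right hr
    have hu : (u : E) ∈ r.1 := hr (by simp)
    have hu' : (u' : E) ∈ r.1 := hr (by simp)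
    exact (hlink u hs hσr hv hu).trans (ih hσr hu' hw)

/-- Normality: induction on the codimension of the face `σ`, a walk in its link being followed by a
chain of facets. -/
lemma exists_chain (hK : IsNormalPseudomanifold d K) {σ : Finset E} (hσ : σ = ∅ ∨ σ ∈ K.faces)
    {s t : Facet K} (hs : σ ⊆ s.1) (ht : σ ⊆ t.1) :
    Relation.ReflTransGen (StarAdj d σ) s t := by
  classical
  induction hn : d - σ.card generalizing σ s t with
  | zero => exact .single (starAdj_of_le_card (by omega) hs ht)
  | succ n ih =>
    have hlt : σ.card < d := by omega
    obtain ⟨v, hv⟩ := hK.exists_link_vertex hlt hs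
    obtain ⟨w, hw⟩ := hK.exists_link_vertex hlt ht
    obtain ⟨p⟩ := (hK.connected_link σ hσ hlt).preconnected v w
    refine hK.exists_chain_of_walk (fun u hu hface s t hs ht => ?_) p hs ht hv hw
    exact Relation.ReflTransGen.mono (fun _ _ => StarAdj.anti (Finset.subset_insert u σ)) _ _
      (ih (.inr hface) hs ht (by rw [Finset.card_insert_of_notMem hu]; omega))

end IsNormalPseudomanifold

end Star

section ColorFace

variable {V C : Type*} {κ : V → C} {S : Set C} {σ : Finset V}

open Classical in
/-- The face of `σ` spanned by its vertices with colours in `S`. -/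
noncomputable def colorFace (κ : V → C) (S : Set C) (σ : Finset V) : Finset V :=
  {v ∈ σ | κ v ∈ S}

open Classical in
lemma mem_colorFace {v : V} : v ∈ colorFace κ S σ ↔ v ∈ σ ∧ κ v ∈ S :=
  Finset.mem_filter

lemma colorFace_subset : colorFace κ S σ ⊆ σ := fun _ hv => (mem_colorFace.1 hv).1

end ColorFace

section FacetVertex

variable {E : Type*} [AddCommGroup E] [Module ℝ E] {K : SimplicialComplex ℝ E} {κ : E → Fin 4}
  (hK : IsNormalPseudomanifold 3 K) (hκ : IsBalancedColoring 3 K κ)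

include hK hκ in
lemma exists_vertex_of_color (σ : Facet K) (c : Fin 4) : ∃ v ∈ σ.1, κ v = c := by
  have hcard : (σ.1.image κ).card = Fintype.card (Fin 4) := by
    rw [Finset.card_image_of_injOn (hκ σ σ.2.1), hK.pure σ σ.2, Fintype.card_fin]
  have hc : c ∈ σ.1.image κ := Finset.eq_univ_of_card _ hcard ▸ Finset.mem_univ c
  simpa only [Finset.mem_image] using hc

/-- The vertex of a given colour in a facet. -/
noncomputable def facetVertex (σ : Facet K) (c : Fin 4) : E :=
  (exists_vertex_of_color hK hκ σ c).choose

lemma facetVertex_mem (σ : Facet K) (c : Fin 4) : facetVertex hK hκ σ c ∈ σ.1 :=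
  (exists_vertex_of_color hK hκ σ c).choose_spec.1

lemma color_facetVertex (σ : Facet K) (c : Fin 4) : κ (facetVertex hK hκ σ c) = c :=
  (exists_vertex_of_color hK hκ σ c).choose_spec.2

lemma mem_facet_iff {σ : Facet K} {v : E} : v ∈ σ.1 ↔ facetVertex hK hκ σ (κ v) = v :=
  ⟨fun hv => hκ σ σ.2.1 (facetVertex_mem hK hκ σ _) hv (color_facetVertex hK hκ σ _),
    fun h => h ▸ facetVertex_mem hK hκ σ _⟩

lemma facetVertex_mem_iff {σ τ : Facet K} {c : Fin 4} :
    facetVertex hK hκ σ c ∈ τ.1 ↔ facetVertex hK hκ τ c = facetVertex hK hκ σ c := by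
  rw [mem_facet_iff hK hκ, color_facetVertex hK hκ]

lemma facetVertex_injective : Function.Injective (facetVertex hK hκ) := by
  intro σ τ h
  ext v
  rw [mem_facet_iff hK hκ, mem_facet_iff hK hκ, h]

lemma colorFace_eq_empty_or_mem_faces (S : Set (Fin 4)) (σ : Facet K) :
    colorFace κ S σ.1 = ∅ ∨ colorFace κ S σ.1 ∈ K.faces :=
  (colorFace κ S σ.1).eq_empty_or_nonempty.imp_right (K.down_closed σ.2.1 colorFace_subset)

lemma colorFace_subset_iff {S : Set (Fin 4)} {σ τ : Facet K} : colorFace κ S σ.1 ⊆ τ.1 ↔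
    Set.EqOn (facetVertex hK hκ τ) (facetVertex hK hκ σ) S := by
  refine ⟨fun h c hc => ?_, fun h v hv => ?_⟩
  · refine (facetVertex_mem_iff hK hκ).1 (h (mem_colorFace.2 ⟨facetVertex_mem hK hκ σ c, ?_⟩))
    rwa [color_facetVertex hK hκ]
  · obtain ⟨hvσ, hvS⟩ := mem_colorFace.1 hv
    rw [mem_facet_iff hK hκ, h hvS, (mem_facet_iff hK hκ).1 hvσ]

include hK hκ in
lemma card_colorFace_compl_singleton (c : Fin 4) (σ : Facet K) :
    (colorFace κ {c}ᶜ σ.1).card = 3 := by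
  classical
  have herase : colorFace κ {c}ᶜ σ.1 = σ.1.erase (facetVertex hK hκ σ c) := by
    ext v
    rw [mem_colorFace, Finset.mem_erase, and_comm]
    refine and_congr_left fun hv => not_congr ⟨?_, ?_⟩
    · rintro rfl
      exact ((mem_facet_iff hK hκ).1 hv).symm
    · rintro rfl
      exact color_facetVertex hK hκ σ c
  rw [herase, Finset.card_erase_of_mem (facetVertex_mem hK hκ σ c), hK.pure σ σ.2]

lemma exists_ne_eq_pair_of_ncard_eq_two {α : Type*} {s : Set α} (hs : s.ncard = 2) {a : α}
    (ha : a ∈ s) : ∃ b ≠ a, s = {a, b} := by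
  obtain ⟨x, y, hxy, rfl⟩ := Set.ncard_eq_two.1 hs
  obtain rfl | rfl := ha
  exacts [⟨y, hxy.symm, rfl⟩, ⟨x, hxy, Set.pair_comm _ _⟩]

lemma exists_neighbor_facet (σ : Facet K) (c : Fin 4) : ∃ τ ≠ σ, ∀ ρ,
    Set.EqOn (facetVertex hK hκ ρ) (facetVertex hK hκ σ) {c}ᶜ ↔ ρ = σ ∨ ρ = τ := by
  have hcard := card_colorFace_compl_singleton hK hκ c σ
  have hface : colorFace κ {c}ᶜ σ.1 ∈ K.faces :=
    (colorFace_eq_empty_or_mem_faces {c}ᶜ σ).resolve_left fun h => by simp [h] at hcard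
  obtain ⟨τ, hne, hset⟩ := exists_ne_eq_pair_of_ncard_eq_two (hK.two_facets _ hface hcard)
    ⟨σ.2, colorFace_subset⟩
  have hiff (ρ) := Set.ext_iff.1 hset ρ
  refine ⟨⟨τ, ((hiff τ).2 (.inr rfl)).1⟩, fun e => hne (congrArg Subtype.val e), fun ρ => ?_⟩
  rw [← colorFace_subset_iff, Subtype.ext_iff, Subtype.ext_iff]
  exact ⟨fun h => (hiff ρ).1 ⟨ρ.2, h⟩, fun h => ((hiff ρ).2 h).2⟩

open Classical in
lemma image_color_inter (σ τ : Facet K) : (σ.1 ∩ τ.1).image κ =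
    ({c | facetVertex hK hκ σ c = facetVertex hK hκ τ c} : Finset (Fin 4)) := by
  ext c
  simp only [Finset.mem_image, Finset.mem_inter, Finset.mem_filter, Finset.mem_univ, true_and]
  constructor
  · rintro ⟨v, ⟨hσ, hτ⟩, rfl⟩
    rw [(mem_facet_iff hK hκ).1 hσ, (mem_facet_iff hK hκ).1 hτ]
  · intro h
    exact ⟨_, ⟨facetVertex_mem hK hκ σ c, h ▸ facetVertex_mem hK hκ τ c⟩,
      color_facetVertex hK hκ σ c⟩

open Classical in
include hκ in
lemma card_image_color_inter (σ τ : Facet K) :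
    ((σ.1 ∩ τ.1).image κ).card = (σ.1 ∩ τ.1).card :=
  Finset.card_image_of_injOn ((hκ σ σ.2.1).mono (by simp))

open Classical in
lemma exists_eqOn_compl_of_card_inter {σ τ : Facet K} (h : 3 ≤ (σ.1 ∩ τ.1).card) :
    ∃ c, Set.EqOn (facetVertex hK hκ σ) (facetVertex hK hκ τ) {c}ᶜ := by
  rw [← card_image_color_inter hκ] at h
  have hcompl := Finset.card_compl ((σ.1 ∩ τ.1).image κ)
  rw [Fintype.card_fin] at hcompl
  obtain ⟨c, hc⟩ := Finset.card_le_one_iff_subset_singleton.1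
    (show (((σ.1 ∩ τ.1).image κ)ᶜ).card ≤ 1 by omega)
  refine ⟨c, fun d hd => ?_⟩
  have hmem : d ∈ (σ.1 ∩ τ.1).image κ := by
    by_contra hcon
    exact hd (Finset.mem_singleton.1 (hc (Finset.mem_compl.2 hcon)))
  rw [image_color_inter hK hκ] at hmem
  exact (Finset.mem_filter.1 hmem).2

/-- The facets of a balanced normal pseudomanifold of dimension three. -/
noncomputable def coloredFacets : ColoredFacets (Facet K) E where
  vtx := facetVertex hK hκ
  color_eq {σ τ c d} h := by rw [← color_facetVertex hK hκ σ c, h, color_facetVertex hK hκ]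
  injective := facetVertex_injective hK hκ
  exists_neighbor := exists_neighbor_facet hK hκ
  exists_chain S σ τ h := by
    refine Relation.ReflTransGen.mono (fun s t hst => ?_) _ _ (hK.exists_chain
      (colorFace_eq_empty_or_mem_faces S σ) colorFace_subset
      ((colorFace_subset_iff hK hκ).2 h))
    exact ⟨(colorFace_subset_iff hK hκ).1 hst.1, (colorFace_subset_iff hK hκ).1 hst.2.1,
      exists_eqOn_compl_of_card_inter hK hκ hst.2.2⟩
  nonempty := hK.nonempty_facet

end FacetVertex

section Genus

variable {E : Type*} [AddCommGroup E] [Module ℝ E] {K : SimplicialComplex ℝ E} {κ : E → Fin 4}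
  (hK : IsNormalPseudomanifold 3 K) (hκ : IsBalancedColoring 3 K κ)

open Classical in
lemma image_color_inter_of_eqOn {σ τ : Facet K} (hne : σ ≠ τ) {c : Fin 4}
    (h : Set.EqOn ((coloredFacets hK hκ).vtx σ) ((coloredFacets hK hκ).vtx τ) {c}ᶜ) :
    (σ.1 ∩ τ.1).image κ = {c}ᶜ := by
  rw [image_color_inter hK hκ]
  ext d
  simp only [Finset.mem_filter, Finset.mem_univ, true_and, Finset.mem_compl, Finset.mem_singleton]
  refine ⟨?_, fun hd => h hd⟩
  rintro hd rfl
  exact hne (ColoredFacets.eq_of_eqOn_compl h hd)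

lemma dualGraph_eq : dualGraph 3 K = (coloredFacets hK hκ).dual := by
  classical
  ext σ τ
  refine and_congr_right fun hne => ⟨fun hcard => ?_, fun ⟨c, hc⟩ => ?_⟩
  · exact exists_eqOn_compl_of_card_inter hK hκ (by convert hcard.ge)
  · have himage := image_color_inter_of_eqOn hK hκ hne hc
    rw [← card_image_color_inter hκ, himage, Finset.card_compl]
    rfl

lemma bicolored_le_bicoloredGraph (c c' : Fin 4) :
    (coloredFacets hK hκ).bicolored c c' ≤ bicoloredGraph 3 K κ c c' := by
  rintro σ τ ⟨hne, e, he, hστ⟩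
  refine ⟨?_, e, he, image_color_inter_of_eqOn hK hκ hne hστ⟩
  rw [dualGraph_eq hK hκ]
  exact ⟨hne, e, hστ⟩

lemma bicoloredCycleCount_le (c c' : Fin 4) : bicoloredCycleCount 3 K κ c c' ≤
    Nat.card ((coloredFacets hK hκ).bicolored c c').ConnectedComponent := by
  have := hK.finite_facet
  have : Finite ((coloredFacets hK hκ).bicolored c c').ConnectedComponent := Quot.finite _
  exact Nat.card_le_card_of_surjective
    (SimpleGraph.ConnectedComponent.map (.ofLE (bicolored_le_bicoloredGraph hK hκ c c')))
    (SimpleGraph.ConnectedComponent.surjective_map_ofLE _)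

lemma surfaceEulerChar_add_le (ε : Equiv.Perm (Fin 4)) :
    surfaceEulerChar 3 K κ ε + Nat.card (Facet K) ≤
      ((coloredFacets hK hκ).system (isColorSplit_of_perm ε)).crossEdges.ncard := by
  have := hK.finite_facet
  have hcycles : ∑ i, bicoloredCycleCount 3 K κ (ε i) (ε (i + 1)) ≤ _ :=
    (Finset.sum_le_sum fun i _ => bicoloredCycleCount_le hK hκ (ε i) (ε (i + 1))).trans
      (ColoredFacets.sum_card_connectedComponent_le ε)
  rw [surfaceEulerChar, dualGraph_eq hK hκ, ColoredFacets.ncard_edgeSet_dual]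
  zify at hcycles
  push_cast
  linarith

lemma ncard_edgeSet_add_one_le_balancedGenusAt (ε : Equiv.Perm (Fin 4)) {a b : Bool → Fin 4}
    (h : IsColorSplit a b) (hcross : ((coloredFacets hK hκ).system h).crossEdges.ncard =
      ((coloredFacets hK hκ).system (isColorSplit_of_perm ε)).crossEdges.ncard) :
    (((coloredFacets hK hκ).system h).graph.edgeSet.ncard : ℝ) + 1 ≤
      balancedGenusAt 3 K κ ε + Nat.card ((coloredFacets hK hκ).Side a) := by
  have := hK.finite_facet
  have hedges := ColoredFacets.two_mul_ncard_edgeSet_system_le (X := coloredFacets hK hκ) h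
  have heuler := surfaceEulerChar_add_le hK hκ ε
  rw [hcross] at hedges
  rify at hedges heuler
  rw [balancedGenusAt]
  linarith

lemma nonempty_realization_system_homeomorph [TopologicalSpace E] [T2Space E] [ContinuousAdd E]
    [ContinuousSMul ℝ E] {a b : Bool → Fin 4} (h : IsColorSplit a b)
    [Fintype ((coloredFacets hK hκ).Side a)] [Fintype ((coloredFacets hK hκ).Side b)]
    [DecidableEq ((coloredFacets hK hκ).Side a)] [DecidableEq ((coloredFacets hK hκ).Side b)] :
    Nonempty (Realization ((coloredFacets hK hκ).system h).simplices ≃ₜ K.space) := by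
  classical
  refine nonempty_realization_homeomorph_space (pos := Sum.elim
    (fun x : (coloredFacets hK hκ).Side a => x.1) fun y : (coloredFacets hK hκ).Side b => y.1)
    (Function.Injective.sumElim Subtype.val_injective Subtype.val_injective ?_) ?_ ?_
  · rintro ⟨_, σ, i, rfl⟩ ⟨_, τ, j, rfl⟩ e
    exact h.ne i j ((coloredFacets hK hκ).color_eq e)
  · rintro _ ⟨_, _, _, _, ⟨σ, i, j, rfl, rfl, rfl, rfl⟩, rfl⟩
    refine K.down_closed σ.2.1 (fun v hv => ?_) (by simp)
    simp only [Finset.image_insert, Finset.image_singleton, Finset.mem_insert,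
      Finset.mem_singleton] at hv
    rcases hv with rfl | rfl | rfl | rfl <;> exact facetVertex_mem hK hκ σ _
  · intro t ht
    obtain ⟨σ, hσ⟩ := hK.exists_facet ht
    refine ⟨_, ⟨_, _, _, _, ColoredFacets.fac_side h σ true true, rfl⟩, fun v hv => ?_⟩
    simp only [Finset.image_insert, Finset.image_singleton, Finset.mem_insert,
      Finset.mem_singleton]
    rw [← (mem_facet_iff hK hκ).1 (hσ hv)]
    obtain ⟨_ | _, hi⟩ | ⟨_ | _, hi⟩ := h.cover (κ v) <;> rw [← hi]
    exacts [.inr (.inl rfl), .inl rfl, .inr (.inr (.inr rfl)), .inr (.inr (.inl rfl))]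

end Genus

lemma FacetSystem.Normal.pathConnectedSpace {A B : Type*} [Fintype A] [Fintype B]
    [DecidableEq A] [DecidableEq B] {C : FacetSystem A B} (hC : C.Normal) :
    PathConnectedSpace (Realization C.simplices) := by
  obtain ⟨x₀⟩ := hC.left.connected.nonempty
  have hgraph (x) : Relation.ReflTransGen
      (fun u w : A ⊕ B => ∃ s ∈ C.simplices, u ∈ s ∧ w ∈ s) (.inl x₀) (.inl x) := by
    refine Relation.ReflTransGen.lift Sum.inl ?_ _ _
      ((SimpleGraph.reachable_iff_reflTransGen _ _).1 (hC.left.connected.preconnected x₀ x))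
    rintro u w ⟨y, y', h⟩
    exact ⟨_, ⟨_, _, _, _, h, rfl⟩, by simp, by simp⟩
  refine pathConnectedSpace_realization (v₀ := .inl x₀) ?_ ?_
  · obtain ⟨x', y, y', h⟩ := hC.left.exists_adj x₀
    exact ⟨_, ⟨_, _, _, _, h, rfl⟩, by simp⟩
  · rintro (x | y)
    · exact hgraph x
    · obtain ⟨y', x, x', h⟩ := hC.right.exists_adj y
      exact (hgraph x).tail ⟨_, ⟨_, _, _, _, h, rfl⟩, by simp, by simp⟩

lemma coe_add_natCast_le_of_add_le {r : ℕ∞} {k n m : ℕ} {g : ℝ} (h : r + k + n ≤ m)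
    (hg : (m : ℝ) ≤ g + n) : ((r : ENNReal) : EReal) + k ≤ g := by
  have hr : r ≠ ⊤ := by
    rintro rfl
    simp at h
  lift r to ℕ using hr
  have hrk : (r : ℝ) + k ≤ g := by
    have hm : r + k + n ≤ m := by exact_mod_cast h
    rify at hm
    linarith
  have hcoe : (((r : ℕ∞) : ENNReal) : EReal) + k = ((r + k : ℝ) : EReal) := by
    push_cast
    rfl
  rw [hcoe]
  exact EReal.coe_le_coe_iff.2 hrk

lemma groupRank_add_three_le_balancedGenusAt {E : Type*} [AddCommGroup E] [Module ℝ E]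
    [TopologicalSpace E] [T2Space E] [ContinuousAdd E] [ContinuousSMul ℝ E]
    {K : SimplicialComplex ℝ E} {κ : E → Fin 4} (hK : IsNormalPseudomanifold 3 K)
    (hκ : IsBalancedColoring 3 K κ) (ε : Equiv.Perm (Fin 4)) {a b : Bool → Fin 4}
    (h : IsColorSplit a b) (hcross : ((coloredFacets hK hκ).system h).crossEdges.ncard =
      ((coloredFacets hK hκ).system (isColorSplit_of_perm ε)).crossEdges.ncard)
    (hR : ¬((coloredFacets hK hκ).system h).NoRemovableTriple) {M : Type*} [TopologicalSpace M]
    (e : K.space ≃ₜ M) (x : M) :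
    ((groupRank (FundamentalGroup M x) : ENNReal) : EReal) + 3 ≤ balancedGenusAt 3 K κ ε := by
  classical
  have := hK.finite_facet
  have := Fintype.ofFinite ((coloredFacets hK hκ).Side a)
  have := Fintype.ofFinite ((coloredFacets hK hκ).Side b)
  have hC := ColoredFacets.normal_system (X := coloredFacets hK hκ) h
  obtain ⟨f⟩ := nonempty_realization_system_homeomorph hK hκ h
  have := hC.pathConnectedSpace
  have := (f.trans e).surjective.pathConnectedSpace (f.trans e).continuous
  obtain ⟨R, hR, hcard, hrem⟩ := not_not.1 hR
  have hrank := hC.groupRank_fundamentalGroup_le (f.trans e) x hR hrem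
  rw [hcard] at hrank
  have hgenus := ncard_edgeSet_add_one_le_balancedGenusAt hK hκ ε h hcross
  exact_mod_cast coe_add_natCast_le_of_add_le (by exact_mod_cast hrank) (by exact_mod_cast hgenus)

lemma nonempty_space_homeomorph_sphere {E : Type*} [AddCommGroup E] [Module ℝ E]
    [TopologicalSpace E] [T2Space E] [ContinuousAdd E] [ContinuousSMul ℝ E]
    {K : SimplicialComplex ℝ E} {κ : E → Fin 4} (hK : IsNormalPseudomanifold 3 K)
    (hκ : IsBalancedColoring 3 K κ) {a b : Bool → Fin 4} (h : IsColorSplit a b)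
    (ha : ((coloredFacets hK hκ).system h).NoRemovableTriple)
    (hb : ((coloredFacets hK hκ).system h.swap).NoRemovableTriple) :
    Nonempty (K.space ≃ₜ Metric.sphere (0 : EuclideanSpace ℝ (Fin 4)) 1) := by
  classical
  have := hK.finite_facet
  have := Fintype.ofFinite ((coloredFacets hK hκ).Side a)
  have := Fintype.ofFinite ((coloredFacets hK hκ).Side b)
  obtain ⟨f⟩ := nonempty_realization_system_homeomorph hK hκ h
  rw [← ColoredFacets.system_swap h] at hb
  obtain ⟨f'⟩ := (ColoredFacets.normal_system h).nonempty_homeomorph_sphere ha hb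
  exact ⟨f.symm.trans f'⟩

theorem theorem1p1_general (M : Type*) [TopologicalSpace M]
    (hM : IsEmpty (M ≃ₜ Metric.sphere (0 : EuclideanSpace ℝ (Fin 4)) 1)) (x : M) :
    ((groupRank (FundamentalGroup M x) : ENNReal) : EReal) + 3 ≤ balancedGenus 3 M := by
  refine le_iInf fun T => ?_
  obtain ⟨ε, -, hε⟩ := Finset.exists_mem_eq_inf' (Finset.univ_nonempty (α := Equiv.Perm (Fin 4)))
    (balancedGenusAt 3 T.complex T.color)
  rw [complexBalancedGenus, hε]
  have h := isColorSplit_of_perm ε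
  by_cases heven : ((coloredFacets T.normal T.balanced).system h).NoRemovableTriple
  · by_cases hodd : ((coloredFacets T.normal T.balanced).system h.swap).NoRemovableTriple
    · obtain ⟨f⟩ := nonempty_space_homeomorph_sphere T.normal T.balanced h heven hodd
      exact hM.elim (T.homeo.symm.trans f)
    · refine groupRank_add_three_le_balancedGenusAt T.normal T.balanced ε h.swap ?_ hodd T.homeo x
      rw [← ColoredFacets.system_swap h, FacetSystem.ncard_crossEdges_swap]
  · exact groupRank_add_three_le_balancedGenusAt T.normal T.balanced ε h rfl heven T.homeo x

theorem theorem1p1 (M : Type*) [TopologicalSpace M] [T2Space M] [SecondCountableTopology M]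
    [ChartedSpace (EuclideanSpace ℝ (Fin 3)) M] [CompactSpace M] [ConnectedSpace M]
    (hM : IsEmpty (M ≃ₜ Metric.sphere (0 : EuclideanSpace ℝ (Fin 4)) 1)) (x : M) :
    ((groupRank (FundamentalGroup M x) : ENNReal) : EReal) + 3 ≤ balancedGenus 3 M :=
  theorem1p1_general M hM x
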